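/- **Setting.** Let $X\subseteq\mathbb R^d$ be closed and convex, and consider $\min_{x\in X}F(x)$, $F(x)=\frac1n\sum_{i=1}^n f_i(g_i(x))+r(x)$, where $g_i(x)=\mathbb E_{\zeta\sim\mathbb P_i}[g_i(x;\zeta)]\in\mathbb R^m$. Let $\|\cdot\|$ be a norm on $\mathbb R^m$ with dual norm $\|\cdot\|_*$, such that $\frac12\|\cdot\|_2^2$ is $\mu_\psi$-strongly convex and $L_\psi$-smooth with respect to $\|\cdot\|$, that is, $\mu_\psi\|v\|^2\le\|v\|_2^2\le L_\psi\|v\|^2$ (for the Euclidean norm, $\mu_\psi=L_\psi=1$). Assume: * $r:X\to(-\infty,+\infty]$ is proper, lower semicontinuous and convex. * Every $g_i$ is (coordinatewise) convex on $X$, differentiable on $X$, with $\|g_i(x)-g_i(x')\|_*\le C_g\|x-x'\|_2$ and $\|g_i(x)-g_i(x')-\nabla g_i(x')(x-x')\|_*\le\frac{L_g}{2}\|x-x'\|_2^2$ for $x,x'\in X$. * Every $f_i:\mathbb R^m\to\mathbb R$ is convex (possibly non-smooth), with $|f_i(u)-f_i(u')|\le C_f\|u-u'\|_*$, and $f_i$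 is non-decreasing in each coordinate unless $g_i$ is affine on $X$. * The first-order oracle $g_i'(x;\zeta)$ is unbiased, $\mathbb E_{\zeta\sim\mathbb P_i}[g_i'(x;\zeta)]=\nabla g_i(x)$ for $x\in X$. With $\mathcal Y_i$ the (compact, convex) closure of the domain of the convex conjugate $f_i^*$, for all $x\in X$ and $y\in\mathcal Y_1\times\dots\times\mathcal Y_n$: $\mathbb E\|g_i(x)-g_i(x;\zeta)\|_*^2\le\sigma_0^2$, $\ \mathbb E\|\nabla g_i(x)-g_i'(x;\zeta)\|_{\mathrm{op}}^2\le\sigma_1^2$ (operator norm from $\|\cdot\|_2$ to $\|\cdot\|_*$), and $\frac1n\sum_{j}\big\|\nabla g_j(x)^\top y^{(j)}-\frac1n\sum_i\nabla g_i(x)^\top y^{(i)}\big\|_2^2\le\delta^2$. **Algorithm (ALEXR with $\psi_i=\frac12\|\cdot\|_2^2$, $\theta=1$).** Let $1\le S\le n$ and $B\ge1$. Start at deterministic $x_0\in X$, $y_0\in\mathcal Y_1\times\dots\times\mathcal Y_n$, and put $x_{-1}=x_0$. In iteration $t=0,1,\dots$ draw, independently of the past, a uniformly random $\mathcal S_t\subseteq\{1,\dots,n\}$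 with $|\mathcal S_t|=S$ and, for each $i$, two independent batches $\mathcal B_t^{(i)},\tilde{\mathcal B}_t^{(i)}$ of $B$ i.i.d. samples from $\mathbb P_i$ (independent also over $i$ and of $\mathcal S_t$; only those with $i\in\mathcal S_t$ are used). Writing $g_i(x;\mathcal B)$ and $g_i'(x;\mathcal B)$ for batch averages, set $$y_{t+1}^{(i)}=\arg\max_{v\in\mathcal Y_i}\Big\{\big\langle v,\;2g_i(x_t;\mathcal B_t^{(i)})-g_i(x_{t-1};\mathcal B_t^{(i)})\big\rangle-f_i^*(v)-\tfrac\tau2\|v-y_t^{(i)}\|_2^2\Big\}\ (i\in\mathcal S_t),\qquad y_{t+1}^{(i)}=y_t^{(i)}\ (i\notin\mathcal S_t),$$ $$G_t=\frac1S\sum_{i\in\mathcal S_t}[g_i'(x_t;\tilde{\mathcal B}_t^{(i)})]^\top y_{t+1}^{(i)},\qquad x_{t+1}=\arg\min_{x\in X}\Big\{\langle G_t,x\rangle+r(x)+\tfrac\eta2\|x-x_t\|_2^2\Big\}.$$ Let $\bar x_T=\frac1T\sum_{t=0}^{T-1}x_{t+1}$, and let $\tilde y_T$ be any measurable selection with $\tilde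 y_T^{(i)}\in\arg\max_{v\in\mathcal Y_i}\{\langle v,g_i(\bar x_T)\rangle-f_i^*(v)\}$. Put $\Omega_{\mathcal Y}^0=\mathbb E\big[\sum_{i=1}^n\frac12\|\tilde y_T^{(i)}-y_0^{(i)}\|_2^2\big]$. **Theorem.** There is a constant $C>0$, depending only on $C_f,C_g,L_g,\sigma_0,\sigma_1,\delta,\mu_\psi,L_\psi$ and a bound $D$, and for all $S,B\ge1$ there is $\varepsilon_0>0$, depending only on the same constants and on $S,B$, such that for every $\varepsilon\in(0,\varepsilon_0]$ there are parameters $0<\eta\le C/\varepsilon$ and $0<\tau\le C/(B\varepsilon)$, depending only on the same constants and on $S$, $B$, $\varepsilon$, with the following property. For every problem as above with $n\ge S$ and a minimizer $x_*$ of $F$ on $X$ with $\|x_0-x_*\|_2\le D$, and every number of iterations $$T\ \ge\ C\,\max\Big\{\frac1S,\ \frac{\Omega_{\mathcal Y}^0}{BS}\Big\}\,\frac1{\varepsilon^2},$$ the algorithm with these $\eta,\tau$ satisfies $\mathbb E[F(\bar x_T)-F(x_*)]\le\varepsilon$. -/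

import Mathlib

open MeasureTheory ProbabilityTheory
open scoped ENNReal RealInnerProductSpace

noncomputable section

namespace ALEXR

/-- Euclidean space of dimension `k`. -/
abbrev Vec (k : ℕ) : Type := EuclideanSpace ℝ (Fin k)

/-- Subsets of the finite index set carry the discrete measurable structure. -/
instance instMeasurableSpaceFinsetFin (n : ℕ) : MeasurableSpace (Finset (Fin n)) := ⊤

instance instDiscreteFinsetFin (n : ℕ) : DiscreteMeasurableSpace (Finset (Fin n)) :=
  ⟨fun _ => trivial⟩

/-! ### Norms, conjugates, Bregman divergences -/

/-- The norm dual to `q`: `‖u‖_* = sup {⟪u, v⟫ : q v ≤ 1}`. -/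
def dualNorm {m : ℕ} (q : Seminorm ℝ (Vec m)) (u : Vec m) : ℝ :=
  ⨆ v : {v : Vec m // q v ≤ 1}, ⟪u, (v : Vec m)⟫

/-- The operator norm of a linear map from Euclidean space to the dual of the space normed by `q`.
It equals the operator norm of the adjoint, from the space normed by `q` to Euclidean space. -/
def opNorm {d m : ℕ} (q : Seminorm ℝ (Vec m)) (A : Vec d →L[ℝ] Vec m) : ℝ :=
  ⨆ x : {x : Vec d // ‖x‖ ≤ 1}, dualNorm q (A x)

/-- The convex conjugate `f^*`, with values in the extended reals. -/
def conj {m : ℕ} (f : Vec m → ℝ) (v : Vec m) : EReal :=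
  ⨆ u : Vec m, ((⟪v, u⟫ - f u : ℝ) : EReal)

/-- The block of the dual feasible set that belongs to `f`: the closure of the effective domain of
`f^*` (convex, and compact when `f` is Lipschitz). -/
def dualSet {m : ℕ} (f : Vec m → ℝ) : Set (Vec m) :=
  closure {v | conj f v < ⊤}

/-- The Bregman divergence `U_ψ(u, v) = ψ u - ψ v - ⟪∇ψ(v), u - v⟫`. -/
def bregman {m : ℕ} (ψ : Vec m → ℝ) (u v : Vec m) : ℝ :=
  ψ u - ψ v - ⟪gradient ψ v, u - v⟫

/-- The quadratic distance-generating function `½‖·‖₂²`. -/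
def quad {m : ℕ} (v : Vec m) : ℝ := (1 / 2) * ‖v‖ ^ 2

theorem bregman_quad {m : ℕ} (u v : Vec m) : bregman quad u v = (1 / 2) * ‖u - v‖ ^ 2 := by
  have h : HasGradientAt (quad (m := m)) v v := by
    rw [hasGradientAt_iff_hasFDerivAt]
    have h1 := ((hasStrictFDerivAt_norm_sq v).hasFDerivAt).const_mul (1 / 2 : ℝ)
    refine h1.congr_fderiv ?_
    ext w
    simp
  rw [bregman, h.gradient, norm_sub_sq_real, inner_sub_right, real_inner_self_eq_norm_sq,
    real_inner_comm]
  simp only [quad]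
  ring

/-! ### The problem -/

/-- The data of a finite-sum coupled compositional problem with `n` summands, `x` in dimension `d`
and inner functions with values in dimension `m`. Functions of `x` are only looked at on `X`. -/
structure Problem (n d m : ℕ) (Z : Type*) [MeasurableSpace Z] where
  /-- the feasible set -/
  X : Set (Vec d)
  /-- the outer functions `f_i` -/
  f : Fin n → Vec m → ℝ
  /-- the distribution of the samples of the `i`-th inner function -/
  P : Fin n → Measure Z
  /-- the zeroth-order stochastic oracle `g_i(x; ζ)` -/
  gs : Fin n → Vec d → Z → Vec m
  /-- the first-order stochastic oracle `g_i'(x; ζ)` -/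
  dgs : Fin n → Vec d → Z → Vec d →L[ℝ] Vec m
  /-- the derivative of the inner function `g_i` on `X` -/
  dg : Fin n → Vec d → Vec d →L[ℝ] Vec m
  /-- the regularizer, which may take the value `+∞` -/
  r : Vec d → EReal

variable {n d m : ℕ} {Z : Type*} [MeasurableSpace Z]

/-- The inner function `g_i(x) = E[g_i(x; ζ)]`. -/
def Problem.g (p : Problem n d m Z) (i : Fin n) (x : Vec d) : Vec m :=
  ∫ ζ, p.gs i x ζ ∂(p.P i)

/-- The objective `F(x) = (1/n) ∑ f_i(g_i(x)) + r(x)`. -/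
def Problem.F (p : Problem n d m Z) (x : Vec d) : EReal :=
  (((1 / (n : ℝ)) * ∑ i, p.f i (p.g i x) : ℝ) : EReal) + p.r x

/-- The standing assumptions, with smooth inner functions, with respect to the norm `q` on the dual
blocks. -/
structure Problem.Assumptions (p : Problem n d m Z) (q : Seminorm ℝ (Vec m))
    (Cf Cg Lg σ₀ σ₁ δ : ℝ) : Prop where
  /- the domain and the regularizer: `r` is proper, lower semicontinuous and convex on `X` -/
  convex_X : Convex ℝ p.X
  closed_X : IsClosed p.X
  r_ne_bot : ∀ x ∈ p.X, p.r x ≠ ⊥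
  r_proper : ∃ x ∈ p.X, p.r x ≠ ⊤
  r_lsc : LowerSemicontinuousOn p.r p.X
  r_convex : ∀ x ∈ p.X, ∀ z ∈ p.X, ∀ a b : ℝ, 0 < a → 0 < b → a + b = 1 →
    p.r (a • x + b • z) ≤ (a : EReal) * p.r x + (b : EReal) * p.r z
  /- the samples and the measurability of the oracles -/
  prob : ∀ i, IsProbabilityMeasure (p.P i)
  gs_meas : ∀ i, Measurable fun w : Vec d × Z => p.gs i w.1 w.2
  dgs_meas : ∀ i, Measurable fun w : Vec d × Z => p.dgs i w.1 w.2
  /- the inner functions are convex, Lipschitz and smooth on `X` -/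
  g_convex : ∀ i k, ConvexOn ℝ p.X fun x => p.g i x k
  g_lip : ∀ i, ∀ x ∈ p.X, ∀ z ∈ p.X, dualNorm q (p.g i x - p.g i z) ≤ Cg * ‖x - z‖
  g_deriv : ∀ i, ∀ x ∈ p.X, HasFDerivWithinAt (p.g i) (p.dg i x) p.X x
  g_smooth : ∀ i, ∀ x ∈ p.X, ∀ z ∈ p.X,
    dualNorm q (p.g i x - p.g i z - p.dg i z (x - z)) ≤ Lg / 2 * ‖x - z‖ ^ 2
  /- the outer functions are convex and Lipschitz, and monotone unless `g_i` is affine on `X` -/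
  f_convex : ∀ i, ConvexOn ℝ Set.univ (p.f i)
  f_lip : ∀ i u v, |p.f i u - p.f i v| ≤ Cf * dualNorm q (u - v)
  f_mono : ∀ i, (∀ u v : Vec m, (∀ k, u k ≤ v k) → p.f i u ≤ p.f i v) ∨
    ∃ A : Vec d →ᵃ[ℝ] Vec m, Set.EqOn (p.g i) A p.X
  /- the first-order oracle is unbiased, and the variances are bounded -/
  dgs_unbiased : ∀ i, ∀ x ∈ p.X, ∫ ζ, p.dgs i x ζ ∂(p.P i) = p.dg i x
  var_zero : ∀ i, ∀ x ∈ p.X,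
    ∫⁻ ζ, ENNReal.ofReal (dualNorm q (p.g i x - p.gs i x ζ) ^ 2) ∂(p.P i)
      ≤ ENNReal.ofReal (σ₀ ^ 2)
  var_one : ∀ i, ∀ x ∈ p.X,
    ∫⁻ ζ, ENNReal.ofReal (opNorm q (p.dg i x - p.dgs i x ζ) ^ 2) ∂(p.P i)
      ≤ ENNReal.ofReal (σ₁ ^ 2)
  var_block : ∀ x ∈ p.X, ∀ y : Fin n → Vec m, (∀ i, y i ∈ dualSet (p.f i)) →
    (1 / (n : ℝ)) * ∑ j, ‖(p.dg j x).adjoint (y j)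
      - (1 / (n : ℝ)) • ∑ i, (p.dg i x).adjoint (y i)‖ ^ 2 ≤ δ ^ 2

/-! ### The algorithm -/

/-- The randomness of one iteration: the sampled block set, and for each block `i` the batches
`𝓑ᵢ` and `𝓑̃ᵢ`. Only the batches of sampled blocks are used by the algorithm. -/
abbrev Sample (n B : ℕ) (Z : Type*) : Type _ :=
  Finset (Fin n) × (Fin n → Fin B → Z) × (Fin n → Fin B → Z)

/-- The law of the randomness of one iteration: the block set is uniform among the subsets of size
`S`, all entries of the batches of block `i` have law `P_i`, and everything is independent. -/
def Problem.sampleLaw (p : Problem n d m Z) (S B : ℕ) : Measure (Sample n B Z) :=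
  (uniformOn ((Finset.univ.powersetCard S : Finset (Finset (Fin n))) :
      Set (Finset (Fin n)))).prod
    ((Measure.pi fun i => Measure.pi fun _ : Fin B => p.P i).prod
      (Measure.pi fun i => Measure.pi fun _ : Fin B => p.P i))

/-- The mini-batch estimator `g_i(x; 𝓑)`. -/
def Problem.gBatch (p : Problem n d m Z) {B : ℕ} (i : Fin n) (x : Vec d) (b : Fin B → Z) :
    Vec m :=
  (1 / (B : ℝ)) • ∑ j, p.gs i x (b j)

/-- The mini-batch estimator `g_i'(x; 𝓑)`. -/
def Problem.dgBatch (p : Problem n d m Z) {B : ℕ} (i : Fin n) (x : Vec d) (b : Fin B → Z) :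
    Vec d →L[ℝ] Vec m :=
  (1 / (B : ℝ)) • ∑ j, p.dgs i x (b j)

/-- The extrapolated estimator `g_i(x; 𝓑) + θ (g_i(x; 𝓑) - g_i(x'; 𝓑))`, where `x'` is the
previous iterate. -/
def Problem.gExtra (p : Problem n d m Z) {B : ℕ} (θ : ℝ) (i : Fin n) (x xprev : Vec d)
    (b : Fin B → Z) : Vec m :=
  p.gBatch i x b + θ • (p.gBatch i x b - p.gBatch i xprev b)

/-- The stochastic gradient estimator `G = (1/S) ∑_{i ∈ s} [g_i'(x; 𝓑̃ᵢ)]ᵀ y_i`. -/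
def Problem.gradEst (p : Problem n d m Z) {B : ℕ} (S : ℕ) (s : Finset (Fin n)) (x : Vec d)
    (y : Fin n → Vec m) (b : Fin n → Fin B → Z) : Vec d :=
  (1 / (S : ℝ)) • ∑ i ∈ s, (p.dgBatch i x (b i)).adjoint (y i)

/-- `(x, y)` is a run of the algorithm with batch sizes `S` and `B`, distance-generating function
`ψ`, parameters `θ, η, τ`, and deterministic start `(x₀, y₀)`, driven by the samples `W`. In the
first iteration the previous iterate is `x₀` itself (as `0 - 1 = 0` for natural numbers). -/
structure IsRun (p : Problem n d m Z) (S B : ℕ) (ψ : Vec m → ℝ) (θ η τ : ℝ) (x₀ : Vec d)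
    (y₀ : Fin n → Vec m) {Ω : Type*} [MeasurableSpace Ω] (μ : Measure Ω)
    (W : ℕ → Ω → Sample n B Z) (x : ℕ → Ω → Vec d) (y : ℕ → Ω → Fin n → Vec m) : Prop where
  sample_meas : ∀ t, Measurable (W t)
  sample_indep : iIndepFun W μ
  sample_law : ∀ t, μ.map (W t) = p.sampleLaw S B
  x_zero : ∀ ω, x 0 ω = x₀
  y_zero : ∀ ω, y 0 ω = y₀
  y_sampled : ∀ t ω, ∀ i ∈ (W t ω).1, y (t + 1) ω i ∈ dualSet (p.f i) ∧
    IsMaxOn (fun v : Vec m =>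
      ((⟪v, p.gExtra θ i (x t ω) (x (t - 1) ω) ((W t ω).2.1 i)⟫
        - τ * bregman ψ v (y t ω i) : ℝ) : EReal) - conj (p.f i) v)
      (dualSet (p.f i)) (y (t + 1) ω i)
  y_unsampled : ∀ t ω, ∀ i ∉ (W t ω).1, y (t + 1) ω i = y t ω i
  x_step : ∀ t ω, x (t + 1) ω ∈ p.X ∧
    IsMinOn (fun z : Vec d =>
      ((⟪p.gradEst S (W t ω).1 (x t ω) (y (t + 1) ω) (W t ω).2.2, z⟫
        + η / 2 * ‖z - x t ω‖ ^ 2 : ℝ) : EReal) + p.r z)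
      p.X (x (t + 1) ω)

/-- The time average `x̄_T = (1/T) ∑_{t < T} x_{t+1}`. -/
def average {Ω : Type*} (x : ℕ → Ω → Vec d) (T : ℕ) (ω : Ω) : Vec d :=
  (1 / (T : ℝ)) • ∑ t ∈ Finset.range T, x (t + 1) ω

/-- `ỹ` is a measurable selection `ỹ_i ∈ argmax_{v ∈ 𝓨ᵢ} {⟪v, g_i(x̄)⟫ - f_i^*(v)}` at the random
point `x̄`. -/
def IsDualSelection (p : Problem n d m Z) {Ω : Type*} [MeasurableSpace Ω] (xbar : Ω → Vec d)
    (yt : Ω → Fin n → Vec m) : Prop :=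
  Measurable yt ∧ ∀ ω i, yt ω i ∈ dualSet (p.f i) ∧
    IsMaxOn (fun v : Vec m => ((⟪v, p.g i (xbar ω)⟫ : ℝ) : EReal) - conj (p.f i) v)
      (dualSet (p.f i)) (yt ω i)

/-- The radius `E[∑ᵢ U_ψ(ỹ_i, y₀_i)]`. -/
def radius {Ω : Type*} [MeasurableSpace Ω] (μ : Measure Ω) (ψ : Vec m → ℝ)
    (yt : Ω → Fin n → Vec m) (y₀ : Fin n → Vec m) : ℝ :=
  ∫ ω, ∑ i, bregman ψ (yt ω i) (y₀ i) ∂μ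

end ALEXR

end

/-!
Writing each `f_i` as the conjugate of `f_i^*` turns the problem into a convex-concave saddle point
problem, and ALEXR into a stochastic primal-dual method. Next to the iterates `(x_t, y_t)` consider
the *full* dual step `z_t`, which moves every block; given the inner batches it is independent of
the block set `S_t`, and `y_{t+1}` agrees with it on the sampled blocks. The three-point
inequalities of both proximal steps bound the gap of the Lagrangian at `(x_{t+1}, z_t)` by
telescoping distances, a coupling term and errors. The coupling term contains
`g(x_{t+1}) - g(x_t)` minus its extrapolated guess `g(x_t) - g(x_{t-1})`, so summation by parts
leaves only a boundary term and squares absorbed by the proximal terms.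

The dual comparison point `ỹ_T` depends on the noise, so `⟪ỹ_T - z_t, e_t⟫` does not have mean zero.
Its part `⟪ỹ_T - y₀, ∑ e_t⟫` is bounded by Young's inequality instead, and `E‖∑ e_t‖²` only grows
linearly because the increments are orthogonal. In the same way, the distances of the blocks to
`ỹ_T` telescope up to the centred weights `1/n - 1[i ∈ S_t]/S`, which multiply quantities that do
not depend on `S_t`. In expectation the terms linear in the noise vanish, the others are bounded by
the variances, and `η ≍ 1/(Sε)`, `τ ≍ 1/(Bε)` balance everything.
-/

noncomputable section

namespace ALEXR

/-! ### Quadratic proximal steps -/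

section Prox

variable {E : Type*} [NormedAddCommGroup E] [InnerProductSpace ℝ E]

/-- `z` is a proximal point: it minimizes `h v + ⟪c, v⟫ + τ / 2 * ‖v - y₀‖ ^ 2` over `A`. Both
updates of the algorithm are of this form. -/
def IsProxPoint (A : Set E) (h : E → ℝ) (τ : ℝ) (c y₀ z : E) : Prop :=
  z ∈ A ∧ IsMinOn (fun v => h v + ⟪c, v⟫ + τ / 2 * ‖v - y₀‖ ^ 2) A z

theorem nonneg_of_forall_add_mul {a b : ℝ} (h : ∀ s : ℝ, 0 < s → s < 1 → 0 ≤ a + s * b) :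
    0 ≤ a := by
  have hlim : Filter.Tendsto (fun s : ℝ => a + s * b) (nhdsWithin 0 (Set.Ioi 0)) (nhds a) :=
    ((by fun_prop : Continuous fun s : ℝ => a + s * b).tendsto' 0 a (by simp)).mono_left
      nhdsWithin_le_nhds
  refine ge_of_tendsto hlim ?_
  filter_upwards [Ioo_mem_nhdsGT one_pos] with s hs using h s hs.1 hs.2

theorem norm_add_smul_sub_sub_sq (y z v : E) (s : ℝ) :
    ‖z + s • (v - z) - y‖ ^ 2
      = ‖z - y‖ ^ 2 + 2 * s * ⟪z - y, v - z⟫ + s ^ 2 * ‖v - z‖ ^ 2 := by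
  rw [add_sub_right_comm, norm_add_sq_real, inner_smul_right, norm_smul, mul_pow,
    Real.norm_eq_abs, sq_abs]
  ring

theorem IsProxPoint.three_point {A : Set E} {h : E → ℝ} (hh : ConvexOn ℝ A h) {τ : ℝ}
    {c y₀ z v : E} (hz : IsProxPoint A h τ c y₀ z) (hv : v ∈ A) :
    h z + ⟪c, z⟫ + τ / 2 * ‖z - y₀‖ ^ 2 + τ / 2 * ‖v - z‖ ^ 2
      ≤ h v + ⟪c, v⟫ + τ / 2 * ‖v - y₀‖ ^ 2 := by
  have hdiff : ∀ s : ℝ, 0 < s → s < 1 →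
      0 ≤ h v - h z + ⟪c, v - z⟫ + τ * ⟪z - y₀, v - z⟫ + s * (τ / 2 * ‖v - z‖ ^ 2) := by
    intro s hs₀ hs₁
    have hseg : (1 - s) • z + s • v = z + s • (v - z) := by module
    have hmin := hz.2 (hh.1 hz.1 hv (sub_nonneg.2 hs₁.le) hs₀.le (sub_add_cancel 1 s))
    have hconv := hh.2 hz.1 hv (sub_nonneg.2 hs₁.le) hs₀.le (sub_add_cancel 1 s)
    simp only [hseg, Set.mem_ofPred_eq, norm_add_smul_sub_sub_sq, inner_add_right,
      inner_smul_right, smul_eq_mul] at hmin hconv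
    refine le_of_mul_le_mul_left ?_ hs₀
    linarith
  have hvar := nonneg_of_forall_add_mul hdiff
  have hsq : ‖v - y₀‖ ^ 2 = ‖z - y₀‖ ^ 2 + 2 * ⟪z - y₀, v - z⟫ + ‖v - z‖ ^ 2 := by
    simpa using norm_add_smul_sub_sub_sq y₀ z v 1
  rw [inner_sub_right] at hvar
  rw [hsq]
  linarith

theorem norm_le_of_norm_sq_le_inner {u w : E} (h : ‖u‖ ^ 2 ≤ ⟪w, u⟫) : ‖u‖ ≤ ‖w‖ := by
  rcases (norm_nonneg u).eq_or_lt with hu | hu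
  · exact hu ▸ norm_nonneg w
  · refine le_of_mul_le_mul_right ?_ hu
    calc ‖u‖ * ‖u‖ = ‖u‖ ^ 2 := (sq _).symm
      _ ≤ ⟪w, u⟫ := h
      _ ≤ ‖w‖ * ‖u‖ := real_inner_le_norm w u

theorem IsProxPoint.norm_sub_le {A : Set E} {h : E → ℝ} (hh : ConvexOn ℝ A h) {τ : ℝ} (hτ : 0 < τ)
    {c y₀ z c' y₀' z' : E} (hz : IsProxPoint A h τ c y₀ z) (hz' : IsProxPoint A h τ c' y₀' z') :
    ‖z - z'‖ ≤ ‖(y₀ - τ⁻¹ • c) - (y₀' - τ⁻¹ • c')‖ := by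
  refine norm_le_of_norm_sq_le_inner (le_of_mul_le_mul_left (a := τ) ?_ hτ)
  have hsum := add_le_add (hz.three_point hh hz'.1) (hz'.three_point hh hz.1)
  rw [norm_sub_rev z' z] at hsum
  have hinner : τ * ⟪(y₀ - τ⁻¹ • c) - (y₀' - τ⁻¹ • c'), z - z'⟫
      = τ * ⟪y₀ - y₀', z - z'⟫ - ⟪c - c', z - z'⟫ := by
    simp only [inner_sub_left, inner_smul_left, conj_trivial]
    field_simp
    ring
  rw [hinner]
  simp only [norm_sub_sq_real, inner_sub_left, inner_sub_right] at hsum ⊢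
  rw [real_inner_comm y₀ z, real_inner_comm y₀ z', real_inner_comm y₀' z, real_inner_comm y₀' z']
    at hsum
  linarith

theorem IsProxPoint.eq {A : Set E} {h : E → ℝ} (hh : ConvexOn ℝ A h) {τ : ℝ} (hτ : 0 < τ)
    {c y₀ z z' : E} (hz : IsProxPoint A h τ c y₀ z) (hz' : IsProxPoint A h τ c y₀ z') : z = z' := by
  simpa [sub_eq_zero] using hz.norm_sub_le hh hτ hz'

end Prox

/-! ### Conjugates of convex functions -/

section Conj

variable {m : ℕ} {f : Vec m → ℝ} {K : ℝ}

theorem le_conj (f : Vec m → ℝ) (u v : Vec m) : ((⟪v, u⟫ - f u : ℝ) : EReal) ≤ conj f v :=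
  le_iSup (fun u : Vec m => ((⟪v, u⟫ - f u : ℝ) : EReal)) u

theorem conj_ne_bot (f : Vec m → ℝ) (v : Vec m) : conj f v ≠ ⊥ :=
  ne_bot_of_le_ne_bot (EReal.coe_ne_bot _) (le_conj f 0 v)

theorem coe_toReal_conj {v : Vec m} (hv : conj f v < ⊤) :
    ((conj f v).toReal : EReal) = conj f v :=
  EReal.coe_toReal hv.ne (conj_ne_bot f v)

theorem fenchel_young {v : Vec m} (hv : conj f v < ⊤) (u : Vec m) :
    ⟪v, u⟫ - (conj f v).toReal ≤ f u := by
  have := le_conj f u v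
  rw [← coe_toReal_conj hv, EReal.coe_le_coe_iff] at this
  linarith

theorem conj_add_smul_le {v w : Vec m} (hv : conj f v < ⊤) (hw : conj f w < ⊤) {a b : ℝ}
    (ha : 0 ≤ a) (hb : 0 ≤ b) (hab : a + b = 1) :
    conj f (a • v + b • w) ≤ ((a * (conj f v).toReal + b * (conj f w).toReal : ℝ) : EReal) := by
  refine iSup_le fun u => EReal.coe_le_coe_iff.2 ?_
  have hsplit : f u = a * f u + b * f u := by rw [← add_mul, hab, one_mul]
  simp only [inner_add_left, inner_smul_left, conj_trivial]
  linarith [mul_le_mul_of_nonneg_left (fenchel_young hv u) ha,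
    mul_le_mul_of_nonneg_left (fenchel_young hw u) hb]

theorem convexOn_toReal_conj (f : Vec m → ℝ) :
    ConvexOn ℝ {v | conj f v < ⊤} fun v => (conj f v).toReal := by
  have hmem : Convex ℝ {v | conj f v < ⊤} := fun v hv w hw a b ha hb hab =>
    (conj_add_smul_le hv hw ha hb hab).trans_lt (EReal.coe_lt_top _)
  refine ⟨hmem, fun v hv w hw a b ha hb hab => ?_⟩
  have h := conj_add_smul_le hv hw ha hb hab
  rwa [← coe_toReal_conj (hmem hv hw ha hb hab), EReal.coe_le_coe_iff] at h

theorem mem_dualSet {v : Vec m} (hv : conj f v < ⊤) : v ∈ dualSet f := subset_closure hv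

theorem exists_conj_lt_top {y : Vec m} (hy : y ∈ dualSet f) : ∃ v, conj f v < ⊤ :=
  closure_nonempty_iff.1 ⟨y, hy⟩

theorem nonpos_of_forall_mul_le {a c : ℝ} (h : ∀ t : ℝ, 0 ≤ t → t * a ≤ c) : a ≤ 0 := by
  by_contra! ha
  have hc := h ((|c| + 1) / a) (by positivity)
  rw [div_mul_cancel₀ _ ha.ne'] at hc
  linarith [le_abs_self c]

theorem norm_le_of_conj_lt_top (hK : 0 ≤ K) (hf : ∀ u v, |f u - f v| ≤ K * ‖u - v‖) {v : Vec m}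
    (hv : conj f v < ⊤) : ‖v‖ ≤ K := by
  have hray : ∀ t : ℝ, 0 ≤ t → t * (‖v‖ * (‖v‖ - K)) ≤ (conj f v).toReal + f 0 := by
    intro t ht
    have hlip := (abs_le.1 (hf (t • v) 0)).2
    have hfy := fenchel_young hv (t • v)
    rw [sub_zero, norm_smul, Real.norm_of_nonneg ht] at hlip
    rw [inner_smul_right, real_inner_self_eq_norm_sq] at hfy
    linarith
  by_contra! hlt
  exact (nonpos_of_forall_mul_le hray).not_gt (mul_pos (hK.trans_lt hlt) (sub_pos.2 hlt))

theorem norm_le_of_mem_dualSet (hK : 0 ≤ K) (hf : ∀ u v, |f u - f v| ≤ K * ‖u - v‖) {v : Vec m}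
    (hv : v ∈ dualSet f) : ‖v‖ ≤ K := by
  have hsub : {v | conj f v < ⊤} ⊆ Metric.closedBall 0 K := fun v hv =>
    mem_closedBall_zero_iff.2 (norm_le_of_conj_lt_top hK hf hv)
  exact mem_closedBall_zero_iff.1 (closure_minimal hsub Metric.isClosed_closedBall hv)

theorem isCompact_dualSet (hK : 0 ≤ K) (hf : ∀ u v, |f u - f v| ≤ K * ‖u - v‖) :
    IsCompact (dualSet f) :=
  (isCompact_closedBall (0 : Vec m) K).of_isClosed_subset isClosed_closure
    fun _ hv => mem_closedBall_zero_iff.2 (norm_le_of_mem_dualSet hK hf hv)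

theorem nonneg_of_conj_lt_top (hf : ∀ u v : Vec m, (∀ k, u k ≤ v k) → f u ≤ f v) {v : Vec m}
    (hv : conj f v < ⊤) (k : Fin m) : 0 ≤ v k := by
  have hray : ∀ t : ℝ, 0 ≤ t → t * -v k ≤ (conj f v).toReal + f 0 := by
    intro t ht
    have hfy := fenchel_young hv (-(t • EuclideanSpace.single k (1 : ℝ)))
    have hmono := hf (-(t • EuclideanSpace.single k (1 : ℝ))) 0 fun j => by
      by_cases hj : j = k <;> simp [hj, ht]
    simp only [inner_neg_right, inner_smul_right, EuclideanSpace.inner_single_right, one_mul,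
      conj_trivial] at hfy
    linarith
  exact neg_nonpos.1 (nonpos_of_forall_mul_le hray)

theorem nonneg_of_mem_dualSet (hf : ∀ u v : Vec m, (∀ k, u k ≤ v k) → f u ≤ f v) {v : Vec m}
    (hv : v ∈ dualSet f) (k : Fin m) : 0 ≤ v k := by
  have hcont : Continuous fun v : Vec m => v k := by fun_prop
  exact closure_minimal (fun w hw => nonneg_of_conj_lt_top hf hw k)
    (isClosed_le continuous_const hcont) hv

theorem lowerSemicontinuous_conj (f : Vec m → ℝ) : LowerSemicontinuous (conj f) :=
  lowerSemicontinuous_iSup fun u =>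
    (continuous_coe_real_ereal.comp
      (by fun_prop : Continuous fun v : Vec m => ⟪v, u⟫ - f u)).lowerSemicontinuous

theorem conj_lt_top_of_isMaxOn {ℓ : Vec m → ℝ} {y : Vec m} (hmem : y ∈ dualSet f)
    (hy : IsMaxOn (fun v => ((ℓ v : ℝ) : EReal) - conj f v) (dualSet f) y) : conj f y < ⊤ := by
  obtain ⟨v, hv⟩ := exists_conj_lt_top hmem
  have h := hy (mem_dualSet hv)
  by_contra hcon
  simp only [Set.mem_ofPred_eq, not_lt_top_iff.1 hcon, EReal.sub_top] at h
  rw [← coe_toReal_conj hv, ← EReal.coe_sub] at h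
  exact EReal.coe_ne_bot _ (le_bot_iff.1 h)

theorem sub_toReal_conj_le_of_isMaxOn {ℓ : Vec m → ℝ} {y v : Vec m} (hmem : y ∈ dualSet f)
    (hy : IsMaxOn (fun v => ((ℓ v : ℝ) : EReal) - conj f v) (dualSet f) y) (hv : conj f v < ⊤) :
    ℓ v - (conj f v).toReal ≤ ℓ y - (conj f y).toReal := by
  have h := hy (mem_dualSet hv)
  simp only [Set.mem_ofPred_eq] at h
  rwa [← coe_toReal_conj hv, ← coe_toReal_conj (conj_lt_top_of_isMaxOn hmem hy), ← EReal.coe_sub,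
    ← EReal.coe_sub, EReal.coe_le_coe_iff] at h

theorem exists_isMaxOn_sub_conj (hK : 0 ≤ K) (hf : ∀ u v, |f u - f v| ≤ K * ‖u - v‖)
    (hne : (dualSet f).Nonempty) {ℓ : Vec m → ℝ} (hℓ : Continuous ℓ) :
    ∃ y ∈ dualSet f, IsMaxOn (fun v => ((ℓ v : ℝ) : EReal) - conj f v) (dualSet f) y := by
  have hlsc : LowerSemicontinuous fun v => conj f v + ((-ℓ v : ℝ) : EReal) :=
    (lowerSemicontinuous_conj f).add'
      (continuous_coe_real_ereal.comp hℓ.neg).lowerSemicontinuous fun v =>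
        EReal.continuousAt_add (Or.inr (EReal.coe_ne_bot _)) (Or.inr (EReal.coe_ne_top _))
  have hneg : ∀ v, ((ℓ v : ℝ) : EReal) - conj f v = -(conj f v + ((-ℓ v : ℝ) : EReal)) := by
    intro v
    rw [EReal.neg_add (Or.inr (EReal.coe_ne_top _)) (Or.inr (EReal.coe_ne_bot _)),
      EReal.coe_neg, sub_eq_add_neg, sub_eq_add_neg, neg_neg, add_comm]
  obtain ⟨y, hmem, hy⟩ := (hlsc.lowerSemicontinuousOn (dualSet f)).exists_isMinOn hne
    (isCompact_dualSet hK hf)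
  refine ⟨y, hmem, fun v hv => ?_⟩
  simp only [Set.mem_ofPred_eq, hneg]
  exact EReal.neg_le_neg_iff.2 (hy hv)

theorem exists_affine_eq_of_lt (hf : ConvexOn ℝ Set.univ f) {u : Vec m} {b : ℝ} (hb : b < f u) :
    ∃ v c, (∀ w, ⟪v, w⟫ + c ≤ f w) ∧ ⟪v, u⟫ + c = b := by
  have hcont : Continuous f := continuousOn_univ.1 (hf.continuousOn isOpen_univ)
  obtain ⟨l, c, hle, heq⟩ := hf.exists_affine_le_of_lt (𝕜 := ℝ) (Set.mem_univ u) hb isClosed_univ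
    (hcont.lowerSemicontinuous.lowerSemicontinuousOn _)
  obtain ⟨v, rfl⟩ := (InnerProductSpace.toDual ℝ (Vec m)).surjective l
  exact ⟨v, c, fun w => by simpa using hle ⟨w, Set.mem_univ w⟩, by simpa using heq⟩

theorem le_inner_sub_conj_of_isMaxOn (hf : ConvexOn ℝ Set.univ f) {u y : Vec m}
    (hmem : y ∈ dualSet f)
    (hy : IsMaxOn (fun v => ((⟪v, u⟫ : ℝ) : EReal) - conj f v) (dualSet f) y) :
    f u ≤ ⟪y, u⟫ - (conj f y).toReal := by
  refine le_of_forall_lt_imp_le_of_dense fun b hb => ?_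
  obtain ⟨v, c, hle, rfl⟩ := exists_affine_eq_of_lt hf hb
  have hconj : conj f v ≤ ((-c : ℝ) : EReal) :=
    iSup_le fun w => EReal.coe_le_coe_iff.2 (by linarith [hle w])
  have hv := hconj.trans_lt (EReal.coe_lt_top _)
  rw [← coe_toReal_conj hv, EReal.coe_le_coe_iff] at hconj
  linarith [sub_toReal_conj_le_of_isMaxOn hmem hy hv]

end Conj

/-! ### The assumptions in Euclidean form -/

section Norms

variable {d m : ℕ} {q : Seminorm ℝ (Vec m)} {μψ Lψ : ℝ}

theorem inner_le_of_seminorm_le_one (hL : 0 ≤ Lψ) (hq : ∀ v, ‖v‖ ^ 2 ≤ Lψ * q v ^ 2) (u : Vec m)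
    (v : {v : Vec m // q v ≤ 1}) : ⟪u, (v : Vec m)⟫ ≤ √Lψ * ‖u‖ := by
  have hv : ‖(v : Vec m)‖ ≤ √Lψ := by
    refine Real.le_sqrt_of_sq_le ((hq v).trans (mul_le_of_le_one_right hL ?_))
    exact pow_le_one₀ (apply_nonneg q _) v.2
  calc ⟪u, (v : Vec m)⟫ ≤ ‖u‖ * ‖(v : Vec m)‖ := real_inner_le_norm _ _
    _ ≤ ‖u‖ * √Lψ := by gcongr
    _ = √Lψ * ‖u‖ := mul_comm _ _

theorem dualNorm_le (hL : 0 ≤ Lψ) (hq : ∀ v, ‖v‖ ^ 2 ≤ Lψ * q v ^ 2) (u : Vec m) :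
    dualNorm q u ≤ √Lψ * ‖u‖ :=
  have : Nonempty {v : Vec m // q v ≤ 1} := ⟨⟨0, by simp⟩⟩
  ciSup_le (inner_le_of_seminorm_le_one hL hq u)

theorem inner_le_dualNorm (hL : 0 ≤ Lψ) (hq : ∀ v, ‖v‖ ^ 2 ≤ Lψ * q v ^ 2) (u : Vec m) {v : Vec m}
    (hv : q v ≤ 1) : ⟪u, v⟫ ≤ dualNorm q u :=
  le_ciSup (f := fun v : {v : Vec m // q v ≤ 1} => ⟪u, (v : Vec m)⟫)
    ⟨_, Set.forall_mem_range.2 (inner_le_of_seminorm_le_one hL hq u)⟩ ⟨v, hv⟩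

theorem sqrt_mul_norm_le_dualNorm (hμ : 0 ≤ μψ) (hL : 0 ≤ Lψ)
    (hq : ∀ v, μψ * q v ^ 2 ≤ ‖v‖ ^ 2 ∧ ‖v‖ ^ 2 ≤ Lψ * q v ^ 2) (u : Vec m) :
    √μψ * ‖u‖ ≤ dualNorm q u := by
  have hle := fun {v : Vec m} => inner_le_dualNorm (v := v) hL (fun v => (hq v).2) u
  rcases (norm_nonneg u).eq_or_lt with hu | hu
  · simpa [← hu] using hle (v := 0) (by simp)
  · have hqu : √μψ * q u ≤ ‖u‖ := by
      refine (sq_le_sq₀ (by positivity) hu.le).1 ?_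
      rw [mul_pow, Real.sq_sqrt hμ]
      exact (hq u).1
    have hunit : q ((√μψ / ‖u‖) • u) ≤ 1 := by
      rwa [map_smul_eq_mul, Real.norm_of_nonneg (by positivity), div_mul_eq_mul_div, div_le_one hu]
    calc √μψ * ‖u‖ = √μψ / ‖u‖ * ‖u‖ ^ 2 := by field_simp
      _ = ⟪u, (√μψ / ‖u‖) • u⟫ := by rw [inner_smul_right, real_inner_self_eq_norm_sq]
      _ ≤ dualNorm q u := hle hunit

theorem sqrt_mul_norm_le_opNorm (hμ : 0 < μψ) (hL : 0 ≤ Lψ)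
    (hq : ∀ v, μψ * q v ^ 2 ≤ ‖v‖ ^ 2 ∧ ‖v‖ ^ 2 ≤ Lψ * q v ^ 2) (A : Vec d →L[ℝ] Vec m) :
    √μψ * ‖A‖ ≤ opNorm q A := by
  have hbdd : BddAbove (Set.range fun x : {x : Vec d // ‖x‖ ≤ 1} => dualNorm q (A x)) := by
    refine ⟨√Lψ * ‖A‖, Set.forall_mem_range.2 fun x => ?_⟩
    refine (dualNorm_le hL (fun v => (hq v).2) _).trans ?_
    gcongr
    exact (A.le_opNorm_of_le x.2).trans_eq (mul_one _)
  have hle : ∀ x : {x : Vec d // ‖x‖ ≤ 1}, √μψ * ‖A x‖ ≤ opNorm q A := fun x =>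
    (sqrt_mul_norm_le_dualNorm hμ.le hL hq _).trans (le_ciSup hbdd x)
  have hnonneg : 0 ≤ opNorm q A := by simpa using hle ⟨0, by simp⟩
  rw [← le_div_iff₀' (Real.sqrt_pos.2 hμ)]
  refine A.opNorm_le_of_unit_norm (by positivity) fun x hx => ?_
  rw [le_div_iff₀' (Real.sqrt_pos.2 hμ)]
  exact hle ⟨x, hx.le⟩

end Norms

section SquareIntegrable

variable {α E : Type*} {mα : MeasurableSpace α} {P : Measure α} [NormedAddCommGroup E]

theorem memLp_two_of_lintegral_sq_lt_top {f : α → E} (hf : AEStronglyMeasurable f P)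
    (h : ∫⁻ a, ENNReal.ofReal (‖f a‖ ^ 2) ∂P < ⊤) : MemLp f 2 P := by
  rw [memLp_two_iff_integrable_sq_norm hf]
  refine ⟨hf.norm.pow 2, ?_⟩
  rwa [hasFiniteIntegral_iff_ofReal (ae_of_all _ fun a => by positivity)]

theorem memLp_two_of_lintegral_const_sub_sq_lt_top [IsFiniteMeasure P] {f : α → E} (c : E)
    (hf : AEStronglyMeasurable f P) (h : ∫⁻ a, ENNReal.ofReal (‖c - f a‖ ^ 2) ∂P < ⊤) :
    MemLp f 2 P := by
  have hsub := (memLp_const (p := 2) (μ := P) c).sub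
    (memLp_two_of_lintegral_sq_lt_top (aestronglyMeasurable_const.sub hf) h)
  exact hsub.congr_norm hf (ae_of_all _ fun a => by simp)

theorem integral_sq_le_of_lintegral_sq_le {f : α → E} (hf : AEStronglyMeasurable f P) {c : ℝ}
    (hc : 0 ≤ c) (h : ∫⁻ a, ENNReal.ofReal (‖f a‖ ^ 2) ∂P ≤ ENNReal.ofReal c) :
    ∫ a, ‖f a‖ ^ 2 ∂P ≤ c := by
  rw [integral_eq_lintegral_of_nonneg_ae (ae_of_all _ fun a => by positivity)
    (by simpa only [Pi.pow_def] using hf.norm.pow 2)]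
  exact ENNReal.toReal_le_of_le_ofReal hc h

theorem lintegral_sq_le_of_mul_le {N f : α → ℝ} {s σ : ℝ} (hs : 0 < s)
    (hNf : ∀ a, s * f a ≤ N a) (hf : ∀ a, 0 ≤ f a)
    (h : ∫⁻ a, ENNReal.ofReal (N a ^ 2) ∂P ≤ ENNReal.ofReal (σ ^ 2)) :
    ∫⁻ a, ENNReal.ofReal (f a ^ 2) ∂P ≤ ENNReal.ofReal ((σ / s) ^ 2) := by
  have hpt : ∀ a, f a ^ 2 ≤ (s ^ 2)⁻¹ * N a ^ 2 := fun a => by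
    rw [← div_eq_inv_mul, le_div_iff₀ (by positivity), ← mul_pow, mul_comm]
    exact pow_le_pow_left₀ (mul_nonneg hs.le (hf a)) (hNf a) 2
  calc ∫⁻ a, ENNReal.ofReal (f a ^ 2) ∂P
      ≤ ∫⁻ a, ENNReal.ofReal ((s ^ 2)⁻¹) * ENNReal.ofReal (N a ^ 2) ∂P := by
        refine lintegral_mono fun a => ?_
        rw [← ENNReal.ofReal_mul (by positivity)]
        exact ENNReal.ofReal_le_ofReal (hpt a)
    _ = ENNReal.ofReal ((s ^ 2)⁻¹) * ∫⁻ a, ENNReal.ofReal (N a ^ 2) ∂P :=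
        lintegral_const_mul' _ _ ENNReal.ofReal_ne_top
    _ ≤ ENNReal.ofReal ((s ^ 2)⁻¹) * ENNReal.ofReal (σ ^ 2) := by gcongr
    _ = ENNReal.ofReal ((σ / s) ^ 2) := by
        rw [← ENNReal.ofReal_mul (by positivity), ← div_eq_inv_mul, ← div_pow]

end SquareIntegrable

section EuclideanForm

variable {n d m : ℕ} {Z : Type*} [MeasurableSpace Z]

/-- The form in which the analysis uses the standing assumptions: all norms are Euclidean,
square-integrability replaces finite lower integrals, and convexity of `⟪v, g_i ·⟫` for the dual
points `v` replaces convexity of `g_i` together with monotonicity of `f_i`. -/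
structure Problem.EuclideanAssumptions (p : Problem n d m Z) (K G Λ s₀ s₁ δ : ℝ) : Prop where
  K_nonneg : 0 ≤ K
  convex_X : Convex ℝ p.X
  r_ne_bot : ∀ x ∈ p.X, p.r x ≠ ⊥
  r_proper : ∃ x ∈ p.X, p.r x ≠ ⊤
  r_convex : ∀ x ∈ p.X, ∀ z ∈ p.X, ∀ a b : ℝ, 0 < a → 0 < b → a + b = 1 →
    p.r (a • x + b • z) ≤ (a : EReal) * p.r x + (b : EReal) * p.r z
  prob : ∀ i, IsProbabilityMeasure (p.P i)
  gs_meas : ∀ i, Measurable fun w : Vec d × Z => p.gs i w.1 w.2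
  dgs_meas : ∀ i, Measurable fun w : Vec d × Z => p.dgs i w.1 w.2
  f_convex : ∀ i, ConvexOn ℝ Set.univ (p.f i)
  f_lip : ∀ i u v, |p.f i u - p.f i v| ≤ K * ‖u - v‖
  inner_convex : ∀ i, ∀ v ∈ dualSet (p.f i), ConvexOn ℝ p.X fun x => ⟪v, p.g i x⟫
  g_lip : ∀ i, ∀ x ∈ p.X, ∀ z ∈ p.X, ‖p.g i x - p.g i z‖ ≤ G * ‖x - z‖
  g_smooth : ∀ i, ∀ x ∈ p.X, ∀ z ∈ p.X,
    ‖p.g i x - p.g i z - p.dg i z (x - z)‖ ≤ Λ / 2 * ‖x - z‖ ^ 2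
  gs_memLp : ∀ i, ∀ x ∈ p.X, MemLp (fun ζ => p.gs i x ζ) 2 (p.P i)
  gs_var : ∀ i, ∀ x ∈ p.X, ∫ ζ, ‖p.g i x - p.gs i x ζ‖ ^ 2 ∂(p.P i) ≤ s₀ ^ 2
  dgs_memLp : ∀ i, ∀ x ∈ p.X, MemLp (fun ζ => p.dgs i x ζ) 2 (p.P i)
  dgs_unbiased : ∀ i, ∀ x ∈ p.X, ∫ ζ, p.dgs i x ζ ∂(p.P i) = p.dg i x
  dgs_var : ∀ i, ∀ x ∈ p.X, ∫ ζ, ‖p.dg i x - p.dgs i x ζ‖ ^ 2 ∂(p.P i) ≤ s₁ ^ 2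
  var_block : ∀ x ∈ p.X, ∀ y : Fin n → Vec m, (∀ i, y i ∈ dualSet (p.f i)) →
    (1 / (n : ℝ)) * ∑ j, ‖(p.dg j x).adjoint (y j)
      - (1 / (n : ℝ)) • ∑ i, (p.dg i x).adjoint (y i)‖ ^ 2 ≤ δ ^ 2

theorem inner_eq_sum (u v : Vec m) : ⟪u, v⟫ = ∑ k, u k * v k := by
  simp [PiLp.inner_apply, mul_comm]

theorem convexOn_inner_of_nonneg {X : Set (Vec d)} {g : Vec d → Vec m} (hX : Convex ℝ X)
    (hg : ∀ k, ConvexOn ℝ X fun x => g x k) {v : Vec m} (hv : ∀ k, 0 ≤ v k) :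
    ConvexOn ℝ X fun x => ⟪v, g x⟫ := by
  refine ⟨hX, fun x hx z hz a b ha hb hab => ?_⟩
  simp only [inner_eq_sum, smul_eq_mul, Finset.mul_sum, ← Finset.sum_add_distrib]
  refine Finset.sum_le_sum fun k _ => ?_
  have hk := mul_le_mul_of_nonneg_left ((hg k).2 hx hz ha hb hab) (hv k)
  simp only [smul_eq_mul] at hk
  linarith

theorem convexOn_inner_of_eqOn_affine {X : Set (Vec d)} {g : Vec d → Vec m} (hX : Convex ℝ X)
    {A : Vec d →ᵃ[ℝ] Vec m} (hA : Set.EqOn g A X) (v : Vec m) :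
    ConvexOn ℝ X fun x => ⟪v, g x⟫ := by
  refine ⟨hX, fun x hx z hz a b ha hb hab => le_of_eq ?_⟩
  simp only [hA hx, hA hz, hA (hX hx hz ha hb hab), Convex.combo_affine_apply hab,
    inner_add_right, inner_smul_right, smul_eq_mul]

namespace Problem.Assumptions

variable {p : Problem n d m Z} {q : Seminorm ℝ (Vec m)} {Cf Cg Lg σ₀ σ₁ δ μψ Lψ : ℝ}

theorem convexOn_inner (h : p.Assumptions q Cf Cg Lg σ₀ σ₁ δ) {i : Fin n} {v : Vec m}
    (hv : v ∈ dualSet (p.f i)) : ConvexOn ℝ p.X fun x => ⟪v, p.g i x⟫ := by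
  rcases h.f_mono i with hmono | ⟨A, hA⟩
  · exact convexOn_inner_of_nonneg h.convex_X (h.g_convex i) (nonneg_of_mem_dualSet hmono hv)
  · exact convexOn_inner_of_eqOn_affine h.convex_X hA v

theorem euclidean (hCf : 0 ≤ Cf) (hμ : 0 < μψ) (hL : 0 ≤ Lψ)
    (hq : ∀ v, μψ * q v ^ 2 ≤ ‖v‖ ^ 2 ∧ ‖v‖ ^ 2 ≤ Lψ * q v ^ 2)
    (h : p.Assumptions q Cf Cg Lg σ₀ σ₁ δ) :
    p.EuclideanAssumptions (Cf * √Lψ) (Cg / √μψ) (Lg / √μψ) (σ₀ / √μψ) (σ₁ / √μψ) δ :=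
  have hs : 0 < √μψ := Real.sqrt_pos.2 hμ
  have hdual := sqrt_mul_norm_le_dualNorm hμ.le hL hq
  have hprob := h.prob
  have hgs : ∀ i x, AEStronglyMeasurable (fun ζ => p.gs i x ζ) (p.P i) := fun i x =>
    ((h.gs_meas i).comp measurable_prodMk_left).aestronglyMeasurable
  have hdgs : ∀ i x, AEStronglyMeasurable (fun ζ => p.dgs i x ζ) (p.P i) := fun i x =>
    ((h.dgs_meas i).comp measurable_prodMk_left).aestronglyMeasurable
  have hvar₀ := fun i x hx => lintegral_sq_le_of_mul_le hs (fun _ => hdual _)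
    (fun _ => norm_nonneg _) (h.var_zero i x hx)
  have hvar₁ := fun i x hx => lintegral_sq_le_of_mul_le hs
    (fun _ => sqrt_mul_norm_le_opNorm hμ hL hq _) (fun _ => norm_nonneg _) (h.var_one i x hx)
  { h with
    K_nonneg := by positivity
    f_lip := fun i u v => (h.f_lip i u v).trans <| by
      rw [mul_assoc]
      exact mul_le_mul_of_nonneg_left (dualNorm_le hL (fun v => (hq v).2) _) hCf
    inner_convex := fun _ _ => h.convexOn_inner
    g_lip := fun i x hx z hz => by
      rw [div_mul_eq_mul_div, le_div_iff₀' hs]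
      exact (hdual _).trans (h.g_lip i x hx z hz)
    g_smooth := fun i x hx z hz => by
      rw [div_right_comm, div_mul_eq_mul_div, le_div_iff₀' hs]
      exact (hdual _).trans (h.g_smooth i x hx z hz)
    gs_memLp := fun i x hx => memLp_two_of_lintegral_const_sub_sq_lt_top _ (hgs i x)
      ((hvar₀ i x hx).trans_lt ENNReal.ofReal_lt_top)
    gs_var := fun i x hx => integral_sq_le_of_lintegral_sq_le
      (aestronglyMeasurable_const.sub (hgs i x)) (by positivity) (hvar₀ i x hx)
    dgs_memLp := fun i x hx => memLp_two_of_lintegral_const_sub_sq_lt_top _ (hdgs i x)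
      ((hvar₁ i x hx).trans_lt ENNReal.ofReal_lt_top)
    dgs_var := fun i x hx => integral_sq_le_of_lintegral_sq_le
      (aestronglyMeasurable_const.sub (hdgs i x)) (by positivity) (hvar₁ i x hx) }

end Problem.Assumptions

namespace Problem.EuclideanAssumptions

variable {p : Problem n d m Z} {K G Λ s₀ s₁ δ : ℝ}

theorem norm_le (h : p.EuclideanAssumptions K G Λ s₀ s₁ δ) {i : Fin n} {v : Vec m}
    (hv : v ∈ dualSet (p.f i)) : ‖v‖ ≤ K :=
  norm_le_of_mem_dualSet h.K_nonneg (h.f_lip i) hv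

theorem norm_g_segment_sub_le (h : p.EuclideanAssumptions K G Λ s₀ s₁ δ) (i : Fin n)
    {x z : Vec d} (hx : x ∈ p.X) (hz : z ∈ p.X) {s : ℝ} (hs₀ : 0 < s) (hs₁ : s < 1) :
    ‖p.g i (x + s • (z - x)) - p.g i x - s • p.dg i x (z - x)‖
      ≤ s ^ 2 * (Λ / 2 * ‖z - x‖ ^ 2) := by
  have hle := h.g_smooth i _ (h.convex_X.add_smul_sub_mem hx hz ⟨hs₀.le, hs₁.le⟩) x hx
  rw [add_sub_cancel_left, map_smul, norm_smul, mul_pow, Real.norm_eq_abs, sq_abs] at hle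
  linarith

theorem inner_dg_le (h : p.EuclideanAssumptions K G Λ s₀ s₁ δ) {i : Fin n} {x z : Vec d}
    (hx : x ∈ p.X) (hz : z ∈ p.X) {v : Vec m} (hv : v ∈ dualSet (p.f i)) :
    ⟪v, p.dg i x (z - x)⟫ ≤ ⟪v, p.g i z⟫ - ⟪v, p.g i x⟫ := by
  rw [← sub_nonneg]
  refine nonneg_of_forall_add_mul (b := ‖v‖ * (Λ / 2 * ‖z - x‖ ^ 2)) fun s hs₀ hs₁ => ?_
  have hconv := (h.inner_convex i v hv).2 hx hz (sub_nonneg.2 hs₁.le) hs₀.le (sub_add_cancel 1 s)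
  rw [show (1 - s) • x + s • z = x + s • (z - x) by module] at hconv
  have hrem := (neg_le_abs _).trans ((abs_real_inner_le_norm v _).trans
    (mul_le_mul_of_nonneg_left (h.norm_g_segment_sub_le i hx hz hs₀ hs₁) (norm_nonneg v)))
  simp only [inner_sub_right, inner_smul_right] at hrem
  refine le_of_mul_le_mul_left ?_ hs₀
  simp only [smul_eq_mul] at hconv
  linarith

theorem norm_dg_le (h : p.EuclideanAssumptions K G Λ s₀ s₁ δ) (i : Fin n) {x z : Vec d}
    (hx : x ∈ p.X) (hz : z ∈ p.X) : ‖p.dg i x (z - x)‖ ≤ G * ‖z - x‖ := by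
  rw [← sub_nonneg]
  refine nonneg_of_forall_add_mul (b := Λ / 2 * ‖z - x‖ ^ 2) fun s hs₀ hs₁ => ?_
  have hlip := h.g_lip i _ (h.convex_X.add_smul_sub_mem hx hz ⟨hs₀.le, hs₁.le⟩) x hx
  have htri := (norm_le_norm_add_norm_sub' (s • p.dg i x (z - x))
    (p.g i (x + s • (z - x)) - p.g i x)).trans (add_le_add hlip
      ((norm_sub_rev _ _).trans_le (h.norm_g_segment_sub_le i hx hz hs₀ hs₁)))
  simp only [add_sub_cancel_left, norm_smul, Real.norm_of_nonneg hs₀.le] at htri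
  refine le_of_mul_le_mul_left ?_ hs₀
  linarith

end Problem.EuclideanAssumptions

end EuclideanForm

/-! ### Inequalities for one block of dual iterates -/

section Block

variable {E : Type*} [NormedAddCommGroup E] [InnerProductSpace ℝ E]

theorem inner_le_weighted {a : ℝ} (ha : 0 < a) (u v : E) :
    ⟪u, v⟫ ≤ a / 2 * ‖u‖ ^ 2 + 1 / (2 * a) * ‖v‖ ^ 2 := by
  refine (real_inner_le_norm u v).trans ?_
  have hsq : a / 2 * ‖u‖ ^ 2 + 1 / (2 * a) * ‖v‖ ^ 2 - ‖u‖ * ‖v‖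
      = 1 / (2 * a) * (a * ‖u‖ - ‖v‖) ^ 2 := by
    field_simp
    ring
  rw [← sub_nonneg, hsq]
  positivity

theorem inner_le_norm_sq_div_eight {τ : ℝ} (hτ : 0 < τ) (u v : E) :
    ⟪u, v⟫ ≤ τ / 8 * ‖u‖ ^ 2 + 2 / τ * ‖v‖ ^ 2 := by
  have h := inner_le_weighted (a := τ / 4) (by positivity) u v
  rwa [show 1 / (2 * (τ / 4)) = 2 / τ by field_simp; norm_num, div_div,
    show (4 * 2 : ℝ) = 8 by norm_num] at h

theorem sum_inner_sub_succ_sub {Δ : ℕ → E} (hΔ : Δ 0 = 0) (z : ℕ → E) (w : E) (T : ℕ) :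
    ∑ t ∈ Finset.range (T + 1), ⟪w - z t, Δ (t + 1) - Δ t⟫
      = ⟪w - z T, Δ (T + 1)⟫ + ∑ t ∈ Finset.range T, ⟪z (t + 1) - z t, Δ (t + 1)⟫ := by
  induction T with
  | zero => simp [hΔ]
  | succ T ih =>
    rw [Finset.sum_range_succ, ih, Finset.sum_range_succ _ T]
    simp only [inner_sub_left, inner_sub_right]
    ring

variable {τ : ℝ} {y z Δ : ℕ → E}

theorem coupling_sum_le (hτ : 0 < τ) (hΔ : Δ 0 = 0)
    (hy : ∀ t, y (t + 1) = z t ∨ y (t + 1) = y t) (w : E) (T : ℕ) :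
    ∑ t ∈ Finset.range (T + 1), ⟪w - z t, Δ (t + 1) - Δ t⟫
      ≤ ⟪w - z T, Δ (T + 1)⟫ + τ / 4 * ∑ t ∈ Finset.range (T + 1), ‖z t - y t‖ ^ 2
        + 4 / τ * ∑ t ∈ Finset.range (T + 1), ‖Δ t‖ ^ 2 := by
  have hstep (t : ℕ) : ⟪z (t + 1) - z t, Δ (t + 1)⟫ ≤ τ / 8 * ‖z (t + 1) - y (t + 1)‖ ^ 2
      + τ / 8 * ‖z t - y t‖ ^ 2 + 4 / τ * ‖Δ (t + 1)‖ ^ 2 := by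
    have hle : ‖y (t + 1) - z t‖ ≤ ‖z t - y t‖ := by
      rcases hy t with h | h
      · simp [h]
      · rw [h, norm_sub_rev]
    have h₁ := inner_le_norm_sq_div_eight hτ (z (t + 1) - y (t + 1)) (Δ (t + 1))
    have h₂ := inner_le_norm_sq_div_eight hτ (y (t + 1) - z t) (Δ (t + 1))
    have h₃ : τ / 8 * ‖y (t + 1) - z t‖ ^ 2 ≤ τ / 8 * ‖z t - y t‖ ^ 2 := by gcongr
    rw [← sub_add_sub_cancel _ (y (t + 1)), inner_add_left, show 4 / τ = 2 / τ + 2 / τ by ring]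
    linarith
  have hsum := Finset.sum_le_sum fun t (_ : t ∈ Finset.range T) => hstep t
  have hhead : 0 ≤ τ / 8 * ‖z 0 - y 0‖ ^ 2 := by positivity
  have hlast : 0 ≤ τ / 8 * ‖z T - y T‖ ^ 2 := by positivity
  have hshift := Finset.sum_range_succ' (fun t => ‖z t - y t‖ ^ 2) T
  have hsplit := Finset.sum_range_succ (fun t => ‖z t - y t‖ ^ 2) T
  rw [sum_inner_sub_succ_sub hΔ, Finset.sum_range_succ' (fun t => ‖Δ t‖ ^ 2), hΔ, norm_zero]
  simp only [Finset.sum_add_distrib, ← Finset.mul_sum] at hsum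
  linear_combination hsum + hhead + hlast - τ / 8 * hshift - τ / 8 * hsplit

theorem noise_sum_le (hτ : 0 < τ) (y z e : ℕ → E) (w : E) (T : ℕ) :
    ∑ t ∈ Finset.range T, ⟪w - z t, e t⟫
      ≤ τ / 2 * ‖w - y 0‖ ^ 2 + 1 / (2 * τ) * ‖∑ t ∈ Finset.range T, e t‖ ^ 2
        + ∑ t ∈ Finset.range T, ⟪y 0 - y t, e t⟫ + τ / 8 * ∑ t ∈ Finset.range T, ‖z t - y t‖ ^ 2
        + 2 / τ * ∑ t ∈ Finset.range T, ‖e t‖ ^ 2 := by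
  have htotal := inner_le_weighted hτ (w - y 0) (∑ t ∈ Finset.range T, e t)
  rw [inner_sum] at htotal
  have hstep : ∀ t ∈ Finset.range T, ⟪w - z t, e t⟫ ≤ ⟪w - y 0, e t⟫ + ⟪y 0 - y t, e t⟫
      + (τ / 8 * ‖z t - y t‖ ^ 2 + 2 / τ * ‖e t‖ ^ 2) := by
    intro t _
    have h := inner_le_norm_sq_div_eight hτ (y t - z t) (e t)
    rw [norm_sub_rev] at h
    simp only [inner_sub_left] at h ⊢
    linarith
  have hsum := Finset.sum_le_sum hstep
  simp only [Finset.sum_add_distrib, ← Finset.mul_sum] at hsum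
  linarith

variable {a b : ℝ} {c : ℕ → ℝ}

-- Since `c` is the deviation of the sampling weights from their mean, the sums on the right are
-- martingales, except that the comparison point `w` may depend on the noise.
theorem sum_norm_sub_sq_sub
    (hy : ∀ t, (y (t + 1) = z t ∧ c t = a - b) ∨ (y (t + 1) = y t ∧ c t = a)) (w : E) (T : ℕ) :
    a * ∑ t ∈ Finset.range T, τ / 2 * (‖w - y t‖ ^ 2 - ‖w - z t‖ ^ 2)
      = τ / 2 * b * (‖w - y 0‖ ^ 2 - ‖w - y T‖ ^ 2)
        + τ * ⟪w - y 0, ∑ t ∈ Finset.range T, c t • (z t - y t)⟫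
        + τ / 2 * ∑ t ∈ Finset.range T, c t * (‖y t - y 0‖ ^ 2 - ‖z t - y 0‖ ^ 2) := by
  have hpolar (v : E) :
      ‖w - v‖ ^ 2 = ‖w - y 0‖ ^ 2 - 2 * ⟪w - y 0, v - y 0⟫ + ‖v - y 0‖ ^ 2 := by
    rw [← norm_sub_sq_real, sub_sub_sub_cancel_right]
  induction T with
  | zero => simp
  | succ T ih =>
    have hinner : ⟪w - y 0, z T - y T⟫ = ⟪w - y 0, z T - y 0⟫ - ⟪w - y 0, y T - y 0⟫ := by
      rw [← inner_sub_right, sub_sub_sub_cancel_right]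
    simp only [Finset.sum_range_succ, mul_add, ih, inner_add_right, inner_smul_right]
    rw [hinner, hpolar (y T), hpolar (z T), hpolar (y (T + 1))]
    rcases hy T with ⟨h, hc⟩ | ⟨h, hc⟩ <;> rw [h, hc] <;> ring

theorem distance_sum_le (hτ : 0 < τ) (hb : 0 < b)
    (hy : ∀ t, (y (t + 1) = z t ∧ c t = a - b) ∨ (y (t + 1) = y t ∧ c t = a)) (w : E) (T : ℕ) :
    a * ∑ t ∈ Finset.range T, τ / 2 * (‖w - y t‖ ^ 2 - ‖w - z t‖ ^ 2)
      ≤ 5 / 2 * τ * b * ‖w - y 0‖ ^ 2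
        + τ / 2 * ∑ t ∈ Finset.range T, c t * (‖y t - y 0‖ ^ 2 - ‖z t - y 0‖ ^ 2)
        + τ / (8 * b) * ‖∑ t ∈ Finset.range T, c t • (z t - y t)‖ ^ 2 := by
  have hinner := mul_le_mul_of_nonneg_left (inner_le_weighted (a := 4 * b) (by positivity)
    (w - y 0) (∑ t ∈ Finset.range T, c t • (z t - y t))) hτ.le
  have hlast : 0 ≤ τ / 2 * b * ‖w - y T‖ ^ 2 := by positivity
  rw [sum_norm_sub_sq_sub hy, show τ / (8 * b) = τ * (1 / (2 * (4 * b))) by field_simp; norm_num]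
  linarith

theorem block_sum_le (hτ : 0 < τ) (ha : 0 ≤ a) (hab : a ≤ b) (hb : 0 < b) (hΔ : Δ 0 = 0)
    (hy : ∀ t, (y (t + 1) = z t ∧ c t = a - b) ∨ (y (t + 1) = y t ∧ c t = a))
    (e : ℕ → E) (w : E) (T : ℕ) :
    a * ∑ t ∈ Finset.range (T + 1), (⟪w - z t, Δ (t + 1) - Δ t + e t⟫
        + τ / 2 * (‖w - y t‖ ^ 2 - ‖w - z t‖ ^ 2 - ‖z t - y t‖ ^ 2))
      ≤ a * ⟪w - z T, Δ (T + 1)⟫ + a * (4 / τ * ∑ t ∈ Finset.range (T + 1), ‖Δ t‖ ^ 2)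
        + 3 * τ * b * ‖w - y 0‖ ^ 2
        + (a * ∑ t ∈ Finset.range (T + 1), ⟪y 0 - y t, e t⟫
          + τ / 2 * ∑ t ∈ Finset.range (T + 1), c t * (‖y t - y 0‖ ^ 2 - ‖z t - y 0‖ ^ 2))
        + (a * (1 / (2 * τ) * ‖∑ t ∈ Finset.range (T + 1), e t‖ ^ 2)
          + a * (2 / τ * ∑ t ∈ Finset.range (T + 1), ‖e t‖ ^ 2)
          + (τ / (8 * b) * ‖∑ t ∈ Finset.range (T + 1), c t • (z t - y t)‖ ^ 2
            - a * (τ / 8 * ∑ t ∈ Finset.range (T + 1), ‖z t - y t‖ ^ 2))) := by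
  have hcoupling := mul_le_mul_of_nonneg_left
    (coupling_sum_le hτ hΔ (fun t => (hy t).imp And.left And.left) w T) ha
  have hnoise := mul_le_mul_of_nonneg_left (noise_sum_le hτ y z e w (T + 1)) ha
  have hdistance := distance_sum_le hτ hb hy w (T + 1)
  have hab' : a * (τ / 2 * ‖w - y 0‖ ^ 2) ≤ b * (τ / 2 * ‖w - y 0‖ ^ 2) := by gcongr
  simp only [inner_add_right, mul_sub, Finset.sum_add_distrib, Finset.sum_sub_distrib,
    ← Finset.mul_sum] at hdistance ⊢
  linarith

end Block

/-! ### Dual and primal steps -/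

section Steps

variable {n d m : ℕ} {Z : Type*} [MeasurableSpace Z]

/-- `z` is the result of the dual step of a block with outer function `f` from `y₀`, where `u` is
the estimate of the inner function. -/
def IsDualStep (f : Vec m → ℝ) (τ : ℝ) (y₀ u z : Vec m) : Prop :=
  IsProxPoint {v | conj f v < ⊤} (fun v => (conj f v).toReal) τ (-u) y₀ z

/-- The effective domain of the regularizer on the feasible set. -/
def Problem.dom (p : Problem n d m Z) : Set (Vec d) := {x | x ∈ p.X ∧ p.r x < ⊤}

/-- `z` is the result of the primal step from `x₀` with the gradient estimate `c`. -/
def Problem.IsPrimalStep (p : Problem n d m Z) (η : ℝ) (x₀ c z : Vec d) : Prop :=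
  IsProxPoint p.dom (fun x => (p.r x).toReal) η c x₀ z

theorem isDualStep_of_isMaxOn {f : Vec m → ℝ} {τ : ℝ} {y₀ u z : Vec m} (hmem : z ∈ dualSet f)
    (hz : IsMaxOn (fun v : Vec m => ((⟪v, u⟫ - τ * bregman quad v y₀ : ℝ) : EReal) - conj f v)
      (dualSet f) z) : IsDualStep f τ y₀ u z := by
  refine ⟨conj_lt_top_of_isMaxOn hmem hz, fun v hv => ?_⟩
  have h := sub_toReal_conj_le_of_isMaxOn hmem hz hv
  simp only [bregman_quad, Set.mem_ofPred_eq, inner_neg_left, real_inner_comm] at h ⊢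
  linarith

theorem IsDualStep.inner_sub_le {f : Vec m → ℝ} {τ : ℝ} {y₀ u z w : Vec m}
    (hz : IsDualStep f τ y₀ u z) (hw : conj f w < ⊤) (v : Vec m) :
    ⟪w - z, v⟫ + (conj f z).toReal - (conj f w).toReal
      ≤ ⟪w - z, v - u⟫ + τ / 2 * (‖w - y₀‖ ^ 2 - ‖w - z‖ ^ 2 - ‖z - y₀‖ ^ 2) := by
  have h := IsProxPoint.three_point (convexOn_toReal_conj f) hz hw
  rw [inner_neg_left, inner_neg_left, real_inner_comm, real_inner_comm w] at h
  simp only [inner_sub_right, inner_sub_left w z u]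
  linarith

namespace Problem.EuclideanAssumptions

variable {p : Problem n d m Z} {K G Λ s₀ s₁ δ : ℝ}

theorem exists_isDualStep (h : p.EuclideanAssumptions K G Λ s₀ s₁ δ) (τ : ℝ) {i : Fin n}
    (hne : (dualSet (p.f i)).Nonempty) (y₀ u : Vec m) : ∃ z, IsDualStep (p.f i) τ y₀ u z := by
  have hcont : Continuous fun v : Vec m => ⟪v, u⟫ - τ * bregman quad v y₀ := by
    simp only [bregman_quad]
    fun_prop
  obtain ⟨z, hmem, hz⟩ := exists_isMaxOn_sub_conj h.K_nonneg (h.f_lip i) hne hcont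
  exact ⟨z, isDualStep_of_isMaxOn hmem hz⟩

theorem coe_toReal_r (h : p.EuclideanAssumptions K G Λ s₀ s₁ δ) {x : Vec d} (hx : x ∈ p.dom) :
    ((p.r x).toReal : EReal) = p.r x :=
  EReal.coe_toReal hx.2.ne (h.r_ne_bot x hx.1)

theorem dom_nonempty (h : p.EuclideanAssumptions K G Λ s₀ s₁ δ) : p.dom.Nonempty :=
  let ⟨x, hx, hr⟩ := h.r_proper
  ⟨x, hx, lt_top_iff_ne_top.2 hr⟩

theorem r_combo_le (h : p.EuclideanAssumptions K G Λ s₀ s₁ δ) {x z : Vec d} (hx : x ∈ p.dom)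
    (hz : z ∈ p.dom) {a b : ℝ} (ha : 0 < a) (hb : 0 < b) (hab : a + b = 1) :
    p.r (a • x + b • z) ≤ ((a * (p.r x).toReal + b * (p.r z).toReal : ℝ) : EReal) := by
  rw [EReal.coe_add, EReal.coe_mul, EReal.coe_mul, h.coe_toReal_r hx, h.coe_toReal_r hz]
  exact h.r_convex x hx.1 z hz.1 a b ha hb hab

theorem convexOn_r (h : p.EuclideanAssumptions K G Λ s₀ s₁ δ) :
    ConvexOn ℝ p.dom fun x => (p.r x).toReal := by
  have hmem {x z : Vec d} (hx : x ∈ p.dom) (hz : z ∈ p.dom) {a b : ℝ} (ha : 0 < a) (hb : 0 < b)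
      (hab : a + b = 1) : a • x + b • z ∈ p.dom :=
    ⟨h.convex_X hx.1 hz.1 ha.le hb.le hab,
      (h.r_combo_le hx hz ha hb hab).trans_lt (EReal.coe_lt_top _)⟩
  refine convexOn_iff_forall_pos.2 ⟨convex_iff_forall_pos.2 fun x hx z hz a b => hmem hx hz,
    fun x hx z hz a b ha hb hab => ?_⟩
  have hle := h.r_combo_le hx hz ha hb hab
  rwa [← h.coe_toReal_r (hmem hx hz ha hb hab), EReal.coe_le_coe_iff] at hle

theorem mem_dom_of_isMinOn (h : p.EuclideanAssumptions K G Λ s₀ s₁ δ) {φ : Vec d → ℝ} {z : Vec d}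
    (hzX : z ∈ p.X) (hz : IsMinOn (fun x => (φ x : EReal) + p.r x) p.X z) : z ∈ p.dom := by
  obtain ⟨w, hw⟩ := h.dom_nonempty
  refine ⟨hzX, ?_⟩
  have hle := hz hw.1
  by_contra hcon
  simp only [Set.mem_ofPred_eq, not_lt_top_iff.1 hcon, EReal.coe_add_top] at hle
  rw [← h.coe_toReal_r hw, ← EReal.coe_add] at hle
  exact EReal.coe_ne_top _ (top_le_iff.1 hle)

theorem isPrimalStep_of_isMinOn (h : p.EuclideanAssumptions K G Λ s₀ s₁ δ) {η : ℝ}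
    {x₀ c z : Vec d} (hzX : z ∈ p.X) (hz : IsMinOn (fun x : Vec d =>
      ((⟪c, x⟫ + η / 2 * ‖x - x₀‖ ^ 2 : ℝ) : EReal) + p.r x) p.X z) :
    p.IsPrimalStep η x₀ c z := by
  have hmem := h.mem_dom_of_isMinOn hzX hz
  refine ⟨hmem, fun v hv => ?_⟩
  have hle := hz hv.1
  simp only [Set.mem_ofPred_eq] at hle ⊢
  rw [← h.coe_toReal_r hv, ← h.coe_toReal_r hmem, ← EReal.coe_add, ← EReal.coe_add,
    EReal.coe_le_coe_iff] at hle
  linarith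

end Problem.EuclideanAssumptions

/-! ### The Lagrangian and the optimality gap -/

/-- The Lagrangian of the min-max form of the problem. Its value is meaningful only for `x` in
`p.dom` and `w i` in the domain of the conjugate of `p.f i`, because of the conversions of
extended reals. -/
def Problem.lagrangian (p : Problem n d m Z) (x : Vec d) (w : Fin n → Vec m) : ℝ :=
  1 / (n : ℝ) * ∑ i, (⟪w i, p.g i x⟫ - (conj (p.f i) (w i)).toReal) + (p.r x).toReal

/-- The objective as a real number, meaningful only on `p.dom`. -/
def Problem.realF (p : Problem n d m Z) (x : Vec d) : ℝ :=
  1 / (n : ℝ) * ∑ i, p.f i (p.g i x) + (p.r x).toReal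

theorem smul_sum_mem_of_convex {E : Type*} [AddCommGroup E] [Module ℝ E] {A : Set E}
    (hA : Convex ℝ A) {T : ℕ} (hT : 0 < T) {x : ℕ → E} (hx : ∀ t, x t ∈ A) :
    (1 / (T : ℝ)) • ∑ t ∈ Finset.range T, x t ∈ A := by
  rw [Finset.smul_sum]
  refine hA.sum_mem (fun _ _ => by positivity) ?_ fun t _ => hx t
  rw [Finset.sum_const, Finset.card_range, nsmul_eq_mul]
  field_simp

theorem mul_map_smul_sum_le_of_convexOn {E : Type*} [AddCommGroup E] [Module ℝ E] {A : Set E}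
    {φ : E → ℝ} (hφ : ConvexOn ℝ A φ) {T : ℕ} (hT : 0 < T) {x : ℕ → E} (hx : ∀ t, x t ∈ A) :
    T * φ ((1 / (T : ℝ)) • ∑ t ∈ Finset.range T, x t) ≤ ∑ t ∈ Finset.range T, φ (x t) := by
  have hle := hφ.map_sum_le (t := Finset.range T) (w := fun _ => 1 / (T : ℝ)) (p := x)
    (fun _ _ => by positivity)
    (by rw [Finset.sum_const, Finset.card_range, nsmul_eq_mul]; field_simp) fun t _ => hx t
  rwa [← Finset.smul_sum, ← Finset.smul_sum, smul_eq_mul, one_div, ← div_eq_inv_mul,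
    le_div_iff₀' (Nat.cast_pos.2 hT), ← one_div] at hle

theorem Problem.lagrangian_le_realF {p : Problem n d m Z} (x : Vec d) {w : Fin n → Vec m}
    (hw : ∀ i, conj (p.f i) (w i) < ⊤) : p.lagrangian x w ≤ p.realF x := by
  unfold lagrangian realF
  gcongr with i
  exact fenchel_young (hw i) _

namespace Problem.EuclideanAssumptions

variable {p : Problem n d m Z} {K G Λ s₀ s₁ δ : ℝ}

theorem realF_le_lagrangian (h : p.EuclideanAssumptions K G Λ s₀ s₁ δ) {x : Vec d}
    {w : Fin n → Vec m} (hw : ∀ i, w i ∈ dualSet (p.f i) ∧ IsMaxOn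
      (fun v : Vec m => ((⟪v, p.g i x⟫ : ℝ) : EReal) - conj (p.f i) v) (dualSet (p.f i)) (w i)) :
    p.realF x ≤ p.lagrangian x w := by
  unfold lagrangian realF
  gcongr with i
  exact le_inner_sub_conj_of_isMaxOn (h.f_convex i) (hw i).1 (hw i).2

theorem convexOn_lagrangian (h : p.EuclideanAssumptions K G Λ s₀ s₁ δ) {w : Fin n → Vec m}
    (hw : ∀ i, w i ∈ dualSet (p.f i)) : ConvexOn ℝ p.dom fun x => p.lagrangian x w := by
  refine ConvexOn.add (ConvexOn.smul (by positivity) ?_) h.convexOn_r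
  refine ⟨h.convexOn_r.1, fun x hx z hz a b ha hb hab => ?_⟩
  simp only [Finset.smul_sum, ← Finset.sum_add_distrib]
  refine Finset.sum_le_sum fun i _ => ?_
  exact ((h.inner_convex i (w i) (hw i)).sub (concaveOn_const _ h.convex_X)).2 hx.1 hz.1 ha hb hab

theorem F_eq_coe (h : p.EuclideanAssumptions K G Λ s₀ s₁ δ) {x : Vec d} (hx : x ∈ p.dom) :
    p.F x = (p.realF x : EReal) := by
  rw [realF, EReal.coe_add, h.coe_toReal_r hx, F]

theorem mul_realF_sub_le (h : p.EuclideanAssumptions K G Λ s₀ s₁ δ) (xs : Vec d) {T : ℕ}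
    (hT : 0 < T) {x : ℕ → Vec d} (hx : ∀ t, x t ∈ p.dom) {w : Fin n → Vec m}
    (hw : ∀ i, w i ∈ dualSet (p.f i) ∧ IsMaxOn (fun v : Vec m =>
        ((⟪v, p.g i ((1 / (T : ℝ)) • ∑ t ∈ Finset.range T, x t)⟫ : ℝ) : EReal) - conj (p.f i) v)
        (dualSet (p.f i)) (w i)) {v : ℕ → Fin n → Vec m}
    (hv : ∀ t i, conj (p.f i) (v t i) < ⊤) :
    T * (p.realF ((1 / (T : ℝ)) • ∑ t ∈ Finset.range T, x t) - p.realF xs)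
      ≤ ∑ t ∈ Finset.range T, (p.lagrangian (x t) w - p.lagrangian xs (v t)) := by
  set xb := (1 / (T : ℝ)) • ∑ t ∈ Finset.range T, x t
  have hupper : T * p.realF xb ≤ ∑ t ∈ Finset.range T, p.lagrangian (x t) w :=
    (mul_le_mul_of_nonneg_left (h.realF_le_lagrangian hw) T.cast_nonneg).trans
      (mul_map_smul_sum_le_of_convexOn (h.convexOn_lagrangian fun i => (hw i).1) hT hx)
  have hlower : ∑ t ∈ Finset.range T, p.lagrangian xs (v t) ≤ T * p.realF xs := by
    rw [← nsmul_eq_mul]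
    refine (Finset.sum_le_card_nsmul _ _ _ fun t _ => lagrangian_le_realF xs (hv t)).trans_eq ?_
    rw [Finset.card_range]
  rw [mul_sub, Finset.sum_sub_distrib]
  exact sub_le_sub hupper hlower

end Problem.EuclideanAssumptions

end Steps

/-! ### Trajectories -/

section Trajectories

variable {n d m : ℕ} {Z : Type*} [MeasurableSpace Z]

/-- One realization of the iterates of the algorithm: primal iterates `x`, dual iterates `y`, full
dual steps `z` (the updates of all blocks, sampled or not), sampled blocks `s`, estimates `u` of the
extrapolated inner functions, and gradient estimates `c`. -/
structure Trajectory (n d m : ℕ) where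
  x : ℕ → Vec d
  y : ℕ → Fin n → Vec m
  z : ℕ → Fin n → Vec m
  s : ℕ → Finset (Fin n)
  u : ℕ → Fin n → Vec m
  c : ℕ → Vec d

/-- The trajectory follows the update rules of the algorithm with step parameters `η` and `τ`. -/
structure Problem.IsTrajectory (p : Problem n d m Z) (η τ : ℝ) (tr : Trajectory n d m) :
    Prop where
  x_zero : tr.x 0 ∈ p.X
  y_zero : ∀ i, tr.y 0 i ∈ dualSet (p.f i)
  dual_step : ∀ t i, IsDualStep (p.f i) τ (tr.y t i) (tr.u t i) (tr.z t i)
  primal_step : ∀ t, p.IsPrimalStep η (tr.x t) (tr.c t) (tr.x (t + 1))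
  y_sampled : ∀ t, ∀ i ∈ tr.s t, tr.y (t + 1) i = tr.z t i
  y_unsampled : ∀ t, ∀ i ∉ tr.s t, tr.y (t + 1) i = tr.y t i

/-- The error of the estimate `u` of the extrapolated inner function. -/
def Problem.innerError (p : Problem n d m Z) (i : Fin n) (x x' : Vec d) (u : Vec m) : Vec m :=
  (2 : ℝ) • p.g i x - p.g i x' - u

/-- The gradient of the coupling term of the Lagrangian with respect to the primal variable. -/
def Problem.fullGrad (p : Problem n d m Z) (x : Vec d) (z : Fin n → Vec m) : Vec d :=
  (1 / (n : ℝ)) • ∑ i, (p.dg i x).adjoint (z i)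

/-- The error of the gradient estimate at time `t`. -/
def Problem.gradError (p : Problem n d m Z) (tr : Trajectory n d m) (t : ℕ) : Vec d :=
  p.fullGrad (tr.x t) (tr.z t) - tr.c t

/-- The deviation of the sampling weight of a block from its mean. -/
def samplingDev (S : ℕ) (s : Finset (Fin n)) (i : Fin n) : ℝ :=
  1 / (n : ℝ) - if i ∈ s then 1 / (S : ℝ) else 0

/-- The part of the error bound of a block whose expectation vanishes. -/
def Problem.blockMartingaleTerm (p : Problem n d m Z) (S : ℕ) (τ : ℝ) (tr : Trajectory n d m)
    (T : ℕ) (i : Fin n) : ℝ :=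
  1 / (n : ℝ) * ∑ t ∈ Finset.range T,
      ⟪tr.y 0 i - tr.y t i, p.innerError i (tr.x t) (tr.x (t - 1)) (tr.u t i)⟫
    + τ / 2 * ∑ t ∈ Finset.range T,
      samplingDev S (tr.s t) i * (‖tr.y t i - tr.y 0 i‖ ^ 2 - ‖tr.z t i - tr.y 0 i‖ ^ 2)

/-- The part of the error bound of a block that is quadratic in the errors. -/
def Problem.blockQuadraticTerm (p : Problem n d m Z) (S : ℕ) (τ : ℝ) (tr : Trajectory n d m)
    (T : ℕ) (i : Fin n) : ℝ :=
  1 / (n : ℝ) * (1 / (2 * τ)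
      * ‖∑ t ∈ Finset.range T, p.innerError i (tr.x t) (tr.x (t - 1)) (tr.u t i)‖ ^ 2)
    + 1 / (n : ℝ) * (2 / τ
      * ∑ t ∈ Finset.range T, ‖p.innerError i (tr.x t) (tr.x (t - 1)) (tr.u t i)‖ ^ 2)
    + (τ / (8 * (1 / (S : ℝ)))
        * ‖∑ t ∈ Finset.range T, samplingDev S (tr.s t) i • (tr.z t i - tr.y t i)‖ ^ 2
      - 1 / (n : ℝ) * (τ / 8 * ∑ t ∈ Finset.range T, ‖tr.z t i - tr.y t i‖ ^ 2))

/-- The terms of the error bound whose expectation vanishes. -/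
def Problem.martingaleTerm (p : Problem n d m Z) (S : ℕ) (τ : ℝ) (xs : Vec d)
    (tr : Trajectory n d m) (T : ℕ) : ℝ :=
  ∑ t ∈ Finset.range T, ⟪p.gradError tr t, tr.x t - xs⟫ + ∑ i, p.blockMartingaleTerm S τ tr T i

/-- The terms of the error bound that are quadratic in the errors. -/
def Problem.quadraticTerm (p : Problem n d m Z) (S : ℕ) (η τ : ℝ) (tr : Trajectory n d m)
    (T : ℕ) : ℝ :=
  2 / η * ∑ t ∈ Finset.range T, ‖p.gradError tr t‖ ^ 2 + ∑ i, p.blockQuadraticTerm S τ tr T i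

variable {p : Problem n d m Z} {K G Λ s₀ s₁ δ η τ : ℝ} {tr : Trajectory n d m}

namespace Problem.IsTrajectory

theorem x_mem (ht : p.IsTrajectory η τ tr) (t : ℕ) : tr.x t ∈ p.X := by
  cases t with
  | zero => exact ht.x_zero
  | succ t => exact (ht.primal_step t).1.1

theorem z_mem (ht : p.IsTrajectory η τ tr) (t : ℕ) (i : Fin n) : tr.z t i ∈ dualSet (p.f i) :=
  mem_dualSet (ht.dual_step t i).1

theorem y_mem (ht : p.IsTrajectory η τ tr) (t : ℕ) (i : Fin n) : tr.y t i ∈ dualSet (p.f i) := by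
  induction t with
  | zero => exact ht.y_zero i
  | succ t ih =>
    by_cases hi : i ∈ tr.s t
    · rw [ht.y_sampled t i hi]
      exact ht.z_mem t i
    · rwa [ht.y_unsampled t i hi]

theorem dual_step_le (ht : p.IsTrajectory η τ tr) {w : Fin n → Vec m} {i : Fin n}
    (hw : conj (p.f i) (w i) < ⊤) (t : ℕ) :
    ⟪w i - tr.z t i, p.g i (tr.x (t + 1))⟫ + (conj (p.f i) (tr.z t i)).toReal
        - (conj (p.f i) (w i)).toReal
      ≤ ⟪w i - tr.z t i, (p.g i (tr.x (t + 1)) - p.g i (tr.x t))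
          - (p.g i (tr.x t) - p.g i (tr.x (t - 1)))
          + p.innerError i (tr.x t) (tr.x (t - 1)) (tr.u t i)⟫
        + τ / 2 * (‖w i - tr.y t i‖ ^ 2 - ‖w i - tr.z t i‖ ^ 2 - ‖tr.z t i - tr.y t i‖ ^ 2) := by
  convert IsDualStep.inner_sub_le (ht.dual_step t i) hw (p.g i (tr.x (t + 1))) using 3
  rw [Problem.innerError]
  module

end Problem.IsTrajectory

theorem inner_fullGrad (x : Vec d) (z : Fin n → Vec m) (v : Vec d) :
    ⟪p.fullGrad x z, v⟫ = 1 / (n : ℝ) * ∑ i, ⟪z i, p.dg i x v⟫ := by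
  rw [Problem.fullGrad, inner_smul_left, sum_inner]
  simp only [conj_trivial, ContinuousLinearMap.adjoint_inner_left]

theorem lagrangian_sub_lagrangian (x xs : Vec d) (w z : Fin n → Vec m) :
    p.lagrangian x w - p.lagrangian xs z
      = 1 / (n : ℝ) * ∑ i, (⟪w i - z i, p.g i x⟫ + (conj (p.f i) (z i)).toReal
          - (conj (p.f i) (w i)).toReal)
        + (1 / (n : ℝ) * ∑ i, ⟪z i, p.g i x - p.g i xs⟫
          + ((p.r x).toReal - (p.r xs).toReal)) := by
  simp only [Problem.lagrangian, inner_sub_left, inner_sub_right, Finset.sum_add_distrib,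
    Finset.sum_sub_distrib]
  ring

theorem one_div_mul_sum_const (hn : 0 < n) (a : ℝ) : 1 / (n : ℝ) * ∑ _i : Fin n, a = a := by
  rw [Finset.sum_const, Finset.card_univ, Fintype.card_fin, nsmul_eq_mul, ← mul_assoc,
    one_div_mul_cancel (Nat.cast_pos.2 hn).ne', one_mul]

namespace Problem.EuclideanAssumptions

theorem coupling_sub_le (h : p.EuclideanAssumptions K G Λ s₀ s₁ δ) (hn : 0 < n) {x x' xs : Vec d}
    (hx : x ∈ p.X) (hx' : x' ∈ p.X) (hxs : xs ∈ p.X) {z : Fin n → Vec m}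
    (hz : ∀ i, z i ∈ dualSet (p.f i)) :
    1 / (n : ℝ) * ∑ i, ⟪z i, p.g i x' - p.g i xs⟫
      ≤ ⟪p.fullGrad x z, x' - xs⟫ + K * (Λ / 2 * ‖x' - x‖ ^ 2) := by
  have hblock (i : Fin n) : ⟪z i, p.g i x' - p.g i xs⟫
      ≤ ⟪z i, p.dg i x (x' - xs)⟫ + K * (Λ / 2 * ‖x' - x‖ ^ 2) := by
    have hconvex := h.inner_dg_le hx hxs (hz i)
    have hsmooth : ⟪z i, p.g i x' - p.g i x - p.dg i x (x' - x)⟫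
        ≤ K * (Λ / 2 * ‖x' - x‖ ^ 2) :=
      (real_inner_le_norm _ _).trans <| mul_le_mul (h.norm_le (hz i))
        (h.g_smooth i x' hx' x hx) (norm_nonneg _) h.K_nonneg
    simp only [map_sub, inner_sub_right] at hconvex hsmooth ⊢
    linarith
  calc 1 / (n : ℝ) * ∑ i, ⟪z i, p.g i x' - p.g i xs⟫
      ≤ 1 / (n : ℝ) * ∑ i, (⟪z i, p.dg i x (x' - xs)⟫ + K * (Λ / 2 * ‖x' - x‖ ^ 2)) := by
        gcongr with i
        exact hblock i
    _ = _ := by rw [Finset.sum_add_distrib, mul_add, one_div_mul_sum_const hn, inner_fullGrad]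

theorem primal_step_le (h : p.EuclideanAssumptions K G Λ s₀ s₁ δ) (hn : 0 < n) (hη : 0 < η)
    (hηΛ : 4 * K * Λ ≤ η) {x x' c xs : Vec d} {z : Fin n → Vec m} (hx : x ∈ p.X)
    (hz : ∀ i, z i ∈ dualSet (p.f i)) (hx' : p.IsPrimalStep η x c x') (hxs : xs ∈ p.dom) :
    1 / (n : ℝ) * ∑ i, ⟪z i, p.g i x' - p.g i xs⟫ + ((p.r x').toReal - (p.r xs).toReal)
      ≤ ⟪p.fullGrad x z - c, x - xs⟫ + 2 / η * ‖p.fullGrad x z - c‖ ^ 2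
        + η / 2 * (‖x - xs‖ ^ 2 - ‖x' - xs‖ ^ 2) - η / 4 * ‖x' - x‖ ^ 2 := by
  have hcoupling := h.coupling_sub_le hn hx hx'.1.1 hxs.1 hz
  have hprox := IsProxPoint.three_point h.convexOn_r hx' hxs
  have hyoung := inner_le_norm_sq_div_eight hη (x' - x) (p.fullGrad x z - c)
  have hstep : K * (Λ / 2 * ‖x' - x‖ ^ 2) ≤ η / 8 * ‖x' - x‖ ^ 2 := by
    rw [← mul_assoc]
    gcongr
    linarith
  have hsplit : ⟪p.fullGrad x z, x' - xs⟫ = ⟪p.fullGrad x z - c, x - xs⟫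
      + ⟪x' - x, p.fullGrad x z - c⟫ + (⟪c, x'⟫ - ⟪c, xs⟫) := by
    rw [real_inner_comm (p.fullGrad x z - c) (x' - x)]
    simp only [inner_sub_left, inner_sub_right]
    ring
  rw [norm_sub_rev xs x', norm_sub_rev xs x] at hprox
  linarith

theorem inner_g_sub_le (h : p.EuclideanAssumptions K G Λ s₀ s₁ δ) {i : Fin n} {v w : Vec m}
    (hv : v ∈ dualSet (p.f i)) (hw : w ∈ dualSet (p.f i)) {x x' : Vec d} (hx : x ∈ p.X)
    (hx' : x' ∈ p.X) : ⟪w - v, p.g i x' - p.g i x⟫ ≤ 2 * K * G * ‖x' - x‖ := by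
  have hnorm : ‖w - v‖ ≤ 2 * K := by
    linarith [norm_sub_le w v, h.norm_le hv, h.norm_le hw]
  calc ⟪w - v, p.g i x' - p.g i x⟫ ≤ ‖w - v‖ * ‖p.g i x' - p.g i x‖ := real_inner_le_norm _ _
    _ ≤ 2 * K * (G * ‖x' - x‖) := mul_le_mul hnorm (h.g_lip i x' hx' x hx) (norm_nonneg _)
        (mul_nonneg zero_le_two h.K_nonneg)
    _ = _ := by ring

theorem sum_norm_g_sub_sq_le (h : p.EuclideanAssumptions K G Λ s₀ s₁ δ) {x : ℕ → Vec d}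
    (hx : ∀ t, x t ∈ p.X) (i : Fin n) (T : ℕ) :
    ∑ t ∈ Finset.range (T + 1), ‖p.g i (x t) - p.g i (x (t - 1))‖ ^ 2
      ≤ G ^ 2 * ∑ t ∈ Finset.range T, ‖x (t + 1) - x t‖ ^ 2 := by
  rw [Finset.sum_range_succ', Finset.mul_sum]
  simp only [Nat.add_sub_cancel, Nat.zero_sub, sub_self, norm_zero, ne_eq, OfNat.ofNat_ne_zero,
    not_false_eq_true, zero_pow, add_zero, ← mul_pow]
  gcongr with t
  exact h.g_lip i _ (hx (t + 1)) _ (hx t)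

theorem block_error_sum_le (h : p.EuclideanAssumptions K G Λ s₀ s₁ δ) {S : ℕ} (hS : 0 < S)
    (hSn : S ≤ n) (hτ : 0 < τ) (hητ : 32 * G ^ 2 ≤ η * τ) (ht : p.IsTrajectory η τ tr)
    {i : Fin n} {w : Vec m} (hw : w ∈ dualSet (p.f i)) (T : ℕ) :
    1 / (n : ℝ) * ∑ t ∈ Finset.range (T + 1),
        (⟪w - tr.z t i, (p.g i (tr.x (t + 1)) - p.g i (tr.x t))
          - (p.g i (tr.x t) - p.g i (tr.x (t - 1)))
          + p.innerError i (tr.x t) (tr.x (t - 1)) (tr.u t i)⟫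
        + τ / 2 * (‖w - tr.y t i‖ ^ 2 - ‖w - tr.z t i‖ ^ 2 - ‖tr.z t i - tr.y t i‖ ^ 2))
      ≤ 1 / (n : ℝ) * (2 * K * G * ‖tr.x (T + 1) - tr.x T‖
          + η / 8 * ∑ t ∈ Finset.range T, ‖tr.x (t + 1) - tr.x t‖ ^ 2)
        + 3 * τ * (1 / S) * ‖w - tr.y 0 i‖ ^ 2
        + p.blockMartingaleTerm S τ tr (T + 1) i + p.blockQuadraticTerm S τ tr (T + 1) i := by
  have : (0 : ℝ) < S := Nat.cast_pos.2 hS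
  have hsampling (t : ℕ) :
      (tr.y (t + 1) i = tr.z t i ∧ samplingDev S (tr.s t) i = 1 / (n : ℝ) - 1 / (S : ℝ))
      ∨ (tr.y (t + 1) i = tr.y t i ∧ samplingDev S (tr.s t) i = 1 / (n : ℝ)) := by
    by_cases hi : i ∈ tr.s t
    · exact Or.inl ⟨ht.y_sampled t i hi, by simp [samplingDev, hi]⟩
    · exact Or.inr ⟨ht.y_unsampled t i hi, by simp [samplingDev, hi]⟩
  have hmain := block_sum_le (y := fun t => tr.y t i) (z := fun t => tr.z t i)
    (Δ := fun t => p.g i (tr.x t) - p.g i (tr.x (t - 1))) (c := fun t => samplingDev S (tr.s t) i)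
    hτ (by positivity) (by gcongr) (by positivity) (by simp) hsampling
    (fun t => p.innerError i (tr.x t) (tr.x (t - 1)) (tr.u t i)) w T
  have hlast : 1 / (n : ℝ) * ⟪w - tr.z T i, p.g i (tr.x (T + 1)) - p.g i (tr.x T)⟫
      ≤ 1 / (n : ℝ) * (2 * K * G * ‖tr.x (T + 1) - tr.x T‖) := by
    gcongr
    exact h.inner_g_sub_le (ht.z_mem T i) hw (ht.x_mem T) (ht.x_mem (T + 1))
  have hdiff : 1 / (n : ℝ) * (4 / τ * ∑ t ∈ Finset.range (T + 1),
        ‖p.g i (tr.x t) - p.g i (tr.x (t - 1))‖ ^ 2)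
      ≤ 1 / (n : ℝ) * (η / 8 * ∑ t ∈ Finset.range T, ‖tr.x (t + 1) - tr.x t‖ ^ 2) := by
    have hcoef : 4 / τ * G ^ 2 ≤ η / 8 := by
      rw [div_mul_eq_mul_div, div_le_iff₀ hτ]
      linarith
    gcongr ?_ * ?_
    refine (mul_le_mul_of_nonneg_left (h.sum_norm_g_sub_sq_le ht.x_mem i T)
      (by positivity)).trans ?_
    rw [← mul_assoc]
    gcongr
  simp only [Nat.add_sub_cancel] at hmain
  simp only [Problem.blockMartingaleTerm, Problem.blockQuadraticTerm]
  linarith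

theorem lagrangian_step_le (h : p.EuclideanAssumptions K G Λ s₀ s₁ δ) (hn : 0 < n) (hη : 0 < η)
    (hηΛ : 4 * K * Λ ≤ η) (ht : p.IsTrajectory η τ tr) {xs : Vec d} (hxs : xs ∈ p.dom)
    {w : Fin n → Vec m} (hw : ∀ i, conj (p.f i) (w i) < ⊤) (t : ℕ) :
    p.lagrangian (tr.x (t + 1)) w - p.lagrangian xs (tr.z t)
      ≤ (⟪p.gradError tr t, tr.x t - xs⟫ + 2 / η * ‖p.gradError tr t‖ ^ 2
        + η / 2 * (‖tr.x t - xs‖ ^ 2 - ‖tr.x (t + 1) - xs‖ ^ 2)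
        - η / 4 * ‖tr.x (t + 1) - tr.x t‖ ^ 2)
        + ∑ i, 1 / (n : ℝ) * (⟪w i - tr.z t i, (p.g i (tr.x (t + 1)) - p.g i (tr.x t))
          - (p.g i (tr.x t) - p.g i (tr.x (t - 1)))
          + p.innerError i (tr.x t) (tr.x (t - 1)) (tr.u t i)⟫
        + τ / 2 * (‖w i - tr.y t i‖ ^ 2 - ‖w i - tr.z t i‖ ^ 2
          - ‖tr.z t i - tr.y t i‖ ^ 2)) := by
  rw [lagrangian_sub_lagrangian, add_comm, ← Finset.mul_sum]
  refine add_le_add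
    (h.primal_step_le hn hη hηΛ (ht.x_mem t) (ht.z_mem t) (ht.primal_step t) hxs) ?_
  gcongr with i
  exact ht.dual_step_le (hw i) t

theorem sum_lagrangian_sub_le (h : p.EuclideanAssumptions K G Λ s₀ s₁ δ) {S : ℕ} (hS : 0 < S)
    (hSn : S ≤ n) (hη : 0 < η) (hτ : 0 < τ) (hηΛ : 4 * K * Λ ≤ η) (hητ : 32 * G ^ 2 ≤ η * τ)
    (ht : p.IsTrajectory η τ tr) {xs : Vec d} (hxs : xs ∈ p.dom) {w : Fin n → Vec m}
    (hw : ∀ i, conj (p.f i) (w i) < ⊤) (T : ℕ) :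
    ∑ t ∈ Finset.range (T + 1), (p.lagrangian (tr.x (t + 1)) w - p.lagrangian xs (tr.z t))
      ≤ η / 2 * ‖tr.x 0 - xs‖ ^ 2 + 8 * K ^ 2 * G ^ 2 / η
        + 3 * τ * (1 / S) * ∑ i, ‖w i - tr.y 0 i‖ ^ 2
        + p.martingaleTerm S τ xs tr (T + 1) + p.quadraticTerm S η τ tr (T + 1) := by
  have hn : 0 < n := hS.trans_le hSn
  have hsteps := Finset.sum_le_sum fun t (_ : t ∈ Finset.range (T + 1)) =>
    h.lagrangian_step_le hn hη hηΛ ht hxs hw t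
  have hblocks := Finset.sum_le_sum fun i (_ : i ∈ Finset.univ) =>
    (Finset.mul_sum ..).symm.trans_le (h.block_error_sum_le hS hSn hτ hητ ht (mem_dualSet (hw i)) T)
  have htel : ∑ t ∈ Finset.range (T + 1), (‖tr.x t - xs‖ ^ 2 - ‖tr.x (t + 1) - xs‖ ^ 2)
      = ‖tr.x 0 - xs‖ ^ 2 - ‖tr.x (T + 1) - xs‖ ^ 2 :=
    Finset.sum_range_sub' (fun t => ‖tr.x t - xs‖ ^ 2) (T + 1)
  have hyoung : 2 * K * G * ‖tr.x (T + 1) - tr.x T‖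
      ≤ 8 * K ^ 2 * G ^ 2 / η + η / 8 * ‖tr.x (T + 1) - tr.x T‖ ^ 2 := by
    have hsq : 8 * K ^ 2 * G ^ 2 / η + η / 8 * ‖tr.x (T + 1) - tr.x T‖ ^ 2
          - 2 * K * G * ‖tr.x (T + 1) - tr.x T‖
        = (4 * K * G - η / 2 * ‖tr.x (T + 1) - tr.x T‖) ^ 2 / (2 * η) := by
      field_simp
      ring
    rw [← sub_nonneg, hsq]
    positivity
  have hincr := Finset.sum_range_succ (fun t => ‖tr.x (t + 1) - tr.x t‖ ^ 2) T
  have hend : 0 ≤ η / 2 * ‖tr.x (T + 1) - xs‖ ^ 2 := by positivity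
  have hpos : 0 ≤ η / 8 * ∑ t ∈ Finset.range (T + 1), ‖tr.x (t + 1) - tr.x t‖ ^ 2 := by
    positivity
  rw [Finset.sum_add_distrib, Finset.sum_comm] at hsteps
  rw [Finset.sum_add_distrib, Finset.sum_add_distrib, Finset.sum_add_distrib, ← Finset.mul_sum,
    one_div_mul_sum_const hn, ← Finset.mul_sum] at hblocks
  refine hsteps.trans ((add_le_add_right hblocks _).trans ?_)
  rw [Finset.sum_sub_distrib, Finset.sum_add_distrib, Finset.sum_add_distrib, ← Finset.mul_sum,
    ← Finset.mul_sum, ← Finset.mul_sum, htel, hincr]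
  rw [hincr] at hpos
  simp only [Problem.martingaleTerm, Problem.quadraticTerm]
  linarith

end Problem.EuclideanAssumptions

end Trajectories

/-! ### Independence and conditional moments -/

section Independence

variable {Ω α β γ : Type*} [MeasurableSpace α] [MeasurableSpace β] [MeasurableSpace γ]

theorem indep_sup_left {mΩ : MeasurableSpace Ω} {μ : Measure Ω} [IsProbabilityMeasure μ]
    {m₁ m₂ m₃ : MeasurableSpace Ω} (h₁ : m₁ ≤ mΩ) (h₂ : m₂ ≤ mΩ) (h₃ : m₃ ≤ mΩ)
    (h₁₂₃ : Indep m₁ (m₂ ⊔ m₃) μ) (h₂₃ : Indep m₂ m₃ μ) : Indep (m₁ ⊔ m₂) m₃ μ := by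
  refine IndepSets.indep (sup_le h₁ h₂) h₃
    (p1 := {s | ∃ a b, MeasurableSet[m₁] a ∧ MeasurableSet[m₂] b ∧ a ∩ b = s})
    (p2 := {s | MeasurableSet[m₃] s}) ?_ MeasurableSpace.isPiSystem_measurableSet ?_
    MeasurableSpace.generateFrom_measurableSet.symm ?_
  · rintro _ ⟨a, b, ha, hb, rfl⟩ _ ⟨a', b', ha', hb', rfl⟩ -
    exact ⟨a ∩ a', b ∩ b', ha.inter ha', hb.inter hb', Set.inter_inter_inter_comm ..⟩
  · refine le_antisymm (sup_le (fun a ha => ?_) fun b hb => ?_)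
      (MeasurableSpace.generateFrom_le ?_)
    · exact MeasurableSpace.measurableSet_generateFrom ⟨a, Set.univ, ha, .univ, Set.inter_univ a⟩
    · exact MeasurableSpace.measurableSet_generateFrom ⟨Set.univ, b, .univ, hb, Set.univ_inter b⟩
    · rintro _ ⟨a, b, ha, hb, rfl⟩
      exact MeasurableSet.inter (le_sup_left (a := m₁) (b := m₂) a ha)
        (le_sup_right (a := m₁) (b := m₂) b hb)
  · rw [IndepSets_iff]
    rintro _ c ⟨a, b, ha, hb, rfl⟩ hc
    have hbc : MeasurableSet[m₂ ⊔ m₃] (b ∩ c) :=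
      MeasurableSet.inter (le_sup_left (a := m₂) (b := m₃) b hb)
        (le_sup_right (a := m₂) (b := m₃) c hc)
    have hb' : MeasurableSet[m₂ ⊔ m₃] b := le_sup_left (a := m₂) (b := m₃) b hb
    rw [Indep_iff] at h₁₂₃ h₂₃
    rw [Set.inter_assoc, h₁₂₃ _ _ ha hbc, h₂₃ _ _ hb hc, h₁₂₃ _ _ ha hb', mul_assoc]

theorem comap_sup_comap_le {w : Ω → α} {f : α → β} {g : α → γ} (hf : Measurable f)
    (hg : Measurable g) :
    MeasurableSpace.comap (fun ω => f (w ω)) inferInstance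
      ⊔ MeasurableSpace.comap (fun ω => g (w ω)) inferInstance
      ≤ MeasurableSpace.comap w inferInstance :=
  sup_le (measurable_iff_comap_le.1 (hf.comp (comap_measurable w)))
    (measurable_iff_comap_le.1 (hg.comp (comap_measurable w)))

variable [MeasurableSpace Ω] {μ : Measure Ω}

theorem indepFun_fst_snd_of_measurePreserving_prod [IsFiniteMeasure μ] {V : Ω → β × γ}
    {ρ : Measure β} {ν : Measure γ} [IsProbabilityMeasure ρ] [IsProbabilityMeasure ν]
    (hV : MeasurePreserving V μ (ρ.prod ν)) :
    IndepFun (fun ω => (V ω).1) (fun ω => (V ω).2) μ := by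
  have hfst : MeasurePreserving (fun ω => (V ω).1) μ ρ := measurePreserving_fst.comp hV
  have hsnd : MeasurePreserving (fun ω => (V ω).2) μ ν := measurePreserving_snd.comp hV
  rw [indepFun_iff_map_prod_eq_prod_map_map hfst.aemeasurable hsnd.aemeasurable, hfst.map_eq,
    hsnd.map_eq]
  exact hV.map_eq

variable [IsFiniteMeasure μ] {U : Ω → α} {V : Ω → β} {P : Measure β}

theorem measurePreserving_prodMk_of_indepFun (hUV : IndepFun U V μ) (hU : Measurable U)
    (hV : MeasurePreserving V μ P) :
    MeasurePreserving (fun ω => (U ω, V ω)) μ ((μ.map U).prod P) where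
  measurable := hU.prodMk hV.measurable
  map_eq := by
    rw [(indepFun_iff_map_prod_eq_prod_map_map hU.aemeasurable hV.aemeasurable).1 hUV, hV.map_eq]

variable [SFinite P]

theorem lintegral_indep (hUV : IndepFun U V μ) (hU : Measurable U) (hV : MeasurePreserving V μ P)
    {h : α × β → ℝ≥0∞} (hh : Measurable h) :
    ∫⁻ ω, h (U ω, V ω) ∂μ = ∫⁻ ω, ∫⁻ v, h (U ω, v) ∂P ∂μ := by
  rw [(measurePreserving_prodMk_of_indepFun hUV hU hV).lintegral_comp hh,
    lintegral_prod _ hh.aemeasurable, lintegral_map hh.lintegral_prod_right' hU]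

theorem integral_indep {E : Type*} [NormedAddCommGroup E] [NormedSpace ℝ E]
    (hUV : IndepFun U V μ) (hU : Measurable U) (hV : MeasurePreserving V μ P)
    {h : α × β → E} (hh : StronglyMeasurable h) (hInt : Integrable (fun ω => h (U ω, V ω)) μ) :
    ∫ ω, h (U ω, V ω) ∂μ = ∫ ω, ∫ v, h (U ω, v) ∂P ∂μ := by
  have hpair := measurePreserving_prodMk_of_indepFun hUV hU hV
  have hInt' : Integrable h ((μ.map U).prod P) :=
    (hpair.integrable_comp hh.aestronglyMeasurable).1 hInt
  rw [← integral_map hU.aemeasurable hh.integral_prod_right'.aestronglyMeasurable,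
    ← integral_prod _ hInt', ← hpair.map_eq,
    integral_map hpair.aemeasurable hh.aestronglyMeasurable]

variable {F : Type*} [NormedAddCommGroup F]

theorem memLp_two_of_indep [IsProbabilityMeasure μ] (hUV : IndepFun U V μ) (hU : Measurable U)
    (hV : MeasurePreserving V μ P) {ξ : α × β → F} (hξ : StronglyMeasurable ξ) {c : ℝ}
    (hc : 0 ≤ c) (hmem : ∀ ω, MemLp (fun v => ξ (U ω, v)) 2 P)
    (hle : ∀ᵐ ω ∂μ, ∫ v, ‖ξ (U ω, v)‖ ^ 2 ∂P ≤ c) :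
    MemLp (fun ω => ξ (U ω, V ω)) 2 μ ∧ ∫ ω, ‖ξ (U ω, V ω)‖ ^ 2 ∂μ ≤ c := by
  have hmeas : AEStronglyMeasurable (fun ω => ξ (U ω, V ω)) μ :=
    (hξ.comp_measurable (hU.prodMk hV.measurable)).aestronglyMeasurable
  have hlintegral : ∫⁻ ω, ENNReal.ofReal (‖ξ (U ω, V ω)‖ ^ 2) ∂μ ≤ ENNReal.ofReal c := by
    rw [lintegral_indep (h := fun w => ENNReal.ofReal (‖ξ w‖ ^ 2)) hUV hU hV
      (hξ.norm.measurable.pow_const 2).ennreal_ofReal]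
    calc _ ≤ ∫⁻ _ω, ENNReal.ofReal c ∂μ := by
          refine lintegral_mono_ae (hle.mono fun ω hω => ?_)
          rw [← ofReal_integral_eq_lintegral_ofReal ((hmem ω).integrable_norm_pow two_ne_zero)
            (ae_of_all _ fun v => by positivity)]
          exact ENNReal.ofReal_le_ofReal hω
      _ = ENNReal.ofReal c := by simp
  exact ⟨memLp_two_of_lintegral_sq_lt_top hmeas (hlintegral.trans_lt ENNReal.ofReal_lt_top),
    integral_sq_le_of_lintegral_sq_le hmeas hc hlintegral⟩

variable [InnerProductSpace ℝ F]

omit [IsFiniteMeasure μ] in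
theorem integrable_inner_of_memLp_two {f g : Ω → F} (hf : MemLp f 2 μ) (hg : MemLp g 2 μ) :
    Integrable (fun ω => ⟪f ω, g ω⟫) μ :=
  (hf.norm.integrable_mul hg.norm).mono' (hf.1.inner hg.1)
    (ae_of_all _ fun _ => norm_inner_le_norm _ _)

theorem integral_inner_eq_zero_of_indep [CompleteSpace F] (hUV : IndepFun U V μ)
    (hU : Measurable U) (hV : MeasurePreserving V μ P) {ξ : α × β → F}
    (hξ : StronglyMeasurable ξ) {u : α → F} (hu : StronglyMeasurable u)
    (hmem : MemLp (fun ω => ξ (U ω, V ω)) 2 μ) (humem : MemLp (fun ω => u (U ω)) 2 μ)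
    (hInt : ∀ ω, Integrable (fun v => ξ (U ω, v)) P) (hzero : ∀ ω, ∫ v, ξ (U ω, v) ∂P = 0) :
    ∫ ω, ⟪ξ (U ω, V ω), u (U ω)⟫ ∂μ = 0 := by
  rw [integral_indep (h := fun w => ⟪ξ w, u w.1⟫) hUV hU hV
    (hξ.inner (hu.comp_measurable measurable_fst)) (integrable_inner_of_memLp_two hmem humem)]
  refine integral_eq_zero_of_ae (ae_of_all _ fun ω => ?_)
  have hinner : ∫ v, ⟪ξ (U ω, v), u (U ω)⟫ ∂P = ⟪∫ v, ξ (U ω, v) ∂P, u (U ω)⟫ := by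
    simp only [real_inner_comm (u (U ω))]
    exact integral_inner (hInt ω) (u (U ω))
  simp only [hinner, hzero, inner_zero_left, Pi.zero_apply]

end Independence

section ProductMeasure

variable {ι : Type*} [Fintype ι] {A : ι → Type*} [∀ i, MeasurableSpace (A i)]
  {P : ∀ i, Measure (A i)} [∀ i, IsProbabilityMeasure (P i)]
  {F : Type*} [NormedAddCommGroup F]

theorem memLp_two_pi_eval (i : ι) {φ : A i → F} (hφ : MemLp φ 2 (P i)) :
    MemLp (fun b : ∀ i, A i => φ (b i)) 2 (Measure.pi P) :=
  hφ.comp_measurePreserving (measurePreserving_eval P i)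

theorem integral_norm_sum_sq_pi [InnerProductSpace ℝ F] [CompleteSpace F] [MeasurableSpace F]
    [BorelSpace F] {φ : ∀ i, A i → F} (hφ : ∀ i, MemLp (φ i) 2 (P i))
    (hzero : ∀ i, ∫ a, φ i a ∂(P i) = 0) (s : Finset ι) :
    ∫ b, ‖∑ i ∈ s, φ i (b i)‖ ^ 2 ∂(Measure.pi P) = ∑ i ∈ s, ∫ a, ‖φ i a‖ ^ 2 ∂(P i) := by
  classical
  have hInt (i j : ι) : Integrable (fun b : ∀ i, A i => ⟪φ i (b i), φ j (b j)⟫) (Measure.pi P) :=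
    integrable_inner_of_memLp_two (memLp_two_pi_eval i (hφ i)) (memLp_two_pi_eval j (hφ j))
  have hcross (i j : ι) (hij : i ≠ j) : ∫ b, ⟪φ i (b i), φ j (b j)⟫ ∂(Measure.pi P) = 0 := by
    have hind := (iIndepFun_pi (μ := P) (X := φ)
      (fun i => (hφ i).1.aemeasurable)).indepFun hij
    have hfactor : ∫ b, ⟪φ i (b i), φ j (b j)⟫ ∂(Measure.pi P)
        = ⟪∫ b, φ i (b i) ∂(Measure.pi P), ∫ b, φ j (b j) ∂(Measure.pi P)⟫ :=
      hind.integral_bilin ((memLp_two_pi_eval i (hφ i)).integrable one_le_two)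
        ((memLp_two_pi_eval j (hφ j)).integrable one_le_two) (innerSL ℝ)
    rw [hfactor, integral_comp_eval (f := φ i) (hφ i).1, hzero, inner_zero_left]
  simp only [← real_inner_self_eq_norm_sq, sum_inner, inner_sum]
  rw [integral_finsetSum _ fun i _ => integrable_finsetSum _ fun j _ => hInt _ _]
  refine Finset.sum_congr rfl fun i hi => ?_
  rw [integral_finsetSum _ fun j _ => hInt _ _, Finset.sum_eq_single i]
  · exact integral_comp_eval (f := fun a => ⟪φ i a, φ i a⟫) ((hφ i).1.inner (hφ i).1)
  · exact fun j _ hj => hcross j i hj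
  · exact fun hi' => absurd hi hi'

end ProductMeasure

section BatchMean

variable {A F : Type*} [MeasurableSpace A] {P : Measure A} [IsProbabilityMeasure P]
  [NormedAddCommGroup F] {B : ℕ}

theorem memLp_batchMean [NormedSpace ℝ F] {φ : A → F} (hφ : MemLp φ 2 P) :
    MemLp (fun b : Fin B → A => (1 / (B : ℝ)) • ∑ j, φ (b j)) 2 (Measure.pi fun _ => P) := by
  have hsum : MemLp (fun b : Fin B → A => ∑ j, φ (b j)) 2 (Measure.pi fun _ => P) :=
    memLp_finsetSum _ fun j _ => memLp_two_pi_eval (P := fun _ : Fin B => P) j hφ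
  exact hsum.const_smul (1 / (B : ℝ))

theorem integral_batchMean [NormedSpace ℝ F] {φ : A → F} (hφ : MemLp φ 2 P)
    (hzero : ∫ a, φ a ∂P = 0) :
    ∫ b : Fin B → A, (1 / (B : ℝ)) • ∑ j, φ (b j) ∂(Measure.pi fun _ => P) = 0 := by
  rw [integral_smul, integral_finsetSum _ fun j _ =>
    (memLp_two_pi_eval (P := fun _ : Fin B => P) j hφ).integrable one_le_two,
    Finset.sum_eq_zero, smul_zero]
  intro j _
  rw [integral_comp_eval (μ := fun _ : Fin B => P) hφ.1, hzero]

theorem integral_batchMean_norm_sq_le [InnerProductSpace ℝ F] [CompleteSpace F]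
    [MeasurableSpace F] [BorelSpace F] {φ : A → F} (hφ : MemLp φ 2 P)
    (hzero : ∫ a, φ a ∂P = 0) {c : ℝ} (hc : ∫ a, ‖φ a‖ ^ 2 ∂P ≤ c) :
    ∫ b : Fin B → A, ‖(1 / (B : ℝ)) • ∑ j, φ (b j)‖ ^ 2 ∂(Measure.pi fun _ => P) ≤ c / B := by
  simp only [norm_smul, mul_pow, norm_div, norm_one, RCLike.norm_natCast]
  rw [integral_const_mul, integral_norm_sum_sq_pi (P := fun _ : Fin B => P) (fun _ => hφ)
    (fun _ => hzero), Finset.sum_const, Finset.card_univ, Fintype.card_fin, nsmul_eq_mul]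
  calc (1 / (B : ℝ)) ^ 2 * (B * ∫ a, ‖φ a‖ ^ 2 ∂P) = (∫ a, ‖φ a‖ ^ 2 ∂P) / B := by
        field_simp
    _ ≤ c / B := by gcongr

end BatchMean

/-! ### Sampling without replacement -/

/-- The law of the sampled block set: uniform on the subsets of cardinality `S`. -/
def blockLaw (n S : ℕ) : Measure (Finset (Fin n)) :=
  uniformOn ((Finset.univ.powersetCard S : Finset (Finset (Fin n))) : Set (Finset (Fin n)))

section Sampling

variable {n S : ℕ}

theorem isProbabilityMeasure_blockLaw (hSn : S ≤ n) : IsProbabilityMeasure (blockLaw n S) := by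
  refine isProbabilityMeasure_uniformOn (Finset.finite_toSet _) ?_
  rw [Finset.coe_nonempty, Finset.powersetCard_nonempty]
  simpa using hSn

theorem integral_blockLaw {E : Type*} [NormedAddCommGroup E] [NormedSpace ℝ E]
    [CompleteSpace E] (f : Finset (Fin n) → E) :
    ∫ s, f s ∂(blockLaw n S)
      = (n.choose S : ℝ)⁻¹ • ∑ s ∈ Finset.univ.powersetCard S, f s := by
  rw [blockLaw, uniformOn, ProbabilityTheory.cond, integral_smul_measure,
    Measure.count_apply_finset, Finset.card_powersetCard, Finset.card_univ, Fintype.card_fin,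
    setIntegral_finset _ Integrable.of_finite]
  simp [Measure.real, ENNReal.toReal_inv]

theorem card_filter_mem_powersetCard (hS : 0 < S) (i : Fin n) :
    (((Finset.univ.powersetCard S).filter (i ∈ ·) : Finset (Finset (Fin n))).card : ℝ)
      = S / n * n.choose S := by
  have hcard := Finset.card_filter_powersetCard_subset {i} (Finset.univ : Finset (Fin n)) S
    (Finset.subset_univ _) (by simpa [Nat.one_le_iff_ne_zero] using hS.ne')
  simp only [Finset.singleton_subset_iff, Finset.card_univ, Fintype.card_fin,
    Finset.card_singleton] at hcard
  rw [hcard]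
  have hn : 0 < n := i.pos
  obtain ⟨k, rfl⟩ := Nat.exists_eq_add_of_lt hn
  obtain ⟨l, rfl⟩ := Nat.exists_eq_add_of_lt hS
  simp only [zero_add, Nat.add_sub_cancel]
  have hchoose : ((k + 1 : ℕ) : ℝ) * (k.choose l)
      = ((k + 1).choose (l + 1)) * ((l + 1 : ℕ) : ℝ) := by
    exact_mod_cast Nat.add_one_mul_choose_eq k l
  rw [div_mul_eq_mul_div, eq_div_iff (by positivity)]
  linarith

theorem exists_card_filter_pair_powersetCard (n S : ℕ) :
    ∃ c : ℝ, 0 ≤ c ∧ ∀ i j : Fin n, i ≠ j →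
      (((Finset.univ.powersetCard S).filter fun s => i ∈ s ∧ j ∈ s :
        Finset (Finset (Fin n))).card : ℝ) = c := by
  by_cases hS : 2 ≤ S
  · refine ⟨((n - 2).choose (S - 2) : ℕ), by positivity, fun i j hij => ?_⟩
    have hcard := Finset.card_filter_powersetCard_subset {i, j} (Finset.univ : Finset (Fin n)) S
      (Finset.subset_univ _) (by rwa [Finset.card_pair hij])
    simp only [Finset.insert_subset_iff, Finset.singleton_subset_iff, Finset.card_univ,
      Fintype.card_fin, Finset.card_pair hij] at hcard
    exact_mod_cast hcard
  · refine ⟨0, le_rfl, fun i j hij => ?_⟩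
    rw [Nat.cast_eq_zero, Finset.card_eq_zero, Finset.filter_eq_empty_iff]
    rintro s hs ⟨hi, hj⟩
    have hpair : ({i, j} : Finset (Fin n)).card ≤ s.card :=
      Finset.card_le_card (by simp [Finset.insert_subset_iff, hi, hj])
    rw [Finset.card_pair hij, (Finset.mem_powersetCard.1 hs).2] at hpair
    exact hS hpair

theorem integral_samplingDev (hS : 0 < S) (hSn : S ≤ n) (i : Fin n) :
    ∫ s, samplingDev S s i ∂(blockLaw n S) = 0 := by
  have : 0 < n := hS.trans_le hSn
  simp only [integral_blockLaw, samplingDev]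
  rw [Finset.sum_sub_distrib, ← Finset.sum_filter, Finset.sum_const, Finset.sum_const,
    nsmul_eq_mul, nsmul_eq_mul, card_filter_mem_powersetCard hS, Finset.card_powersetCard,
    Finset.card_univ, Fintype.card_fin]
  field_simp
  simp

theorem integral_samplingDev_sq_le (hS : 0 < S) (hSn : S ≤ n) (i : Fin n) :
    ∫ s, samplingDev S s i ^ 2 ∂(blockLaw n S) ≤ 1 / n * (1 / S) := by
  have hch : (0 : ℝ) < n.choose S := Nat.cast_pos.2 (Nat.choose_pos hSn)
  have hexpand (s : Finset (Fin n)) : samplingDev S s i ^ 2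
      = 2 / n * samplingDev S s i - 1 / n ^ 2 + if i ∈ s then 1 / (S : ℝ) ^ 2 else 0 := by
    by_cases hi : i ∈ s <;> simp only [samplingDev, hi, if_true, if_false] <;> ring
  have hmean : ∑ s ∈ Finset.univ.powersetCard S, samplingDev S s i = 0 := by
    simpa [integral_blockLaw, hch.ne'] using integral_samplingDev hS hSn i
  rw [integral_blockLaw, smul_eq_mul, inv_mul_le_iff₀ hch]
  simp only [hexpand]
  rw [Finset.sum_add_distrib, Finset.sum_sub_distrib, ← Finset.mul_sum, hmean,
    ← Finset.sum_filter, Finset.sum_const, Finset.sum_const, nsmul_eq_mul, nsmul_eq_mul,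
    card_filter_mem_powersetCard hS, Finset.card_powersetCard, Finset.card_univ, Fintype.card_fin]
  have hnonneg : (0 : ℝ) ≤ n.choose S * (1 / n ^ 2) := by positivity
  have hscale : (S : ℝ) / n * n.choose S * (1 / (S : ℝ) ^ 2)
      = n.choose S * (1 / n * (1 / S)) := by
    field_simp
  linarith

variable {F : Type*} [NormedAddCommGroup F] [InnerProductSpace ℝ F]

theorem norm_sum_mem_sq (s : Finset (Fin n)) (b : Fin n → F) :
    ‖∑ i ∈ s, b i‖ ^ 2 = ∑ i, ∑ j, if i ∈ s ∧ j ∈ s then ⟪b i, b j⟫ else 0 := by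
  rw [← real_inner_self_eq_norm_sq, sum_inner, ← Finset.univ_inter s, ← Finset.sum_ite_mem]
  refine Finset.sum_congr rfl fun i _ => ?_
  by_cases hi : i ∈ s <;> simp [hi, inner_sum]

/- Negative correlation: all off-diagonal pairs carry the same weight `c ≥ 0`, so summing to zero
leaves the diagonal weight minus `c`. -/
theorem sum_powersetCard_norm_sq_le (hS : 0 < S) {b : Fin n → F} (hb : ∑ i, b i = 0) :
    ∑ s ∈ Finset.univ.powersetCard S, ‖∑ i ∈ s, b i‖ ^ 2
      ≤ S / n * n.choose S * ∑ i, ‖b i‖ ^ 2 := by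
  obtain ⟨c, hc, hpair⟩ := exists_card_filter_pair_powersetCard n S
  have hrow (i : Fin n) : ∑ s ∈ Finset.univ.powersetCard S,
      ∑ j, (if i ∈ s ∧ j ∈ s then ⟪b i, b j⟫ else 0)
      = (S / n * n.choose S - c) * ‖b i‖ ^ 2 + c * ⟪b i, ∑ j, b j⟫ := by
    rw [Finset.sum_comm, inner_sum, Finset.mul_sum,
      ← Finset.add_sum_erase _ _ (Finset.mem_univ i),
      ← Finset.add_sum_erase (a := i) Finset.univ (fun j => c * ⟪b i, b j⟫) (Finset.mem_univ i),
      ← add_assoc]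
    congr 1
    · simp only [and_self]
      rw [← Finset.sum_filter, Finset.sum_const, nsmul_eq_mul,
        card_filter_mem_powersetCard hS, real_inner_self_eq_norm_sq]
      ring
    · refine Finset.sum_congr rfl fun j hj => ?_
      rw [← Finset.sum_filter, Finset.sum_const, nsmul_eq_mul,
        hpair i j (Finset.ne_of_mem_erase hj).symm]
  simp only [norm_sum_mem_sq]
  rw [Finset.sum_comm]
  simp only [hrow, hb, inner_zero_right, mul_zero, add_zero, ← Finset.mul_sum]
  exact mul_le_mul_of_nonneg_right (sub_le_self _ hc) (Finset.sum_nonneg fun _ _ => by positivity)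

theorem sum_samplingDev_smul_eq (hS : 0 < S) {s : Finset (Fin n)} (hs : s.card = S)
    (a : Fin n → F) :
    ∑ i, samplingDev S s i • a i
      = -((1 / (S : ℝ)) • ∑ i ∈ s, (a i - (1 / (n : ℝ)) • ∑ j, a j)) := by
  have hSpos : (0 : ℝ) < S := Nat.cast_pos.2 hS
  simp only [samplingDev, sub_smul, ite_smul, zero_smul]
  rw [Finset.sum_sub_distrib, Finset.sum_sub_distrib, Finset.sum_const, hs, ← Finset.smul_sum,
    Finset.sum_ite_mem, Finset.univ_inter, ← Finset.smul_sum, ← Nat.cast_smul_eq_nsmul ℝ S,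
    smul_sub, smul_smul (1 / (S : ℝ)), one_div_mul_cancel hSpos.ne', one_smul]
  abel

theorem integral_sum_samplingDev_smul [CompleteSpace F] (hS : 0 < S) (hSn : S ≤ n) (a : Fin n → F) :
    ∫ s, ∑ i, samplingDev S s i • a i ∂(blockLaw n S) = 0 := by
  have := isProbabilityMeasure_blockLaw hSn
  rw [integral_finsetSum _ fun i _ => Integrable.of_finite]
  exact Finset.sum_eq_zero fun i _ => by
    rw [integral_smul_const, integral_samplingDev hS hSn, zero_smul]

theorem integral_norm_sum_samplingDev_smul_sq_le (hS : 0 < S) (hSn : S ≤ n) (a : Fin n → F) :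
    ∫ s, ‖∑ i, samplingDev S s i • a i‖ ^ 2 ∂(blockLaw n S)
      ≤ 1 / S * (1 / n * ∑ i, ‖a i - (1 / (n : ℝ)) • ∑ j, a j‖ ^ 2) := by
  have hn : (0 : ℝ) < n := Nat.cast_pos.2 (hS.trans_le hSn)
  have hch : (0 : ℝ) < n.choose S := Nat.cast_pos.2 (Nat.choose_pos hSn)
  have hcentred : ∑ i, (a i - (1 / (n : ℝ)) • ∑ j, a j) = 0 := by
    rw [Finset.sum_sub_distrib, Finset.sum_const, Finset.card_univ, Fintype.card_fin,
      ← Nat.cast_smul_eq_nsmul ℝ n, smul_smul, mul_one_div_cancel hn.ne', one_smul, sub_self]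
  have hnorm : ∀ s ∈ (Finset.univ : Finset (Fin n)).powersetCard S,
      ‖∑ i, samplingDev S s i • a i‖ ^ 2
        = 1 / (S : ℝ) ^ 2 * ‖∑ i ∈ s, (a i - (1 / (n : ℝ)) • ∑ j, a j)‖ ^ 2 := by
    intro s hs
    rw [sum_samplingDev_smul_eq hS (Finset.mem_powersetCard.1 hs).2, norm_neg, norm_smul,
      mul_pow, Real.norm_of_nonneg (by positivity), one_div_pow]
  rw [integral_blockLaw, smul_eq_mul, inv_mul_le_iff₀ hch, Finset.sum_congr rfl hnorm,
    ← Finset.mul_sum]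
  calc _ ≤ 1 / (S : ℝ) ^ 2 * (S / n * n.choose S
        * ∑ i, ‖a i - (1 / (n : ℝ)) • ∑ j, a j‖ ^ 2) := by
        gcongr
        exact sum_powersetCard_norm_sq_le hS hcentred
    _ = _ := by field_simp

end Sampling

/-! ### The past of a sequence of random variables -/

section Past

variable {Ω β : Type*} [mΩ : MeasurableSpace Ω] [MeasurableSpace β] {μ : Measure Ω}

/-- The σ-algebra generated by the variables before time `t`. -/
@[reducible]
def past (W : ℕ → Ω → β) (t : ℕ) : MeasurableSpace Ω :=
  ⨆ k ∈ Set.Iio t, MeasurableSpace.comap (W k) inferInstance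

theorem past_le {W : ℕ → Ω → β} (hW : ∀ t, Measurable (W t)) (t : ℕ) : past W t ≤ mΩ :=
  iSup₂_le fun k _ => (hW k).comap_le

omit mΩ in
theorem past_mono (W : ℕ → Ω → β) {s t : ℕ} (hst : s ≤ t) : past W s ≤ past W t :=
  biSup_mono fun _ hk => lt_of_lt_of_le hk hst

omit mΩ in
theorem measurable_past (W : ℕ → Ω → β) {s t : ℕ} (hst : s < t) : Measurable[past W t] (W s) := by
  rw [measurable_iff_comap_le]
  exact le_biSup (fun k => MeasurableSpace.comap (W k) inferInstance) (Set.mem_Iio.2 hst)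

theorem indep_past {W : ℕ → Ω → β} (hW : ∀ t, Measurable (W t)) (hind : iIndepFun W μ) (t : ℕ) :
    Indep (past W t) (MeasurableSpace.comap (W t) inferInstance) μ := by
  simpa only [Set.mem_singleton_iff, iSup_iSup_eq_left] using
    indep_iSup_of_disjoint (fun k => (hW k).comap_le) hind.iIndep
      (S := Set.Iio t) (T := {t}) (by simp)

theorem indepFun_of_measurable_past {α : Type*} [MeasurableSpace α] {W : ℕ → Ω → β}
    (hW : ∀ t, Measurable (W t)) (hind : iIndepFun W μ) {t : ℕ} {U : Ω → α}
    (hU : Measurable[past W t] U) : IndepFun U (W t) μ := by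
  rw [IndepFun_iff_Indep]
  exact indep_of_indep_of_le_left (indep_past hW hind t) hU.comap_le

end Past

/-! ### Measurability of the iterates -/

section Measurability

theorem exists_measurable_eq_of_isProxPoint {E : Type*} [NormedAddCommGroup E]
    [InnerProductSpace ℝ E] [FiniteDimensional ℝ E] [MeasurableSpace E] [BorelSpace E] {A : Set E}
    {h : E → ℝ} (hh : ConvexOn ℝ A h) {τ : ℝ} (hτ : 0 < τ) :
    ∃ Φ : E → E, Measurable Φ ∧
      ∀ c y₀ z, IsProxPoint A h τ c y₀ z → z = Φ (y₀ - τ⁻¹ • c) := by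
  set R : E → E → Prop := fun w z => ∃ c y₀, IsProxPoint A h τ c y₀ z ∧ y₀ - τ⁻¹ • c = w
  have hR {w w' z z' : E} : R w z → R w' z' → ‖z - z'‖ ≤ ‖w - w'‖ := by
    rintro ⟨c, y₀, hz, rfl⟩ ⟨c', y₀', hz', rfl⟩
    exact hz.norm_sub_le hh hτ hz'
  have hspec (w : E) (hw : ∃ z, R w z) : R w (Classical.epsilon (R w)) := Classical.epsilon_spec hw
  have hlip : LipschitzOnWith 1 (fun w => Classical.epsilon (R w)) {w | ∃ z, R w z} :=
    LipschitzOnWith.of_dist_le_mul fun w hw w' hw' => by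
      simpa [dist_eq_norm] using hR (hspec w hw) (hspec w' hw')
  obtain ⟨Φ, hΦ, heq⟩ := hlip.extend_finite_dimension
  refine ⟨Φ, hΦ.continuous.measurable, fun c y₀ z hz => ?_⟩
  have hmem : R (y₀ - τ⁻¹ • c) z := ⟨c, y₀, hz, rfl⟩
  rw [← heq ⟨z, hmem⟩]
  simpa [sub_eq_zero] using hR hmem (hspec _ ⟨z, hmem⟩)

variable {n d m : ℕ} {Z : Type*} [MeasurableSpace Z] {p : Problem n d m Z}
  {K G Λ s₀ s₁ δ τ : ℝ} {B : ℕ}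
  {Ω : Type*} {mΩ : MeasurableSpace Ω} {X X' : Ω → Vec d} {Y : Ω → Fin n → Vec m}
  {s : Ω → Finset (Fin n)}

theorem measurable_adjoint_apply {A : Ω → Vec d →L[ℝ] Vec m} {v : Ω → Vec m} (hA : Measurable A)
    (hv : Measurable v) : Measurable fun ω => (A ω).adjoint (v ω) := by
  have hadj : Continuous fun A : Vec d →L[ℝ] Vec m => A.adjoint :=
    LinearIsometryEquiv.continuous _
  have hpair : Measurable fun w : (Vec d →L[ℝ] Vec m) × Vec m => w.1.adjoint w.2 :=
    ((hadj.comp continuous_fst).clm_apply continuous_snd).measurable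
  have hcomp := hpair.comp (hA.prodMk hv)
  exact hcomp

theorem measurableSet_mem_finset (hs : Measurable s) (i : Fin n) : MeasurableSet {ω | i ∈ s ω} :=
  hs (MeasurableSet.of_discrete (s := {s : Finset (Fin n) | i ∈ s}))

theorem measurable_sum_mem {E : Type*} [NormedAddCommGroup E] [MeasurableSpace E] [BorelSpace E]
    [SecondCountableTopology E] (hs : Measurable s) {a : Fin n → Ω → E}
    (ha : ∀ i, Measurable (a i)) : Measurable fun ω => ∑ i ∈ s ω, a i ω := by
  have hsum : (fun ω => ∑ i ∈ s ω, a i ω) = fun ω => ∑ i, if i ∈ s ω then a i ω else 0 := by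
    funext ω
    rw [Finset.sum_ite_mem, Finset.univ_inter]
  rw [hsum]
  exact Finset.measurable_fun_sum _ fun i _ =>
    Measurable.ite (measurableSet_mem_finset hs i) (ha i) measurable_const

theorem measurable_samplingDev (S : ℕ) (hs : Measurable s) (i : Fin n) :
    Measurable fun ω => samplingDev S (s ω) i :=
  (Measurable.of_discrete (f := fun s : Finset (Fin n) => samplingDev S s i)).comp hs

/-- The mean of the first-order oracle. Unlike `p.dg`, which it equals on the feasible set, it
depends measurably on the point. -/
def Problem.meanDeriv (p : Problem n d m Z) (i : Fin n) (x : Vec d) : Vec d →L[ℝ] Vec m :=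
  ∫ ζ, p.dgs i x ζ ∂(p.P i)

/-- The full dual step: the update of every block, sampled or not. -/
def Problem.fullDual (p : Problem n d m Z) (τ : ℝ) (x x' : Vec d) (y : Fin n → Vec m)
    (b : Fin n → Fin B → Z) (i : Fin n) : Vec m :=
  Classical.epsilon fun z => IsDualStep (p.f i) τ (y i) (p.gExtra 1 i x x' (b i)) z

namespace Problem.EuclideanAssumptions

variable (h : p.EuclideanAssumptions K G Λ s₀ s₁ δ)
include h

theorem measurable_g (i : Fin n) : Measurable (p.g i) := by
  have := h.prob i
  exact (h.gs_meas i).stronglyMeasurable.integral_prod_right'.measurable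

theorem measurable_meanDeriv (i : Fin n) : Measurable (p.meanDeriv i) := by
  have := h.prob i
  exact (h.dgs_meas i).stronglyMeasurable.integral_prod_right'.measurable

theorem measurable_meanDeriv_adjoint (i : Fin n) (hX : Measurable X) (hY : Measurable Y) :
    Measurable fun ω => (p.meanDeriv i (X ω)).adjoint (Y ω i) :=
  measurable_adjoint_apply ((h.measurable_meanDeriv i).comp hX) ((measurable_pi_apply i).comp hY)

theorem measurable_gBatch (i : Fin n) {b : Ω → Fin B → Z} (hX : Measurable X) (hb : Measurable b) :
    Measurable fun ω => p.gBatch i (X ω) (b ω) := by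
  have hsum : Measurable fun ω => ∑ j, p.gs i (X ω) (b ω j) :=
    Finset.measurable_fun_sum _ fun j _ =>
      (h.gs_meas i).comp (hX.prodMk ((measurable_pi_apply j).comp hb))
  exact hsum.const_smul (1 / (B : ℝ))

theorem measurable_dgBatch (i : Fin n) {b : Ω → Fin B → Z} (hX : Measurable X)
    (hb : Measurable b) : Measurable fun ω => p.dgBatch i (X ω) (b ω) := by
  have hsum : Measurable fun ω => ∑ j, p.dgs i (X ω) (b ω j) :=
    Finset.measurable_fun_sum _ fun j _ =>
      (h.dgs_meas i).comp (hX.prodMk ((measurable_pi_apply j).comp hb))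
  exact hsum.const_smul (1 / (B : ℝ))

theorem measurable_gExtra (i : Fin n) {b : Ω → Fin B → Z} (hX : Measurable X)
    (hX' : Measurable X') (hb : Measurable b) :
    Measurable fun ω => p.gExtra 1 i (X ω) (X' ω) (b ω) :=
  (h.measurable_gBatch i hX hb).add
    (((h.measurable_gBatch i hX hb).sub (h.measurable_gBatch i hX' hb)).const_smul (1 : ℝ))

theorem measurable_innerError (i : Fin n) {b : Ω → Fin B → Z} (hX : Measurable X)
    (hX' : Measurable X') (hb : Measurable b) : Measurable fun ω =>
      p.innerError i (X ω) (X' ω) (p.gExtra 1 i (X ω) (X' ω) (b ω)) :=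
  ((((h.measurable_g i).comp hX).const_smul (2 : ℝ)).sub ((h.measurable_g i).comp hX')).sub
    (h.measurable_gExtra i hX hX' hb)

theorem measurable_gradEst (S : ℕ) {b : Ω → Fin n → Fin B → Z} (hs : Measurable s)
    (hX : Measurable X) (hY : Measurable Y) (hb : Measurable b) :
    Measurable fun ω => p.gradEst S (s ω) (X ω) (Y ω) (b ω) := by
  have hsum : Measurable fun ω => ∑ i ∈ s ω, (p.dgBatch i (X ω) (b ω i)).adjoint (Y ω i) :=
    measurable_sum_mem hs fun i => measurable_adjoint_apply
      (h.measurable_dgBatch i hX ((measurable_pi_apply i).comp hb))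
      ((measurable_pi_apply i).comp hY)
  exact hsum.const_smul (1 / (S : ℝ))

theorem isDualStep_fullDual {i : Fin n} (hne : (dualSet (p.f i)).Nonempty) (x x' : Vec d)
    (y : Fin n → Vec m) (b : Fin n → Fin B → Z) :
    IsDualStep (p.f i) τ (y i) (p.gExtra 1 i x x' (b i)) (p.fullDual τ x x' y b i) :=
  Classical.epsilon_spec (h.exists_isDualStep τ hne _ _)

theorem measurable_fullDual (hτ : 0 < τ) (hne : ∀ i, (dualSet (p.f i)).Nonempty)
    {b : Ω → Fin n → Fin B → Z} (hX : Measurable X) (hX' : Measurable X') (hY : Measurable Y)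
    (hb : Measurable b) : Measurable fun ω => p.fullDual τ (X ω) (X' ω) (Y ω) (b ω) := by
  refine measurable_pi_lambda _ fun i => ?_
  obtain ⟨Φ, hΦ, heq⟩ := exists_measurable_eq_of_isProxPoint (convexOn_toReal_conj (p.f i)) hτ
  rw [funext fun ω => heq _ _ _ (h.isDualStep_fullDual (hne i) (X ω) (X' ω) (Y ω) (b ω))]
  exact hΦ.comp (((measurable_pi_apply i).comp hY).sub
    ((h.measurable_gExtra i hX hX' ((measurable_pi_apply i).comp hb)).neg.const_smul τ⁻¹))

end Problem.EuclideanAssumptions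

end Measurability

/-! ### Runs as random trajectories -/

section Run

variable {n d m : ℕ} {Z : Type*} [MeasurableSpace Z] {p : Problem n d m Z}
  {K G Λ s₀ s₁ δ η τ : ℝ} {S B : ℕ} {x₀ : Vec d} {y₀ : Fin n → Vec m} {Ω : Type*}

/-- The full dual step at time `t` of a run. -/
def Problem.dualIter (p : Problem n d m Z) (τ : ℝ) (W : ℕ → Ω → Sample n B Z)
    (x : ℕ → Ω → Vec d) (y : ℕ → Ω → Fin n → Vec m) (t : ℕ) (ω : Ω) : Fin n → Vec m :=
  p.fullDual τ (x t ω) (x (t - 1) ω) (y t ω) (W t ω).2.1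

/-- The error of the extrapolated inner estimate of block `i` at time `t` of a run. -/
def Problem.innerErr (p : Problem n d m Z) (W : ℕ → Ω → Sample n B Z) (x : ℕ → Ω → Vec d)
    (i : Fin n) (t : ℕ) (ω : Ω) : Vec m :=
  p.innerError i (x t ω) (x (t - 1) ω) (p.gExtra 1 i (x t ω) (x (t - 1) ω) ((W t ω).2.1 i))

/-- The realization of a run at `ω`, completed by its full dual steps. -/
def Problem.trajectory (p : Problem n d m Z) (S : ℕ) (τ : ℝ) (W : ℕ → Ω → Sample n B Z)
    (x : ℕ → Ω → Vec d) (y : ℕ → Ω → Fin n → Vec m) (ω : Ω) : Trajectory n d m where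
  x t := x t ω
  y t := y t ω
  z t := p.dualIter τ W x y t ω
  s t := (W t ω).1
  u t i := p.gExtra 1 i (x t ω) (x (t - 1) ω) ((W t ω).2.1 i)
  c t := p.gradEst S (W t ω).1 (x t ω) (y (t + 1) ω) (W t ω).2.2

/-- The error of the gradient estimate at time `t` of a run. -/
def Problem.gradErr (p : Problem n d m Z) (S : ℕ) (τ : ℝ) (W : ℕ → Ω → Sample n B Z)
    (x : ℕ → Ω → Vec d) (y : ℕ → Ω → Fin n → Vec m) (t : ℕ) (ω : Ω) : Vec d :=
  p.gradError (p.trajectory S τ W x y ω) t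

variable {mΩ : MeasurableSpace Ω} {μ : Measure Ω} {W : ℕ → Ω → Sample n B Z}
  {x : ℕ → Ω → Vec d} {y : ℕ → Ω → Fin n → Vec m}

/-- A Euclidean run of the algorithm on a problem that satisfies the Euclidean form of the
assumptions, with positive parameters and a feasible start. -/
structure RegularRun (p : Problem n d m Z) (K G Λ s₀ s₁ δ : ℝ) (S B : ℕ) (η τ : ℝ) (x₀ : Vec d)
    (y₀ : Fin n → Vec m) (μ : Measure Ω) (W : ℕ → Ω → Sample n B Z) (x : ℕ → Ω → Vec d)
    (y : ℕ → Ω → Fin n → Vec m) : Prop where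
  assumptions : p.EuclideanAssumptions K G Λ s₀ s₁ δ
  run : IsRun p S B quad 1 η τ x₀ y₀ μ W x y
  S_pos : 0 < S
  S_le : S ≤ n
  B_pos : 0 < B
  η_pos : 0 < η
  τ_pos : 0 < τ
  x₀_mem : x₀ ∈ p.X
  y₀_mem : ∀ i, y₀ i ∈ dualSet (p.f i)

/-- The σ-algebra of everything that determines the full dual step at time `t`. -/
@[reducible]
def pastDual (W : ℕ → Ω → Sample n B Z) (t : ℕ) : MeasurableSpace Ω :=
  past W t ⊔ MeasurableSpace.comap (fun ω => (W t ω).2.1) inferInstance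

/-- The σ-algebra of everything that precedes the sampling of the gradient at time `t`. -/
@[reducible]
def pastGrad (W : ℕ → Ω → Sample n B Z) (t : ℕ) : MeasurableSpace Ω :=
  pastDual W t ⊔ MeasurableSpace.comap (fun ω => (W t ω).1) inferInstance

/-- The law of the batches of one kind in one iteration. -/
def Problem.batchLaw (p : Problem n d m Z) (B : ℕ) : Measure (Fin n → Fin B → Z) :=
  Measure.pi fun i => Measure.pi fun _ => p.P i

theorem Problem.EuclideanAssumptions.isProbabilityMeasure_batchLaw
    (h : p.EuclideanAssumptions K G Λ s₀ s₁ δ) (B : ℕ) : IsProbabilityMeasure (p.batchLaw B) := by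
  have := h.prob
  unfold Problem.batchLaw
  infer_instance

omit mΩ in
theorem measurable_batch_pastDual (W : ℕ → Ω → Sample n B Z) (t : ℕ) :
    Measurable[pastDual W t] fun ω => (W t ω).2.1 :=
  measurable_iff_comap_le.2 le_sup_right

omit mΩ in
theorem measurable_block_pastGrad (W : ℕ → Ω → Sample n B Z) (t : ℕ) :
    Measurable[pastGrad W t] fun ω => (W t ω).1 :=
  measurable_iff_comap_le.2 le_sup_right

namespace RegularRun

variable (hr : RegularRun p K G Λ s₀ s₁ δ S B η τ x₀ y₀ μ W x y)
include hr

theorem isProbabilityMeasure : IsProbabilityMeasure μ :=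
  hr.run.sample_indep.isProbabilityMeasure

theorem dualSet_nonempty (i : Fin n) : (dualSet (p.f i)).Nonempty :=
  ⟨y₀ i, hr.y₀_mem i⟩

theorem isTrajectory (ω : Ω) : p.IsTrajectory η τ (p.trajectory S τ W x y ω) where
  x_zero := (hr.run.x_zero ω).symm.subst (motive := (· ∈ p.X)) hr.x₀_mem
  y_zero i := (hr.run.y_zero ω).symm.subst (motive := (· i ∈ dualSet (p.f i))) (hr.y₀_mem i)
  dual_step _ i := hr.assumptions.isDualStep_fullDual (hr.dualSet_nonempty i) _ _ _ _
  primal_step t := hr.assumptions.isPrimalStep_of_isMinOn (hr.run.x_step t ω).1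
    (hr.run.x_step t ω).2
  y_sampled t i hi := IsProxPoint.eq (convexOn_toReal_conj (p.f i)) hr.τ_pos
    (isDualStep_of_isMaxOn (hr.run.y_sampled t ω i hi).1 (hr.run.y_sampled t ω i hi).2)
    (hr.assumptions.isDualStep_fullDual (hr.dualSet_nonempty i) _ _ _ _)
  y_unsampled t i hi := hr.run.y_unsampled t ω i hi

theorem x_mem (t : ℕ) (ω : Ω) : x t ω ∈ p.X :=
  (hr.isTrajectory ω).x_mem t

theorem y_mem (t : ℕ) (ω : Ω) (i : Fin n) : y t ω i ∈ dualSet (p.f i) :=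
  (hr.isTrajectory ω).y_mem t i

theorem z_mem (t : ℕ) (ω : Ω) (i : Fin n) : p.dualIter τ W x y t ω i ∈ dualSet (p.f i) :=
  (hr.isTrajectory ω).z_mem t i

theorem measurable_y_succ {m' : MeasurableSpace Ω} {t : ℕ} (hW : Measurable[m'] (W t))
    (hX : Measurable[m'] (x t)) (hX' : Measurable[m'] (x (t - 1))) (hY : Measurable[m'] (y t)) :
    Measurable[m'] (y (t + 1)) := by
  refine measurable_pi_iff.2 fun i => ?_
  have hz : Measurable[m'] (p.dualIter τ W x y t) := hr.assumptions.measurable_fullDual hr.τ_pos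
    hr.dualSet_nonempty hX hX' hY ((measurable_fst.comp measurable_snd).comp hW)
  have hcases : (fun ω => y (t + 1) ω i) = fun ω =>
      if i ∈ (W t ω).1 then p.dualIter τ W x y t ω i else y t ω i := by
    funext ω
    split_ifs with hi
    · exact (hr.isTrajectory ω).y_sampled t i hi
    · exact (hr.isTrajectory ω).y_unsampled t i hi
  rw [hcases]
  exact Measurable.ite (measurableSet_mem_finset (measurable_fst.comp hW) i)
    ((measurable_pi_apply i).comp hz) ((measurable_pi_apply i).comp hY)

theorem measurable_x_succ {m' : MeasurableSpace Ω} {t : ℕ} (hW : Measurable[m'] (W t))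
    (hX : Measurable[m'] (x t)) (hY : Measurable[m'] (y (t + 1))) :
    Measurable[m'] (x (t + 1)) := by
  obtain ⟨Φ, hΦ, heq⟩ := exists_measurable_eq_of_isProxPoint hr.assumptions.convexOn_r hr.η_pos
  have hstep : x (t + 1) = fun ω =>
      Φ (x t ω - η⁻¹ • p.gradEst S (W t ω).1 (x t ω) (y (t + 1) ω) (W t ω).2.2) :=
    funext fun ω => heq _ _ _ ((hr.isTrajectory ω).primal_step t)
  rw [hstep]
  have hc := hr.assumptions.measurable_gradEst S (measurable_fst.comp hW) hX hY
    ((measurable_snd.comp measurable_snd).comp hW)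
  exact hΦ.comp (hX.sub (hc.const_smul η⁻¹))

theorem measurable_past_iterates (t : ℕ) :
    Measurable[past W t] (x t) ∧ Measurable[past W t] (x (t - 1)) ∧ Measurable[past W t] (y t) := by
  induction t with
  | zero =>
    rw [funext hr.run.x_zero, funext hr.run.y_zero]
    exact ⟨measurable_const, measurable_const, measurable_const⟩
  | succ t ih =>
    have hle := past_mono W (Nat.le_succ t)
    have hW : Measurable[past W (t + 1)] (W t) := measurable_past W (Nat.lt_succ_self t)
    have hX : Measurable[past W (t + 1)] (x t) := ih.1.mono hle le_rfl
    have hY : Measurable[past W (t + 1)] (y (t + 1)) :=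
      hr.measurable_y_succ hW hX (ih.2.1.mono hle le_rfl) (ih.2.2.mono hle le_rfl)
    exact ⟨hr.measurable_x_succ hW hX hY, hX, hY⟩

/-! ### The law of one iteration -/

theorem past_le (t : ℕ) : past W t ≤ mΩ :=
  ALEXR.past_le hr.run.sample_meas t

theorem pastDual_le (t : ℕ) : pastDual W t ≤ mΩ :=
  sup_le (hr.past_le t) ((measurable_fst.comp measurable_snd).comp (hr.run.sample_meas t)).comap_le

theorem pastGrad_le (t : ℕ) : pastGrad W t ≤ mΩ :=
  sup_le (hr.pastDual_le t) (measurable_fst.comp (hr.run.sample_meas t)).comap_le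

theorem measurePreserving_sample (t : ℕ) : MeasurePreserving (W t) μ
    ((blockLaw n S).prod ((p.batchLaw B).prod (p.batchLaw B))) :=
  ⟨hr.run.sample_meas t, hr.run.sample_law t⟩

theorem measurePreserving_block (t : ℕ) :
    MeasurePreserving (fun ω => (W t ω).1) μ (blockLaw n S) :=
  have := hr.assumptions.isProbabilityMeasure_batchLaw B
  measurePreserving_fst.comp (hr.measurePreserving_sample t)

theorem measurePreserving_batches (t : ℕ) :
    MeasurePreserving (fun ω => (W t ω).2) μ ((p.batchLaw B).prod (p.batchLaw B)) :=
  have := hr.assumptions.isProbabilityMeasure_batchLaw B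
  have := isProbabilityMeasure_blockLaw hr.S_le
  measurePreserving_snd.comp (hr.measurePreserving_sample t)

theorem measurePreserving_innerBatch (t : ℕ) (i : Fin n) :
    MeasurePreserving (fun ω => (W t ω).2.1 i) μ (Measure.pi fun _ => p.P i) :=
  have := hr.assumptions.prob
  have := hr.assumptions.isProbabilityMeasure_batchLaw B
  (measurePreserving_eval (fun i => Measure.pi fun _ => p.P i) i).comp
    ((measurePreserving_fst (ν := p.batchLaw B)).comp (hr.measurePreserving_batches t))

theorem measurePreserving_outerBatches (t : ℕ) :
    MeasurePreserving (fun ω => (W t ω).2.2) μ (p.batchLaw B) :=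
  have := hr.assumptions.isProbabilityMeasure_batchLaw B
  measurePreserving_snd.comp (hr.measurePreserving_batches t)

theorem indepFun_block_batches (t : ℕ) : IndepFun (fun ω => (W t ω).1) (fun ω => (W t ω).2) μ :=
  have := hr.isProbabilityMeasure
  have := hr.assumptions.isProbabilityMeasure_batchLaw B
  have := isProbabilityMeasure_blockLaw hr.S_le
  indepFun_fst_snd_of_measurePreserving_prod (hr.measurePreserving_sample t)

theorem indepFun_inner_outerBatches (t : ℕ) :
    IndepFun (fun ω => (W t ω).2.1) (fun ω => (W t ω).2.2) μ :=
  have := hr.isProbabilityMeasure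
  have := hr.assumptions.isProbabilityMeasure_batchLaw B
  indepFun_fst_snd_of_measurePreserving_prod (hr.measurePreserving_batches t)

theorem indep_pastDual_block (t : ℕ) :
    Indep (pastDual W t) (MeasurableSpace.comap (fun ω => (W t ω).1) inferInstance) μ := by
  have := hr.isProbabilityMeasure
  have hb := (measurable_fst.comp measurable_snd).comp (hr.run.sample_meas t)
  have hs := measurable_fst.comp (hr.run.sample_meas t)
  refine indep_sup_left (hr.past_le t) hb.comap_le hs.comap_le ?_ ?_
  · exact indep_of_indep_of_le_right (indep_past hr.run.sample_meas hr.run.sample_indep t)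
      (comap_sup_comap_le (measurable_fst.comp measurable_snd) measurable_fst)
  · exact (hr.indepFun_block_batches t).symm.comp measurable_fst measurable_id

theorem indep_pastGrad_outerBatches (t : ℕ) :
    Indep (pastGrad W t) (MeasurableSpace.comap (fun ω => (W t ω).2.2) inferInstance) μ := by
  have := hr.isProbabilityMeasure
  have hW := hr.run.sample_meas t
  have hs := measurable_fst.comp hW
  have hb := (measurable_fst.comp measurable_snd).comp hW
  have hb' := (measurable_snd.comp measurable_snd).comp hW
  unfold pastGrad pastDual
  rw [sup_assoc, sup_comm (MeasurableSpace.comap (fun ω => (W t ω).2.1) _)]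
  refine indep_sup_left (hr.past_le t) (sup_le hs.comap_le hb.comap_le) hb'.comap_le ?_ ?_
  · rw [sup_assoc]
    refine indep_of_indep_of_le_right (indep_past hr.run.sample_meas hr.run.sample_indep t) ?_
    exact sup_le (measurable_fst.comp (comap_measurable (W t))).comap_le
      (comap_sup_comap_le (measurable_fst.comp measurable_snd)
        (measurable_snd.comp measurable_snd))
  · refine indep_sup_left hs.comap_le hb.comap_le hb'.comap_le ?_ ?_
    · exact indep_of_indep_of_le_right (hr.indepFun_block_batches t)
        (comap_sup_comap_le (w := fun ω => (W t ω).2) measurable_fst measurable_snd)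
    · exact hr.indepFun_inner_outerBatches t

end RegularRun

end Run

/-! ### Moments of the sampling errors -/

section SamplingErrors

variable {n d m : ℕ} {Z : Type*} [MeasurableSpace Z] {p : Problem n d m Z}
  {K G Λ s₀ s₁ δ : ℝ} {S B : ℕ} {i : Fin n} {x x' : Vec d} {v : Vec m} {z : Fin n → Vec m}

/-- The error of a single sample of the extrapolated inner function. -/
def Problem.sampleError (p : Problem n d m Z) (i : Fin n) (x x' : Vec d) (ζ : Z) : Vec m :=
  (2 : ℝ) • (p.g i x - p.gs i x ζ) - (p.g i x' - p.gs i x' ζ)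

/-- The error of a single sample of the gradient of block `i`. -/
def Problem.sampleGradError (p : Problem n d m Z) (i : Fin n) (x : Vec d) (v : Vec m) (ζ : Z) :
    Vec d :=
  (p.meanDeriv i x).adjoint v - (p.dgs i x ζ).adjoint v

/-- The error of the gradient estimate that is due to the first-order oracle. -/
def Problem.oracleError (p : Problem n d m Z) (S : ℕ) (s : Finset (Fin n)) (x : Vec d)
    (z : Fin n → Vec m) (b : Fin n → Fin B → Z) : Vec d :=
  (1 / (S : ℝ)) • ∑ i ∈ s, (1 / (B : ℝ)) • ∑ j, p.sampleGradError i x (z i) (b i j)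

/-- The error of the gradient estimate that is due to the sampling of blocks. -/
def Problem.blockError (p : Problem n d m Z) (S : ℕ) (s : Finset (Fin n)) (x : Vec d)
    (z : Fin n → Vec m) : Vec d :=
  ∑ i, samplingDev S s i • (p.meanDeriv i x).adjoint (z i)

theorem batchMean_const {E : Type*} [AddCommGroup E] [Module ℝ E] (hB : 0 < B) (v : E) :
    (1 / (B : ℝ)) • ∑ _j : Fin B, v = v := by
  have hB' : (B : ℝ) ≠ 0 := Nat.cast_ne_zero.2 hB.ne'
  rw [Fin.sum_const, ← Nat.cast_smul_eq_nsmul ℝ, smul_smul, one_div_mul_cancel hB', one_smul]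

theorem innerError_gExtra (hB : 0 < B) (i : Fin n) (x x' : Vec d) (b : Fin B → Z) :
    p.innerError i x x' (p.gExtra 1 i x x' b)
      = (1 / (B : ℝ)) • ∑ j, p.sampleError i x x' (b j) := by
  simp only [Problem.innerError, Problem.gExtra, Problem.gBatch, Problem.sampleError,
    Finset.sum_sub_distrib, ← Finset.smul_sum, smul_sub, batchMean_const hB,
    smul_comm (1 / (B : ℝ)) (2 : ℝ)]
  module

theorem adjoint_sub_apply (A A' : Vec d →L[ℝ] Vec m) (v : Vec m) :
    (A - A').adjoint v = A.adjoint v - A'.adjoint v := by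
  rw [map_sub, _root_.sub_apply]

theorem norm_adjoint_apply_le (A : Vec d →L[ℝ] Vec m) (v : Vec m) : ‖A.adjoint v‖ ≤ ‖v‖ * ‖A‖ := by
  rw [mul_comm, ← LinearIsometryEquiv.norm_map ContinuousLinearMap.adjoint A]
  exact A.adjoint.le_opNorm v

theorem adjoint_dgBatch (i : Fin n) (x : Vec d) (b : Fin B → Z) (v : Vec m) :
    (p.dgBatch i x b).adjoint v = (1 / (B : ℝ)) • ∑ j, (p.dgs i x (b j)).adjoint v := by
  rw [Problem.dgBatch, map_smulₛₗ, map_sum]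
  simp

theorem oracleError_eq (hB : 0 < B) (S : ℕ) {s : Finset (Fin n)} (x : Vec d) {y : Fin n → Vec m}
    (hy : ∀ i ∈ s, y i = z i) (b : Fin n → Fin B → Z) :
    p.oracleError S s x z b
      = (1 / (S : ℝ)) • ∑ i ∈ s, (p.meanDeriv i x).adjoint (z i) - p.gradEst S s x y b := by
  rw [Problem.oracleError, Problem.gradEst, ← smul_sub, ← Finset.sum_sub_distrib]
  congr 1
  refine Finset.sum_congr rfl fun i hi => ?_
  simp only [Problem.sampleGradError]
  rw [hy i hi, adjoint_dgBatch, Finset.sum_sub_distrib, smul_sub, batchMean_const hB]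

namespace Problem.EuclideanAssumptions

variable (h : p.EuclideanAssumptions K G Λ s₀ s₁ δ)
include h

theorem memLp_sampleError (hx : x ∈ p.X) (hx' : x' ∈ p.X) :
    MemLp (p.sampleError i x x') 2 (p.P i) := by
  have := h.prob i
  exact (((memLp_const _).sub (h.gs_memLp i x hx)).const_smul (2 : ℝ)).sub
    ((memLp_const _).sub (h.gs_memLp i x' hx'))

theorem integral_sampleError (hx : x ∈ p.X) (hx' : x' ∈ p.X) :
    ∫ ζ, p.sampleError i x x' ζ ∂(p.P i) = 0 := by
  have := h.prob i
  have hInt {x} (hx : x ∈ p.X) : Integrable (fun ζ => p.g i x - p.gs i x ζ) (p.P i) :=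
    (integrable_const _).sub ((h.gs_memLp i x hx).integrable one_le_two)
  have hzero {x} (hx : x ∈ p.X) : ∫ ζ, (p.g i x - p.gs i x ζ) ∂(p.P i) = 0 := by
    rw [integral_sub (integrable_const _) ((h.gs_memLp i x hx).integrable one_le_two)]
    simp [Problem.g]
  have hInt2 : Integrable (fun ζ => (2 : ℝ) • (p.g i x - p.gs i x ζ)) (p.P i) :=
    (hInt hx).smul (2 : ℝ)
  unfold Problem.sampleError
  rw [integral_sub hInt2 (hInt hx'), integral_smul, hzero hx, hzero hx',
    smul_zero, sub_zero]

theorem integral_sampleError_norm_sq_le (hx : x ∈ p.X) (hx' : x' ∈ p.X) :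
    ∫ ζ, ‖p.sampleError i x x' ζ‖ ^ 2 ∂(p.P i) ≤ 10 * s₀ ^ 2 := by
  have := h.prob i
  have hInt {x} (hx : x ∈ p.X) : Integrable (fun ζ => ‖p.g i x - p.gs i x ζ‖ ^ 2) (p.P i) :=
    ((memLp_const (p.g i x)).sub (h.gs_memLp i x hx)).integrable_norm_pow two_ne_zero
  have hsplit (ζ : Z) : ‖p.sampleError i x x' ζ‖ ^ 2
      ≤ 8 * ‖p.g i x - p.gs i x ζ‖ ^ 2 + 2 * ‖p.g i x' - p.gs i x' ζ‖ ^ 2 := by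
    have hpar := parallelogram_law_with_norm ℝ ((2 : ℝ) • (p.g i x - p.gs i x ζ))
      (p.g i x' - p.gs i x' ζ)
    rw [norm_smul, Real.norm_ofNat] at hpar
    unfold Problem.sampleError
    nlinarith [mul_self_nonneg ‖(2 : ℝ) • (p.g i x - p.gs i x ζ) + (p.g i x' - p.gs i x' ζ)‖]
  have hmono := integral_mono ((h.memLp_sampleError hx hx').integrable_norm_pow two_ne_zero)
    (((hInt hx).const_mul 8).add ((hInt hx').const_mul 2)) hsplit
  rw [integral_add' ((hInt hx).const_mul 8) ((hInt hx').const_mul 2), integral_const_mul,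
    integral_const_mul] at hmono
  linarith [h.gs_var i x hx, h.gs_var i x' hx']

theorem meanDeriv_eq (hx : x ∈ p.X) (i : Fin n) : p.meanDeriv i x = p.dg i x :=
  h.dgs_unbiased i x hx

theorem blockError_eq (S : ℕ) (s : Finset (Fin n)) (hx : x ∈ p.X) (z : Fin n → Vec m) :
    p.blockError S s x z
      = p.fullGrad x z - (1 / (S : ℝ)) • ∑ i ∈ s, (p.meanDeriv i x).adjoint (z i) := by
  simp only [Problem.blockError, samplingDev, sub_smul, ite_smul, zero_smul,
    Finset.sum_sub_distrib, Finset.sum_ite_mem, Finset.univ_inter, ← Finset.smul_sum,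
    Problem.fullGrad, h.meanDeriv_eq hx]

theorem fullGrad_sub_gradEst (hB : 0 < B) (S : ℕ) {s : Finset (Fin n)} (hx : x ∈ p.X)
    {y : Fin n → Vec m} (hy : ∀ i ∈ s, y i = z i) (b : Fin n → Fin B → Z) :
    p.fullGrad x z - p.gradEst S s x y b = p.blockError S s x z + p.oracleError S s x z b := by
  rw [h.blockError_eq S s hx z, oracleError_eq hB S x hy b]
  abel

theorem memLp_sampleGradError (hx : x ∈ p.X) (v : Vec m) :
    MemLp (p.sampleGradError i x v) 2 (p.P i) := by
  have := h.prob i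
  have hA := (memLp_const (p := 2) (μ := p.P i) (p.meanDeriv i x)).sub (h.dgs_memLp i x hx)
  refine (hA.norm.const_mul ‖v‖).mono' ?_ (ae_of_all _ fun ζ => ?_)
  · exact (measurable_const.sub (measurable_adjoint_apply
      ((h.dgs_meas i).comp measurable_prodMk_left) measurable_const)).aestronglyMeasurable
  · rw [Problem.sampleGradError, ← adjoint_sub_apply]
    exact norm_adjoint_apply_le _ _

theorem integral_sampleGradError (hx : x ∈ p.X) (v : Vec m) :
    ∫ ζ, p.sampleGradError i x v ζ ∂(p.P i) = 0 := by
  have := h.prob i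
  have hInt : Integrable (fun ζ => p.dgs i x ζ) (p.P i) :=
    (h.dgs_memLp i x hx).integrable one_le_two
  have hintw (w : Vec d) : Integrable (fun ζ => p.dgs i x ζ w) (p.P i) :=
    hInt.apply_continuousLinearMap w
  have hinner (w : Vec d) (ζ : Z) :
      ⟪w, p.sampleGradError i x v ζ⟫ = ⟪v, p.meanDeriv i x w⟫ - ⟪v, p.dgs i x ζ w⟫ := by
    rw [Problem.sampleGradError, inner_sub_right, ContinuousLinearMap.adjoint_inner_right,
      ContinuousLinearMap.adjoint_inner_right, real_inner_comm, real_inner_comm v]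
  refine ext_inner_left ℝ fun w => ?_
  rw [← integral_inner ((h.memLp_sampleGradError hx v).integrable one_le_two), inner_zero_right]
  simp only [hinner]
  rw [integral_sub (integrable_const _) ((hintw w).const_inner v), integral_inner (hintw w),
    ← ContinuousLinearMap.integral_apply hInt]
  simp [Problem.meanDeriv]

theorem integral_sampleGradError_norm_sq_le (hx : x ∈ p.X) (hv : v ∈ dualSet (p.f i)) :
    ∫ ζ, ‖p.sampleGradError i x v ζ‖ ^ 2 ∂(p.P i) ≤ K ^ 2 * s₁ ^ 2 := by
  have := h.prob i
  have hA := (memLp_const (p := 2) (μ := p.P i) (p.dg i x)).sub (h.dgs_memLp i x hx)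
  have hle (ζ : Z) : ‖p.sampleGradError i x v ζ‖ ^ 2 ≤ K ^ 2 * ‖p.dg i x - p.dgs i x ζ‖ ^ 2 := by
    rw [Problem.sampleGradError, ← adjoint_sub_apply, ← mul_pow, h.meanDeriv_eq hx]
    gcongr
    exact (norm_adjoint_apply_le _ _).trans (by gcongr; exact h.norm_le hv)
  have hmono := integral_mono ((h.memLp_sampleGradError hx v).integrable_norm_pow two_ne_zero)
    ((hA.integrable_norm_pow two_ne_zero).const_mul (K ^ 2)) hle
  rw [integral_const_mul] at hmono
  exact hmono.trans (mul_le_mul_of_nonneg_left (h.dgs_var i x hx) (sq_nonneg _))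

theorem memLp_oracleError (s : Finset (Fin n)) (hx : x ∈ p.X) (z : Fin n → Vec m) :
    MemLp (fun b => p.oracleError S s x z b) 2 (p.batchLaw B) := by
  have := h.prob
  have hsum : MemLp (fun b : Fin n → Fin B → Z =>
      ∑ i ∈ s, (1 / (B : ℝ)) • ∑ j, p.sampleGradError i x (z i) (b i j)) 2 (p.batchLaw B) :=
    memLp_finsetSum _ fun i _ => memLp_two_pi_eval
      (P := fun i => Measure.pi fun _ : Fin B => p.P i) i
      (memLp_batchMean (h.memLp_sampleGradError hx (z i)))
  exact hsum.const_smul (1 / (S : ℝ))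

theorem integral_oracleError (s : Finset (Fin n)) (hx : x ∈ p.X) (z : Fin n → Vec m) :
    ∫ b, p.oracleError S s x z b ∂(p.batchLaw B) = 0 := by
  have := h.prob
  have hmem (i : Fin n) := memLp_batchMean (B := B) (h.memLp_sampleGradError (i := i) hx (z i))
  unfold Problem.oracleError Problem.batchLaw
  rw [integral_smul, integral_finsetSum _ fun i _ => (memLp_two_pi_eval
      (P := fun i => Measure.pi fun _ : Fin B => p.P i) i (hmem i)).integrable one_le_two,
    Finset.sum_eq_zero, smul_zero]
  intro i _
  rw [integral_comp_eval (μ := fun i => Measure.pi fun _ : Fin B => p.P i) (hmem i).1,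
    integral_batchMean (h.memLp_sampleGradError hx (z i)) (h.integral_sampleGradError hx (z i))]

theorem integral_oracleError_norm_sq_le (hS : 0 < S) (hB : 0 < B) {s : Finset (Fin n)}
    (hs : s.card = S) (hx : x ∈ p.X) (hz : ∀ i, z i ∈ dualSet (p.f i)) :
    ∫ b, ‖p.oracleError S s x z b‖ ^ 2 ∂(p.batchLaw B) ≤ K ^ 2 * s₁ ^ 2 / S := by
  have := h.prob
  have : (0 : ℝ) < S := Nat.cast_pos.2 hS
  have hmean (i : Fin n) : ∫ b : Fin B → Z,
      ‖(1 / (B : ℝ)) • ∑ j, p.sampleGradError i x (z i) (b j)‖ ^ 2 ∂(Measure.pi fun _ => p.P i)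
        ≤ K ^ 2 * s₁ ^ 2 :=
    (integral_batchMean_norm_sq_le (h.memLp_sampleGradError hx (z i))
      (h.integral_sampleGradError hx (z i))
      (h.integral_sampleGradError_norm_sq_le hx (hz i))).trans
      (div_le_self (by positivity) (Nat.one_le_cast.2 hB))
  unfold Problem.oracleError Problem.batchLaw
  simp only [norm_smul (1 / (S : ℝ)), mul_pow, norm_div, norm_one, RCLike.norm_natCast]
  rw [integral_const_mul, integral_norm_sum_sq_pi (P := fun i => Measure.pi fun _ : Fin B => p.P i)
    (fun i => memLp_batchMean (h.memLp_sampleGradError hx (z i)))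
    fun i => integral_batchMean (h.memLp_sampleGradError hx (z i))
      (h.integral_sampleGradError hx (z i))]
  calc (1 / (S : ℝ)) ^ 2 * ∑ i ∈ s, _ ≤ (1 / (S : ℝ)) ^ 2 * ∑ _i ∈ s, K ^ 2 * s₁ ^ 2 := by
        gcongr with i
        exact hmean i
    _ = K ^ 2 * s₁ ^ 2 / S := by
        rw [Finset.sum_const, hs, nsmul_eq_mul]
        field_simp

theorem integral_blockError_norm_sq_le (hS : 0 < S) (hSn : S ≤ n) (hx : x ∈ p.X)
    (hz : ∀ i, z i ∈ dualSet (p.f i)) :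
    ∫ s, ‖p.blockError S s x z‖ ^ 2 ∂(blockLaw n S) ≤ δ ^ 2 / S := by
  refine (integral_norm_sum_samplingDev_smul_sq_le hS hSn _).trans ?_
  simp only [h.meanDeriv_eq hx]
  have hS' : (0 : ℝ) ≤ 1 / S := by positivity
  exact (mul_le_mul_of_nonneg_left (h.var_block x hx z hz) hS').trans_eq (one_div_mul_eq_div _ _)

end Problem.EuclideanAssumptions

end SamplingErrors

/-! ### Moments of the errors along a run -/

section RunMoments

variable {n d m : ℕ} {Z : Type*} [MeasurableSpace Z] {p : Problem n d m Z}
  {K G Λ s₀ s₁ δ η τ : ℝ} {S B : ℕ} {x₀ : Vec d} {y₀ : Fin n → Vec m} {Ω : Type*}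
  {mΩ : MeasurableSpace Ω} {μ : Measure Ω} {W : ℕ → Ω → Sample n B Z} {x : ℕ → Ω → Vec d}
  {y : ℕ → Ω → Fin n → Vec m} {α : Type*} [MeasurableSpace α] {t : ℕ}

namespace Problem.EuclideanAssumptions

variable {X : α → Vec d} {Y : α → Fin n → Vec m} {s : α → Finset (Fin n)}
  (h : p.EuclideanAssumptions K G Λ s₀ s₁ δ)
include h

theorem measurable_blockError (S : ℕ) (hs : Measurable s) (hX : Measurable X) (hY : Measurable Y) :
    Measurable fun a => p.blockError S (s a) (X a) (Y a) :=
  Finset.measurable_fun_sum _ fun i _ =>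
    (measurable_samplingDev S hs i).smul (h.measurable_meanDeriv_adjoint i hX hY)

theorem measurable_oracleError (S : ℕ) {b : α → Fin n → Fin B → Z} (hs : Measurable s)
    (hX : Measurable X) (hY : Measurable Y) (hb : Measurable b) :
    Measurable fun a => p.oracleError S (s a) (X a) (Y a) (b a) := by
  refine Measurable.const_smul (measurable_sum_mem hs fun i => ?_) (1 / (S : ℝ))
  refine Measurable.const_smul (Finset.measurable_fun_sum _ fun j _ => ?_) (1 / (B : ℝ))
  have hbij : Measurable fun a => b a i j :=
    (measurable_pi_apply j).comp ((measurable_pi_apply i).comp hb)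
  exact (h.measurable_meanDeriv_adjoint i hX hY).sub
    (measurable_adjoint_apply ((h.dgs_meas i).comp (hX.prodMk hbij))
      ((measurable_pi_apply i).comp hY))

theorem memLp_innerError (hB : 0 < B) (i : Fin n) {a a' : Vec d} (ha : a ∈ p.X) (ha' : a' ∈ p.X) :
    MemLp (fun b : Fin B → Z => p.innerError i a a' (p.gExtra 1 i a a' b)) 2
      (Measure.pi fun _ => p.P i) := by
  have := h.prob i
  simp only [innerError_gExtra hB]
  exact memLp_batchMean (h.memLp_sampleError ha ha')

theorem integral_innerError (hB : 0 < B) (i : Fin n) {a a' : Vec d} (ha : a ∈ p.X)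
    (ha' : a' ∈ p.X) :
    ∫ b : Fin B → Z, p.innerError i a a' (p.gExtra 1 i a a' b) ∂(Measure.pi fun _ => p.P i)
      = 0 := by
  have := h.prob i
  simp only [innerError_gExtra hB]
  exact integral_batchMean (h.memLp_sampleError ha ha') (h.integral_sampleError ha ha')

theorem integral_innerError_norm_sq_le (hB : 0 < B) (i : Fin n) {a a' : Vec d} (ha : a ∈ p.X)
    (ha' : a' ∈ p.X) : ∫ b : Fin B → Z, ‖p.innerError i a a' (p.gExtra 1 i a a' b)‖ ^ 2
      ∂(Measure.pi fun _ => p.P i) ≤ 10 * s₀ ^ 2 / B := by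
  have := h.prob i
  simp only [innerError_gExtra hB]
  exact integral_batchMean_norm_sq_le (h.memLp_sampleError ha ha') (h.integral_sampleError ha ha')
    (h.integral_sampleError_norm_sq_le ha ha')

end Problem.EuclideanAssumptions

theorem integral_blockError (hS : 0 < S) (hSn : S ≤ n) (a : Vec d) (z : Fin n → Vec m) :
    ∫ s, p.blockError S s a z ∂(blockLaw n S) = 0 :=
  integral_sum_samplingDev_smul hS hSn _

namespace RegularRun

variable (hr : RegularRun p K G Λ s₀ s₁ δ S B η τ x₀ y₀ μ W x y)
include hr

theorem measurable_dualIter (t : ℕ) : Measurable[pastDual W t] (p.dualIter τ W x y t) := by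
  obtain ⟨hX, hX', hY⟩ := hr.measurable_past_iterates t
  have hle : past W t ≤ pastDual W t := le_sup_left
  exact hr.assumptions.measurable_fullDual hr.τ_pos hr.dualSet_nonempty (hX.mono hle le_rfl)
    (hX'.mono hle le_rfl) (hY.mono hle le_rfl) (measurable_batch_pastDual W t)

theorem measurable_innerErr (i : Fin n) (t : ℕ) :
    Measurable[pastDual W t] (p.innerErr W x i t) := by
  obtain ⟨hX, hX', -⟩ := hr.measurable_past_iterates t
  have hle : past W t ≤ pastDual W t := le_sup_left
  exact hr.assumptions.measurable_innerError i (hX.mono hle le_rfl) (hX'.mono hle le_rfl)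
    ((measurable_pi_apply i).comp (measurable_batch_pastDual W t))

theorem measurable_dualPair (t : ℕ) :
    Measurable[pastDual W t] fun ω => (x t ω, p.dualIter τ W x y t ω) :=
  ((hr.measurable_past_iterates t).1.mono le_sup_left le_rfl).prodMk (hr.measurable_dualIter t)

theorem measurable_gradTriple (t : ℕ) :
    Measurable[pastGrad W t] fun ω => (x t ω, p.dualIter τ W x y t ω, (W t ω).1) :=
  ((hr.measurable_past_iterates t).1.mono (le_sup_left.trans le_sup_left) le_rfl).prodMk
    (((hr.measurable_dualIter t).mono le_sup_left le_rfl).prodMk (measurable_block_pastGrad W t))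

theorem indepFun_innerBatch {U : Ω → α} (hU : Measurable[past W t] U) (i : Fin n) :
    IndepFun U (fun ω => (W t ω).2.1 i) μ :=
  (indepFun_of_measurable_past hr.run.sample_meas hr.run.sample_indep hU).comp measurable_id
    ((measurable_pi_apply i).comp (measurable_fst.comp measurable_snd))

theorem indepFun_block {U : Ω → α} (hU : Measurable[pastDual W t] U) :
    IndepFun U (fun ω => (W t ω).1) μ :=
  indep_of_indep_of_le_left (hr.indep_pastDual_block t) hU.comap_le

theorem indepFun_outerBatches {U : Ω → α} (hU : Measurable[pastGrad W t] U) :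
    IndepFun U (fun ω => (W t ω).2.2) μ :=
  indep_of_indep_of_le_left (hr.indep_pastGrad_outerBatches t) hU.comap_le

theorem memLp_innerErr (i : Fin n) (t : ℕ) :
    MemLp (p.innerErr W x i t) 2 μ ∧ ∫ ω, ‖p.innerErr W x i t ω‖ ^ 2 ∂μ ≤ 10 * s₀ ^ 2 / B := by
  have := hr.isProbabilityMeasure
  have := hr.assumptions.prob i
  obtain ⟨hX, hX', -⟩ := hr.measurable_past_iterates t
  have hU : Measurable[past W t] fun ω => (x t ω, x (t - 1) ω) := hX.prodMk hX'
  have hξ : Measurable fun w : (Vec d × Vec d) × (Fin B → Z) =>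
      p.innerError i w.1.1 w.1.2 (p.gExtra 1 i w.1.1 w.1.2 w.2) :=
    hr.assumptions.measurable_innerError i (measurable_fst.comp measurable_fst)
      (measurable_snd.comp measurable_fst) measurable_snd
  exact memLp_two_of_indep (hr.indepFun_innerBatch hU i) (hU.mono (hr.past_le t) le_rfl)
    (hr.measurePreserving_innerBatch t i) hξ.stronglyMeasurable (by positivity)
    (fun ω => hr.assumptions.memLp_innerError hr.B_pos i (hr.x_mem t ω) (hr.x_mem (t - 1) ω))
    (ae_of_all _ fun ω => hr.assumptions.integral_innerError_norm_sq_le hr.B_pos i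
      (hr.x_mem t ω) (hr.x_mem (t - 1) ω))

theorem integral_inner_innerErr (i : Fin n) {u : Ω → Vec m} (hu : Measurable[past W t] u)
    (hu2 : MemLp u 2 μ) : ∫ ω, ⟪p.innerErr W x i t ω, u ω⟫ ∂μ = 0 := by
  have := hr.isProbabilityMeasure
  have := hr.assumptions.prob i
  obtain ⟨hX, hX', -⟩ := hr.measurable_past_iterates t
  have hU : Measurable[past W t] fun ω => (x t ω, x (t - 1) ω, u ω) := hX.prodMk (hX'.prodMk hu)
  have hξ : Measurable fun w : (Vec d × Vec d × Vec m) × (Fin B → Z) =>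
      p.innerError i w.1.1 w.1.2.1 (p.gExtra 1 i w.1.1 w.1.2.1 w.2) :=
    hr.assumptions.measurable_innerError i (measurable_fst.comp measurable_fst)
      ((measurable_fst.comp measurable_snd).comp measurable_fst) measurable_snd
  exact integral_inner_eq_zero_of_indep (hr.indepFun_innerBatch hU i)
    (hU.mono (hr.past_le t) le_rfl) (hr.measurePreserving_innerBatch t i) hξ.stronglyMeasurable
    (measurable_snd.comp measurable_snd).stronglyMeasurable (hr.memLp_innerErr i t).1 hu2
    (fun ω => (hr.assumptions.memLp_innerError hr.B_pos i (hr.x_mem t ω)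
      (hr.x_mem (t - 1) ω)).integrable one_le_two)
    (fun ω => hr.assumptions.integral_innerError hr.B_pos i (hr.x_mem t ω) (hr.x_mem (t - 1) ω))

theorem integral_block (t : ℕ) (φ : Finset (Fin n) → ℝ) :
    ∫ ω, φ (W t ω).1 ∂μ = ∫ s, φ s ∂(blockLaw n S) := by
  rw [← (hr.measurePreserving_block t).map_eq]
  exact (integral_map (hr.measurePreserving_block t).aemeasurable
    (Measurable.of_discrete (f := φ)).aestronglyMeasurable).symm

theorem ae_card_block (t : ℕ) : ∀ᵐ ω ∂μ, ((W t ω).1).card = S := by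
  have hmem : ∀ᵐ s ∂(blockLaw n S), s ∈ ((Finset.univ.powersetCard S :
      Finset (Finset (Fin n))) : Set (Finset (Fin n))) := ae_cond_mem MeasurableSet.of_discrete
  have hcard : ∀ᵐ s ∂(blockLaw n S), s.card = S := hmem.mono fun s hs =>
    (Finset.mem_powersetCard.1 (Finset.mem_coe.1 hs)).2
  exact (hr.measurePreserving_block t).quasiMeasurePreserving.ae hcard

theorem integral_block_mul (φ : Finset (Fin n) → ℝ) {H : Ω → ℝ} (hH : Measurable[pastDual W t] H) :
    ∫ ω, φ (W t ω).1 * H ω ∂μ = (∫ s, φ s ∂(blockLaw n S)) * ∫ ω, H ω ∂μ := by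
  have hindep : IndepFun (fun ω => φ (W t ω).1) H μ :=
    ((hr.indepFun_block hH).comp measurable_id (Measurable.of_discrete (f := φ))).symm
  rw [hindep.integral_fun_mul_eq_mul_integral
    ((Measurable.of_discrete (f := φ)).comp
      (hr.measurePreserving_block t).measurable).aestronglyMeasurable
    (hH.mono (hr.pastDual_le t) le_rfl).aestronglyMeasurable, hr.integral_block t φ]

theorem integral_samplingDev_mul (i : Fin n) {H : Ω → ℝ} (hH : Measurable[pastDual W t] H) :
    ∫ ω, samplingDev S (W t ω).1 i * H ω ∂μ = 0 := by
  rw [hr.integral_block_mul (fun s => samplingDev S s i) hH,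
    integral_samplingDev hr.S_pos hr.S_le, zero_mul]

theorem integral_samplingDev_sq_mul_le (i : Fin n) {H : Ω → ℝ} (hH : Measurable[pastDual W t] H)
    (hH0 : ∀ ω, 0 ≤ H ω) :
    ∫ ω, samplingDev S (W t ω).1 i ^ 2 * H ω ∂μ ≤ 1 / n * (1 / S) * ∫ ω, H ω ∂μ := by
  rw [hr.integral_block_mul (fun s => samplingDev S s i ^ 2) hH]
  exact mul_le_mul_of_nonneg_right (integral_samplingDev_sq_le hr.S_pos hr.S_le i)
    (integral_nonneg hH0)

theorem gradErr_eq (t : ℕ) (ω : Ω) :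
    p.gradErr S τ W x y t ω = p.blockError S (W t ω).1 (x t ω) (p.dualIter τ W x y t ω)
      + p.oracleError S (W t ω).1 (x t ω) (p.dualIter τ W x y t ω) (W t ω).2.2 :=
  hr.assumptions.fullGrad_sub_gradEst hr.B_pos S (hr.x_mem t ω)
    ((hr.isTrajectory ω).y_sampled t) _

theorem memLp_blockError (t : ℕ) :
    MemLp (fun ω => p.blockError S (W t ω).1 (x t ω) (p.dualIter τ W x y t ω)) 2 μ ∧
      ∫ ω, ‖p.blockError S (W t ω).1 (x t ω) (p.dualIter τ W x y t ω)‖ ^ 2 ∂μ ≤ δ ^ 2 / S := by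
  have := hr.isProbabilityMeasure
  have := isProbabilityMeasure_blockLaw hr.S_le
  have hU := hr.measurable_dualPair t
  exact memLp_two_of_indep (hr.indepFun_block hU) (hU.mono (hr.pastDual_le t) le_rfl)
    (hr.measurePreserving_block t)
    (hr.assumptions.measurable_blockError S measurable_snd (measurable_fst.comp measurable_fst)
      (measurable_snd.comp measurable_fst)).stronglyMeasurable (by positivity)
    (fun ω => MemLp.of_discrete)
    (ae_of_all _ fun ω => hr.assumptions.integral_blockError_norm_sq_le hr.S_pos hr.S_le
      (hr.x_mem t ω) (hr.z_mem t ω))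

theorem integral_inner_blockError {xs : Vec d} (hx : MemLp (fun ω => x t ω - xs) 2 μ) :
    ∫ ω, ⟪p.blockError S (W t ω).1 (x t ω) (p.dualIter τ W x y t ω), x t ω - xs⟫ ∂μ = 0 := by
  have := hr.isProbabilityMeasure
  have := isProbabilityMeasure_blockLaw hr.S_le
  have hU := hr.measurable_dualPair t
  exact integral_inner_eq_zero_of_indep (hr.indepFun_block hU)
    (hU.mono (hr.pastDual_le t) le_rfl) (hr.measurePreserving_block t)
    (hr.assumptions.measurable_blockError S measurable_snd (measurable_fst.comp measurable_fst)
      (measurable_snd.comp measurable_fst)).stronglyMeasurable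
    (measurable_fst.sub_const xs).stronglyMeasurable (hr.memLp_blockError t).1 hx
    (fun ω => Integrable.of_finite)
    (fun ω => integral_blockError hr.S_pos hr.S_le (x t ω) (p.dualIter τ W x y t ω))

theorem measurable_oracleError_triple : Measurable
    fun w : (Vec d × (Fin n → Vec m) × Finset (Fin n)) × (Fin n → Fin B → Z) =>
      p.oracleError S w.1.2.2 w.1.1 w.1.2.1 w.2 :=
  hr.assumptions.measurable_oracleError S
    ((measurable_snd.comp measurable_snd).comp measurable_fst)
    (measurable_fst.comp measurable_fst)
    ((measurable_fst.comp measurable_snd).comp measurable_fst) measurable_snd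

theorem memLp_oracleError (t : ℕ) :
    MemLp (fun ω => p.oracleError S (W t ω).1 (x t ω) (p.dualIter τ W x y t ω) (W t ω).2.2) 2 μ ∧
      ∫ ω, ‖p.oracleError S (W t ω).1 (x t ω) (p.dualIter τ W x y t ω) (W t ω).2.2‖ ^ 2 ∂μ
        ≤ K ^ 2 * s₁ ^ 2 / S := by
  have := hr.isProbabilityMeasure
  have := hr.assumptions.isProbabilityMeasure_batchLaw B
  have hU := hr.measurable_gradTriple t
  refine memLp_two_of_indep (hr.indepFun_outerBatches hU) (hU.mono (hr.pastGrad_le t) le_rfl)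
    (hr.measurePreserving_outerBatches t) hr.measurable_oracleError_triple.stronglyMeasurable
    (by positivity) (fun ω => hr.assumptions.memLp_oracleError _ (hr.x_mem t ω) _) ?_
  filter_upwards [hr.ae_card_block t] with ω hω
  exact hr.assumptions.integral_oracleError_norm_sq_le hr.S_pos hr.B_pos hω (hr.x_mem t ω)
    (hr.z_mem t ω)

theorem integral_inner_oracleError {xs : Vec d} (hx : MemLp (fun ω => x t ω - xs) 2 μ) :
    ∫ ω, ⟪p.oracleError S (W t ω).1 (x t ω) (p.dualIter τ W x y t ω) (W t ω).2.2, x t ω - xs⟫ ∂μ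
      = 0 := by
  have := hr.isProbabilityMeasure
  have := hr.assumptions.isProbabilityMeasure_batchLaw B
  have hU := hr.measurable_gradTriple t
  exact integral_inner_eq_zero_of_indep (hr.indepFun_outerBatches hU)
    (hU.mono (hr.pastGrad_le t) le_rfl) (hr.measurePreserving_outerBatches t)
    hr.measurable_oracleError_triple.stronglyMeasurable
    (measurable_fst.sub_const xs).stronglyMeasurable (hr.memLp_oracleError t).1 hx
    (fun ω => (hr.assumptions.memLp_oracleError _ (hr.x_mem t ω) _).integrable one_le_two)
    (fun ω => hr.assumptions.integral_oracleError _ (hr.x_mem t ω) _)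

theorem memLp_gradErr (t : ℕ) :
    MemLp (p.gradErr S τ W x y t) 2 μ ∧
      ∫ ω, ‖p.gradErr S τ W x y t ω‖ ^ 2 ∂μ ≤ 2 * (K ^ 2 * s₁ ^ 2 + δ ^ 2) / S := by
  obtain ⟨hblock, hblock_le⟩ := hr.memLp_blockError t
  obtain ⟨horacle, horacle_le⟩ := hr.memLp_oracleError t
  have hblock_int := hblock.integrable_norm_pow two_ne_zero
  have horacle_int := horacle.integrable_norm_pow two_ne_zero
  have hmem := hblock.add horacle
  rw [funext (hr.gradErr_eq t)]
  refine ⟨hmem, ?_⟩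
  calc _ ≤ ∫ ω, (2 * ‖p.blockError S (W t ω).1 (x t ω) (p.dualIter τ W x y t ω)‖ ^ 2
        + 2 * ‖p.oracleError S (W t ω).1 (x t ω) (p.dualIter τ W x y t ω) (W t ω).2.2‖ ^ 2) ∂μ := by
        refine integral_mono (hmem.integrable_norm_pow two_ne_zero)
          ((hblock_int.const_mul 2).add (horacle_int.const_mul 2)) fun ω => ?_
        dsimp only [Pi.add_apply]
        rw [← mul_add]
        exact (pow_le_pow_left₀ (norm_nonneg _) (norm_add_le _ _) 2).trans add_sq_le
    _ ≤ _ := by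
        rw [integral_add (hblock_int.const_mul 2) (horacle_int.const_mul 2), integral_const_mul,
          integral_const_mul, mul_div_assoc, add_div]
        linarith

theorem integral_inner_gradErr {xs : Vec d} (hx : MemLp (fun ω => x t ω - xs) 2 μ) :
    ∫ ω, ⟪p.gradErr S τ W x y t ω, x t ω - xs⟫ ∂μ = 0 := by
  simp only [hr.gradErr_eq, inner_add_left]
  rw [integral_add (integrable_inner_of_memLp_two (hr.memLp_blockError t).1 hx)
    (integrable_inner_of_memLp_two (hr.memLp_oracleError t).1 hx),
    hr.integral_inner_blockError hx, hr.integral_inner_oracleError hx, add_zero]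

end RegularRun

end RunMoments

/-! ### Bounds on integrals -/

section IntegralLE

variable {Ω : Type*} {mΩ : MeasurableSpace Ω} {μ : Measure Ω}

/-- `f` is integrable with integral at most `c`. Bounds on expectations are carried in this form
because the integral of a function that is not integrable is `0`. -/
def IntegralLE (μ : Measure Ω) (f : Ω → ℝ) (c : ℝ) : Prop :=
  Integrable f μ ∧ ∫ ω, f ω ∂μ ≤ c

namespace IntegralLE

variable {f g : Ω → ℝ} {a b : ℝ}

theorem const [IsProbabilityMeasure μ] (a : ℝ) : IntegralLE μ (fun _ => a) a :=
  ⟨integrable_const a, by simp⟩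

theorem add (hf : IntegralLE μ f a) (hg : IntegralLE μ g b) :
    IntegralLE μ (fun ω => f ω + g ω) (a + b) :=
  ⟨hf.1.add hg.1, (integral_add hf.1 hg.1).trans_le (add_le_add hf.2 hg.2)⟩

theorem const_mul (hf : IntegralLE μ f a) (hb : 0 ≤ b) : IntegralLE μ (fun ω => b * f ω) (b * a) :=
  ⟨hf.1.const_mul b, (integral_const_mul b f).trans_le (mul_le_mul_of_nonneg_left hf.2 hb)⟩

theorem sum {ι : Type*} (s : Finset ι) {f : ι → Ω → ℝ} (hf : ∀ i, IntegralLE μ (f i) a) :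
    IntegralLE μ (fun ω => ∑ i ∈ s, f i ω) (s.card * a) :=
  ⟨integrable_finsetSum s fun i _ => (hf i).1,
    (integral_finsetSum s fun i _ => (hf i).1).trans_le <|
      (Finset.sum_le_card_nsmul s _ a fun i _ => (hf i).2).trans_eq (nsmul_eq_mul _ _)⟩

theorem lintegral_toENNReal_le {φ : Ω → EReal} (hf : IntegralLE μ f a)
    (hφ : ∀ ω, ∃ b : ℝ, 0 ≤ b ∧ φ ω = b ∧ b ≤ f ω) :
    ∫⁻ ω, (φ ω).toENNReal ∂μ ≤ ENNReal.ofReal a := by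
  have hf0 (ω : Ω) : 0 ≤ f ω := by
    obtain ⟨b, hb, -, hle⟩ := hφ ω
    exact hb.trans hle
  calc ∫⁻ ω, (φ ω).toENNReal ∂μ ≤ ∫⁻ ω, ENNReal.ofReal (f ω) ∂μ := by
        refine lintegral_mono fun ω => ?_
        obtain ⟨b, -, hφb, hle⟩ := hφ ω
        rw [hφb, EReal.toENNReal_of_ne_top (EReal.coe_ne_top b), EReal.toReal_coe]
        exact ENNReal.ofReal_le_ofReal hle
    _ = ENNReal.ofReal (∫ ω, f ω ∂μ) :=
        (ofReal_integral_eq_lintegral_ofReal hf.1 (ae_of_all _ hf0)).symm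
    _ ≤ ENNReal.ofReal a := ENNReal.ofReal_le_ofReal hf.2

end IntegralLE

theorem integral_norm_sum_range_sq {F : Type*} [NormedAddCommGroup F] [InnerProductSpace ℝ F]
    {e : ℕ → Ω → F} (he : ∀ t, MemLp (e t) 2 μ)
    (horth : ∀ t, ∫ ω, ⟪e t ω, ∑ k ∈ Finset.range t, e k ω⟫ ∂μ = 0) (T : ℕ) :
    ∫ ω, ‖∑ t ∈ Finset.range T, e t ω‖ ^ 2 ∂μ = ∑ t ∈ Finset.range T, ∫ ω, ‖e t ω‖ ^ 2 ∂μ := by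
  have hsum (T : ℕ) : MemLp (fun ω => ∑ t ∈ Finset.range T, e t ω) 2 μ :=
    memLp_finsetSum _ fun t _ => he t
  induction T with
  | zero => simp
  | succ T ih =>
    have hexpand (ω : Ω) : ‖∑ t ∈ Finset.range (T + 1), e t ω‖ ^ 2
        = ‖∑ t ∈ Finset.range T, e t ω‖ ^ 2
          + 2 * ⟪e T ω, ∑ t ∈ Finset.range T, e t ω⟫ + ‖e T ω‖ ^ 2 := by
      rw [Finset.sum_range_succ, norm_add_sq_real, real_inner_comm]
    have hsum_int := (hsum T).integrable_norm_pow two_ne_zero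
    have hcross_int := (integrable_inner_of_memLp_two (he T) (hsum T)).const_mul 2
    have hpartial_int : Integrable (fun ω => ‖∑ t ∈ Finset.range T, e t ω‖ ^ 2
        + 2 * ⟪e T ω, ∑ t ∈ Finset.range T, e t ω⟫) μ := hsum_int.add hcross_int
    simp only [hexpand]
    rw [integral_add hpartial_int ((he T).integrable_norm_pow two_ne_zero),
      integral_add hsum_int hcross_int, integral_const_mul, horth, ih, Finset.sum_range_succ]
    ring

theorem IntegralLE.norm_sum_range_sq {F : Type*} [NormedAddCommGroup F] [InnerProductSpace ℝ F]
    {e : ℕ → Ω → F} {c : ℝ} (he : ∀ t, MemLp (e t) 2 μ ∧ ∫ ω, ‖e t ω‖ ^ 2 ∂μ ≤ c)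
    (horth : ∀ t, ∫ ω, ⟪e t ω, ∑ k ∈ Finset.range t, e k ω⟫ ∂μ = 0) (T : ℕ) :
    IntegralLE μ (fun ω => ‖∑ t ∈ Finset.range T, e t ω‖ ^ 2) (T * c) := by
  refine ⟨(memLp_finsetSum (Finset.range T) fun t _ => (he t).1).integrable_norm_pow two_ne_zero,
    ?_⟩
  rw [integral_norm_sum_range_sq (fun t => (he t).1) horth]
  refine (Finset.sum_le_card_nsmul _ _ c fun t _ => (he t).2).trans_eq ?_
  rw [Finset.card_range, nsmul_eq_mul]

end IntegralLE

/-! ### Growth of the primal iterates -/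

section Growth

variable {n d m : ℕ} {Z : Type*} [MeasurableSpace Z]
  {p : Problem n d m Z} {K G Λ s₀ s₁ δ : ℝ}

theorem mean_le_of_forall_le (hn : 0 < n) {a : Fin n → ℝ} {c : ℝ} (ha : ∀ i, a i ≤ c) :
    1 / (n : ℝ) * ∑ i, a i ≤ c := by
  rw [← one_div_mul_sum_const hn c]
  gcongr with i
  exact ha i

theorem sq_le_of_half_sq_add_half_sq_le {η a b c M ε : ℝ} (hη : 0 < η)
    (h : η / 2 * a ^ 2 + η / 2 * b ^ 2 ≤ η / 2 * c ^ 2 + M * c + M * a + (M + ε) * b) :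
    b ^ 2 ≤ 4 * c ^ 2 + (12 * M ^ 2 + 8 * ε ^ 2) / η ^ 2 := by
  have hslack : 4 * c ^ 2 + (12 * M ^ 2 + 8 * ε ^ 2) / η ^ 2 - b ^ 2
      = 4 / η * (η / 2 * c ^ 2 + M * c + M * a + (M + ε) * b - (η / 2 * a ^ 2 + η / 2 * b ^ 2))
        + 2 * (c - M / η) ^ 2 + 2 * (a - M / η) ^ 2 + (b - 2 * (M + ε) / η) ^ 2
        + 4 * (M / η - ε / η) ^ 2 := by
    field_simp
    ring
  have := sub_nonneg.2 h
  rw [← sub_nonneg, hslack]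
  positivity

namespace Problem.EuclideanAssumptions

variable (h : p.EuclideanAssumptions K G Λ s₀ s₁ δ)
include h

theorem realF_le_of_isMinOn {xs x : Vec d} (hxs : xs ∈ p.dom) (hmin : IsMinOn p.F p.X xs)
    (hx : x ∈ p.dom) : p.realF xs ≤ p.realF x := by
  have hle : p.F xs ≤ p.F x := hmin hx.1
  rwa [h.F_eq_coe hxs, h.F_eq_coe hx, EReal.coe_le_coe_iff] at hle

theorem toReal_r_sub_le (hn : 0 < n) {xs x : Vec d} (hxs : xs ∈ p.dom)
    (hmin : IsMinOn p.F p.X xs) (hx : x ∈ p.dom) :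
    (p.r xs).toReal - (p.r x).toReal ≤ K * G * ‖x - xs‖ := by
  have hF := h.realF_le_of_isMinOn hxs hmin hx
  have hf := mean_le_of_forall_le hn (a := fun i => p.f i (p.g i x) - p.f i (p.g i xs))
    (c := K * G * ‖x - xs‖) fun i => by
      refine (le_abs_self _).trans ((h.f_lip i _ _).trans ?_)
      rw [mul_assoc]
      exact mul_le_mul_of_nonneg_left (h.g_lip i _ hx.1 _ hxs.1) h.K_nonneg
  rw [Finset.sum_sub_distrib, mul_sub] at hf
  simp only [realF] at hF
  linarith

theorem abs_inner_fullGrad_sub_le (hn : 0 < n) {x w : Vec d} {z : Fin n → Vec m} (hx : x ∈ p.X)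
    (hw : w ∈ p.X) (hz : ∀ i, z i ∈ dualSet (p.f i)) :
    |⟪p.fullGrad x z, w - x⟫| ≤ K * G * ‖w - x‖ := by
  have hi (i : Fin n) : |⟪z i, p.dg i x (w - x)⟫| ≤ K * G * ‖w - x‖ := by
    refine (abs_real_inner_le_norm _ _).trans ?_
    rw [mul_assoc]
    exact mul_le_mul (h.norm_le (hz i)) (h.norm_dg_le i hx hw) (norm_nonneg _) h.K_nonneg
  rw [inner_fullGrad, abs_le, neg_le, ← mul_neg, ← Finset.sum_neg_distrib]
  exact ⟨mean_le_of_forall_le hn fun i => (neg_le_abs _).trans (hi i),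
    mean_le_of_forall_le hn fun i => (le_abs_self _).trans (hi i)⟩

theorem norm_primal_step_sub_sq_le (hn : 0 < n) {η : ℝ} (hη : 0 < η) {x x' c xs : Vec d}
    {z : Fin n → Vec m} (hx : x ∈ p.X) (hz : ∀ i, z i ∈ dualSet (p.f i))
    (hx' : p.IsPrimalStep η x c x') (hxs : xs ∈ p.dom) (hmin : IsMinOn p.F p.X xs) :
    ‖x' - xs‖ ^ 2
      ≤ 4 * ‖x - xs‖ ^ 2 + (12 * (K * G) ^ 2 + 8 * ‖p.fullGrad x z - c‖ ^ 2) / η ^ 2 := by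
  refine sq_le_of_half_sq_add_half_sq_le (a := ‖x' - x‖) hη ?_
  have hprox := hx'.three_point h.convexOn_r hxs
  have hr := h.toReal_r_sub_le hn hxs hmin hx'.1
  have hxs_grad := (abs_le.1 (h.abs_inner_fullGrad_sub_le hn hx hxs.1 hz)).2
  have hx'_grad := (abs_le.1 (h.abs_inner_fullGrad_sub_le hn hx hx'.1.1 hz)).1
  have herr := real_inner_le_norm (p.fullGrad x z - c) (x' - xs)
  have hsplit : ⟪c, xs⟫ - ⟪c, x'⟫ = ⟪p.fullGrad x z, xs - x⟫ - ⟪p.fullGrad x z, x' - x⟫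
      + ⟪p.fullGrad x z - c, x' - xs⟫ := by
    simp only [inner_sub_left, inner_sub_right]
    ring
  rw [norm_sub_rev xs x', norm_sub_rev xs x] at hprox
  rw [norm_sub_rev xs x] at hxs_grad
  linarith

end Problem.EuclideanAssumptions

theorem abs_samplingDev_le (S : ℕ) (s : Finset (Fin n)) (i : Fin n) : |samplingDev S s i| ≤ 2 := by
  have hn := Nat.cast_inv_le_one (α := ℝ) n
  have hS := Nat.cast_inv_le_one (α := ℝ) S
  have hn' : (0 : ℝ) ≤ (n : ℝ)⁻¹ := by positivity
  have hS' : (0 : ℝ) ≤ (S : ℝ)⁻¹ := by positivity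
  rw [samplingDev, abs_le, one_div, one_div]
  split_ifs <;> constructor <;> linarith

end Growth

/-! ### Expectations of the error terms -/

section ErrorTerms

variable {n d m : ℕ} {Z : Type*} [MeasurableSpace Z] {p : Problem n d m Z}
  {K G Λ s₀ s₁ δ η τ : ℝ} {S B : ℕ} {x₀ : Vec d} {y₀ : Fin n → Vec m} {Ω : Type*}

/-- The move of block `i` in the full dual step at time `t` of a run. -/
def Problem.dualMove (p : Problem n d m Z) (τ : ℝ) (W : ℕ → Ω → Sample n B Z)
    (x : ℕ → Ω → Vec d) (y : ℕ → Ω → Fin n → Vec m) (i : Fin n) (t : ℕ) (ω : Ω) : Vec m :=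
  p.dualIter τ W x y t ω i - y t ω i

/-- The noise that the choice of the updated blocks adds to the move of block `i` at time `t` of
a run. -/
def Problem.samplingNoise (p : Problem n d m Z) (S : ℕ) (τ : ℝ) (W : ℕ → Ω → Sample n B Z)
    (x : ℕ → Ω → Vec d) (y : ℕ → Ω → Fin n → Vec m) (i : Fin n) (t : ℕ) (ω : Ω) : Vec m :=
  samplingDev S (W t ω).1 i • p.dualMove τ W x y i t ω

variable {mΩ : MeasurableSpace Ω} {μ : Measure Ω} {W : ℕ → Ω → Sample n B Z}
  {x : ℕ → Ω → Vec d} {y : ℕ → Ω → Fin n → Vec m}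

theorem Problem.EuclideanAssumptions.norm_sub_le_of_mem_dualSet
    (h : p.EuclideanAssumptions K G Λ s₀ s₁ δ) {i : Fin n} {v w : Vec m}
    (hv : v ∈ dualSet (p.f i)) (hw : w ∈ dualSet (p.f i)) : ‖v - w‖ ≤ 2 * K := by
  linarith [norm_sub_le v w, h.norm_le hv, h.norm_le hw]

omit mΩ in
theorem pastDual_le_past (W : ℕ → Ω → Sample n B Z) {k t : ℕ} (hk : k < t) :
    pastDual W k ≤ past W t :=
  sup_le (past_mono W hk.le) (measurable_iff_comap_le.1
    ((measurable_fst.comp measurable_snd).comp (measurable_past W hk)))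

namespace RegularRun

variable (hr : RegularRun p K G Λ s₀ s₁ δ S B η τ x₀ y₀ μ W x y)
include hr

theorem memLp_x_sub {xs : Vec d} (hxs : xs ∈ p.dom) (hmin : IsMinOn p.F p.X xs) (t : ℕ) :
    MemLp (fun ω => x t ω - xs) 2 μ := by
  have := hr.isProbabilityMeasure
  have hmeas (t : ℕ) : AEStronglyMeasurable (fun ω => x t ω - xs) μ :=
    (((hr.measurable_past_iterates t).1.mono (hr.past_le t) le_rfl).sub_const
      xs).aestronglyMeasurable
  induction t with
  | zero =>
    simp only [hr.run.x_zero]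
    exact memLp_const _
  | succ t ih =>
    rw [memLp_two_iff_integrable_sq_norm (hmeas (t + 1))]
    have hx := (ih.integrable_norm_pow two_ne_zero).const_mul 4
    have herr := ((hr.memLp_gradErr t).1.integrable_norm_pow two_ne_zero).const_mul 8
    refine (hx.add (((integrable_const (12 * (K * G) ^ 2)).add herr).div_const (η ^ 2))).mono'
      ((hmeas (t + 1)).norm.pow 2) (ae_of_all _ fun ω => ?_)
    rw [Real.norm_of_nonneg (by positivity)]
    exact hr.assumptions.norm_primal_step_sub_sq_le (hr.S_pos.trans_le hr.S_le) hr.η_pos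
      (hr.x_mem t ω) (hr.z_mem t ω) ((hr.isTrajectory ω).primal_step t) hxs hmin

theorem measurable_y_block (i : Fin n) (t : ℕ) : Measurable[past W t] fun ω => y t ω i :=
  (measurable_pi_apply i).comp (hr.measurable_past_iterates t).2.2

theorem measurable_z_block (i : Fin n) (t : ℕ) :
    Measurable[pastDual W t] fun ω => p.dualIter τ W x y t ω i :=
  (measurable_pi_apply i).comp (hr.measurable_dualIter t)

theorem integralLE_samplingDev_mul (i : Fin n) {t : ℕ} {H : Ω → ℝ}
    (hH : Measurable[pastDual W t] H) {c : ℝ} (hc : ∀ ω, |H ω| ≤ c) :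
    IntegralLE μ (fun ω => samplingDev S (W t ω).1 i * H ω) 0 := by
  have := hr.isProbabilityMeasure
  refine ⟨?_, (hr.integral_samplingDev_mul i hH).le⟩
  have hdev : AEStronglyMeasurable (fun ω => samplingDev S (W t ω).1 i) μ :=
    (measurable_samplingDev S (hr.measurePreserving_block t).measurable i).aestronglyMeasurable
  refine (integrable_const (2 * c)).mono'
    (hdev.mul (hH.mono (hr.pastDual_le t) le_rfl).aestronglyMeasurable) (ae_of_all _ fun ω => ?_)
  rw [Real.norm_eq_abs, abs_mul]
  exact mul_le_mul (abs_samplingDev_le S _ i) (hc ω) (abs_nonneg _) zero_le_two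

theorem integralLE_inner_gradErr {xs : Vec d} (hxs : xs ∈ p.dom) (hmin : IsMinOn p.F p.X xs)
    (t : ℕ) : IntegralLE μ (fun ω => ⟪p.gradErr S τ W x y t ω, x t ω - xs⟫) 0 :=
  ⟨integrable_inner_of_memLp_two (hr.memLp_gradErr t).1 (hr.memLp_x_sub hxs hmin t),
    (hr.integral_inner_gradErr (hr.memLp_x_sub hxs hmin t)).le⟩

theorem integralLE_inner_innerErr (i : Fin n) (t : ℕ) :
    IntegralLE μ (fun ω => ⟪y₀ i - y t ω i, p.innerErr W x i t ω⟫) 0 := by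
  have := hr.isProbabilityMeasure
  have hmeas : Measurable[past W t] fun ω => y₀ i - y t ω i :=
    (hr.measurable_y_block i t).const_sub _
  have hmem : MemLp (fun ω => y₀ i - y t ω i) 2 μ :=
    MemLp.of_bound (hmeas.mono (hr.past_le t) le_rfl).aestronglyMeasurable (2 * K)
      (ae_of_all _ fun ω =>
        hr.assumptions.norm_sub_le_of_mem_dualSet (hr.y₀_mem i) (hr.y_mem t ω i))
  refine ⟨integrable_inner_of_memLp_two hmem (hr.memLp_innerErr i t).1, ?_⟩
  simp only [real_inner_comm]
  exact (hr.integral_inner_innerErr i hmeas hmem).le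

theorem integralLE_samplingDev_mul_norm_sq_sub (i : Fin n) (t : ℕ) :
    IntegralLE μ (fun ω => samplingDev S (W t ω).1 i
      * (‖y t ω i - y₀ i‖ ^ 2 - ‖p.dualIter τ W x y t ω i - y₀ i‖ ^ 2)) 0 := by
  have hy := ((hr.measurable_y_block i t).mono (le_sup_left : _ ≤ pastDual W t) le_rfl).sub_const
    (y₀ i)
  have hz := (hr.measurable_z_block i t).sub_const (y₀ i)
  have hnorm : Measurable fun v : Vec m => ‖v‖ ^ 2 := measurable_norm.pow_const 2
  refine hr.integralLE_samplingDev_mul i ((hnorm.comp hy).sub (hnorm.comp hz))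
    (c := (2 * K) ^ 2) fun ω => abs_sub_le_of_nonneg_of_le (sq_nonneg _) ?_ (sq_nonneg _) ?_
  · exact pow_le_pow_left₀ (norm_nonneg _)
      (hr.assumptions.norm_sub_le_of_mem_dualSet (hr.y_mem t ω i) (hr.y₀_mem i)) 2
  · exact pow_le_pow_left₀ (norm_nonneg _)
      (hr.assumptions.norm_sub_le_of_mem_dualSet (hr.z_mem t ω i) (hr.y₀_mem i)) 2

theorem integralLE_blockMartingaleTerm (T : ℕ) (i : Fin n) :
    IntegralLE μ (fun ω => p.blockMartingaleTerm S τ (p.trajectory S τ W x y ω) T i) 0 := by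
  have hτ := hr.τ_pos
  have hinner := (IntegralLE.sum (Finset.range T) (hr.integralLE_inner_innerErr i)).const_mul
    (show (0 : ℝ) ≤ 1 / n by positivity)
  have hdev := (IntegralLE.sum (Finset.range T)
    (hr.integralLE_samplingDev_mul_norm_sq_sub i)).const_mul (show (0 : ℝ) ≤ τ / 2 by positivity)
  have hsum := hinner.add hdev
  simp only [mul_zero, add_zero] at hsum
  simp only [Problem.blockMartingaleTerm, Problem.trajectory, hr.run.y_zero]
  exact hsum

theorem integralLE_martingaleTerm {xs : Vec d} (hxs : xs ∈ p.dom) (hmin : IsMinOn p.F p.X xs)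
    (T : ℕ) :
    IntegralLE μ (fun ω => p.martingaleTerm S τ xs (p.trajectory S τ W x y ω) T) 0 := by
  have hsum := (IntegralLE.sum (Finset.range T) (hr.integralLE_inner_gradErr hxs hmin)).add
    (IntegralLE.sum Finset.univ (hr.integralLE_blockMartingaleTerm T))
  simp only [mul_zero, add_zero] at hsum
  exact hsum

theorem integralLE_norm_sum_innerErr_sq (i : Fin n) (T : ℕ) :
    IntegralLE μ (fun ω => ‖∑ t ∈ Finset.range T, p.innerErr W x i t ω‖ ^ 2)
      (T * (10 * s₀ ^ 2 / B)) := by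
  refine IntegralLE.norm_sum_range_sq (hr.memLp_innerErr i) (fun t => ?_) T
  exact hr.integral_inner_innerErr i (Finset.measurable_fun_sum _ fun k hk =>
      (hr.measurable_innerErr i k).mono (pastDual_le_past W (Finset.mem_range.1 hk)) le_rfl)
    (memLp_finsetSum _ fun k _ => (hr.memLp_innerErr i k).1)

theorem measurable_dualMove (i : Fin n) (t : ℕ) :
    Measurable[pastDual W t] (p.dualMove τ W x y i t) :=
  (hr.measurable_z_block i t).sub ((hr.measurable_y_block i t).mono le_sup_left le_rfl)

theorem norm_dualMove_le (i : Fin n) (t : ℕ) (ω : Ω) : ‖p.dualMove τ W x y i t ω‖ ≤ 2 * K :=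
  hr.assumptions.norm_sub_le_of_mem_dualSet (hr.z_mem t ω i) (hr.y_mem t ω i)

theorem integrable_norm_dualMove_sq (i : Fin n) (t : ℕ) :
    Integrable (fun ω => ‖p.dualMove τ W x y i t ω‖ ^ 2) μ := by
  have := hr.isProbabilityMeasure
  exact (MemLp.of_bound ((hr.measurable_dualMove i t).mono (hr.pastDual_le t)
    le_rfl).aestronglyMeasurable (2 * K)
    (ae_of_all _ (hr.norm_dualMove_le i t))).integrable_norm_pow two_ne_zero

theorem measurable_samplingNoise (i : Fin n) {k t : ℕ} (hk : k < t) :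
    Measurable[past W t] (p.samplingNoise S τ W x y i k) := by
  have hblock : Measurable[past W t] fun ω => (W k ω).1 :=
    measurable_fst.comp (measurable_past W hk)
  have hdev : Measurable[past W t] fun ω => samplingDev S (W k ω).1 i :=
    measurable_samplingDev S hblock i
  exact hdev.smul ((hr.measurable_dualMove i k).mono (pastDual_le_past W hk) le_rfl)

theorem memLp_samplingNoise (i : Fin n) (t : ℕ) :
    MemLp (p.samplingNoise S τ W x y i t) 2 μ := by
  have := hr.isProbabilityMeasure
  refine MemLp.of_bound ((hr.measurable_samplingNoise i t.lt_succ_self).mono (hr.past_le _)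
    le_rfl).aestronglyMeasurable (2 * (2 * K)) (ae_of_all _ fun ω => ?_)
  rw [Problem.samplingNoise, norm_smul]
  exact mul_le_mul (abs_samplingDev_le S _ i) (hr.norm_dualMove_le i t ω) (norm_nonneg _)
    zero_le_two

theorem integral_inner_samplingNoise_sum (i : Fin n) (t : ℕ) :
    ∫ ω, ⟪p.samplingNoise S τ W x y i t ω,
      ∑ k ∈ Finset.range t, p.samplingNoise S τ W x y i k ω⟫ ∂μ = 0 := by
  have hsum : Measurable[pastDual W t]
      fun ω => ∑ k ∈ Finset.range t, p.samplingNoise S τ W x y i k ω :=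
    Finset.measurable_fun_sum _ fun k hk =>
      (hr.measurable_samplingNoise i (Finset.mem_range.1 hk)).mono le_sup_left le_rfl
  have hmove := hr.integral_samplingDev_mul i ((hr.measurable_dualMove i t).inner hsum)
  simp only [← real_inner_smul_left] at hmove
  exact hmove

theorem integral_norm_samplingNoise_sq_le (i : Fin n) (t : ℕ) :
    ∫ ω, ‖p.samplingNoise S τ W x y i t ω‖ ^ 2 ∂μ
      ≤ 1 / n * (1 / S) * ∫ ω, ‖p.dualMove τ W x y i t ω‖ ^ 2 ∂μ := by
  simp only [Problem.samplingNoise, norm_smul, mul_pow, Real.norm_eq_abs, sq_abs]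
  have hnorm : Measurable fun v : Vec m => ‖v‖ ^ 2 := measurable_norm.pow_const 2
  exact hr.integral_samplingDev_sq_mul_le i (hnorm.comp (hr.measurable_dualMove i t))
    fun ω => by positivity

theorem integralLE_samplingNoise (i : Fin n) (T : ℕ) :
    IntegralLE μ (fun ω =>
      τ / (8 * (1 / (S : ℝ))) * ‖∑ t ∈ Finset.range T, p.samplingNoise S τ W x y i t ω‖ ^ 2
        - 1 / (n : ℝ) * (τ / 8 * ∑ t ∈ Finset.range T, ‖p.dualMove τ W x y i t ω‖ ^ 2)) 0 := by
  have hτ := hr.τ_pos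
  have hS : (0 : ℝ) < S := Nat.cast_pos.2 hr.S_pos
  have hnoise := (memLp_finsetSum (Finset.range T) fun t _ =>
    hr.memLp_samplingNoise i t).integrable_norm_pow two_ne_zero
  have hmove := integrable_finsetSum (Finset.range T) fun t _ => hr.integrable_norm_dualMove_sq i t
  refine ⟨(hnoise.const_mul _).sub ((hmove.const_mul _).const_mul _), ?_⟩
  rw [integral_sub (hnoise.const_mul _) ((hmove.const_mul _).const_mul _), integral_const_mul,
    integral_const_mul, integral_const_mul,
    integral_norm_sum_range_sq (hr.memLp_samplingNoise i) (hr.integral_inner_samplingNoise_sum i),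
    integral_finsetSum _ fun t _ => hr.integrable_norm_dualMove_sq i t, sub_nonpos]
  calc τ / (8 * (1 / (S : ℝ)))
        * ∑ t ∈ Finset.range T, ∫ ω, ‖p.samplingNoise S τ W x y i t ω‖ ^ 2 ∂μ
      ≤ τ / (8 * (1 / (S : ℝ))) * ∑ t ∈ Finset.range T,
        1 / n * (1 / S) * ∫ ω, ‖p.dualMove τ W x y i t ω‖ ^ 2 ∂μ := by
        gcongr with t
        exact hr.integral_norm_samplingNoise_sq_le i t
    _ = _ := by
        rw [← Finset.mul_sum]
        field_simp

theorem integralLE_blockQuadraticTerm (T : ℕ) (i : Fin n) :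
    IntegralLE μ (fun ω => p.blockQuadraticTerm S τ (p.trajectory S τ W x y ω) T i)
      (1 / n * (T * (25 * s₀ ^ 2 / (B * τ)))) := by
  have hτ := hr.τ_pos
  have hB : (0 : ℝ) < B := Nat.cast_pos.2 hr.B_pos
  have hsum_sq := ((hr.integralLE_norm_sum_innerErr_sq i T).const_mul
    (show (0 : ℝ) ≤ 1 / (2 * τ) by positivity)).const_mul (show (0 : ℝ) ≤ 1 / n by positivity)
  have hsq (t : ℕ) : IntegralLE μ (fun ω => ‖p.innerErr W x i t ω‖ ^ 2) (10 * s₀ ^ 2 / B) :=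
    ⟨(hr.memLp_innerErr i t).1.integrable_norm_pow two_ne_zero, (hr.memLp_innerErr i t).2⟩
  have hsq_sum := ((IntegralLE.sum (Finset.range T) hsq).const_mul
    (show (0 : ℝ) ≤ 2 / τ by positivity)).const_mul (show (0 : ℝ) ≤ 1 / n by positivity)
  have hbound := (hsum_sq.add hsq_sum).add (hr.integralLE_samplingNoise i T)
  rw [Finset.card_range] at hbound
  refine ⟨hbound.1, hbound.2.trans_eq ?_⟩
  field_simp
  ring

theorem integralLE_quadraticTerm (T : ℕ) :
    IntegralLE μ (fun ω => p.quadraticTerm S η τ (p.trajectory S τ W x y ω) T)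
      (T * (4 * (K ^ 2 * s₁ ^ 2 + δ ^ 2) / (η * S) + 25 * s₀ ^ 2 / (B * τ))) := by
  have hη := hr.η_pos
  have hn : (0 : ℝ) < n := Nat.cast_pos.2 (hr.S_pos.trans_le hr.S_le)
  have hgrad (t : ℕ) : IntegralLE μ (fun ω => ‖p.gradErr S τ W x y t ω‖ ^ 2)
      (2 * (K ^ 2 * s₁ ^ 2 + δ ^ 2) / S) :=
    ⟨(hr.memLp_gradErr t).1.integrable_norm_pow two_ne_zero, (hr.memLp_gradErr t).2⟩
  have hbound := ((IntegralLE.sum (Finset.range T) hgrad).const_mul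
    (show (0 : ℝ) ≤ 2 / η by positivity)).add
    (IntegralLE.sum Finset.univ (hr.integralLE_blockQuadraticTerm T))
  rw [Finset.card_range, Finset.card_univ, Fintype.card_fin] at hbound
  refine ⟨hbound.1, hbound.2.trans_eq ?_⟩
  field_simp
  ring

end RegularRun

end ErrorTerms

/-! ### The convergence bound -/

section Bound

variable {n d m : ℕ} {Z : Type*} [MeasurableSpace Z] {p : Problem n d m Z}
  {K G Λ s₀ s₁ δ η τ : ℝ} {S B : ℕ} {x₀ : Vec d} {y₀ : Fin n → Vec m} {Ω : Type*}
  {mΩ : MeasurableSpace Ω} {μ : Measure Ω} {W : ℕ → Ω → Sample n B Z}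
  {x : ℕ → Ω → Vec d} {y : ℕ → Ω → Fin n → Vec m} {yt : Ω → Fin n → Vec m}

theorem radius_quad_nonneg (μ : Measure Ω) (yt : Ω → Fin n → Vec m) (y₀ : Fin n → Vec m) :
    0 ≤ radius μ quad yt y₀ := by
  refine integral_nonneg fun ω => Finset.sum_nonneg fun i _ => ?_
  rw [bregman_quad]
  positivity

namespace RegularRun

variable (hr : RegularRun p K G Λ s₀ s₁ δ S B η τ x₀ y₀ μ W x y)
include hr

theorem integralLE_sum_norm_sub_sq (hm : Measurable yt) (hyt : ∀ ω i, yt ω i ∈ dualSet (p.f i)) :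
    IntegralLE μ (fun ω => ∑ i, ‖yt ω i - y₀ i‖ ^ 2) (2 * radius μ quad yt y₀) := by
  have := hr.isProbabilityMeasure
  have hmem (i : Fin n) : MemLp (fun ω => yt ω i - y₀ i) 2 μ :=
    MemLp.of_bound (((measurable_pi_apply i).comp hm).sub_const (y₀ i)).aestronglyMeasurable
      (2 * K) (ae_of_all _ fun ω =>
        hr.assumptions.norm_sub_le_of_mem_dualSet (hyt ω i) (hr.y₀_mem i))
  refine ⟨integrable_finsetSum _ fun i _ => (hmem i).integrable_norm_pow two_ne_zero, le_of_eq ?_⟩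
  simp only [radius, bregman_quad, ← Finset.mul_sum, integral_const_mul]
  ring

theorem exists_gap_le {xs : Vec d} (hxs : xs ∈ p.dom) (hmin : IsMinOn p.F p.X xs)
    (hηΛ : 4 * K * Λ ≤ η) (hητ : 32 * G ^ 2 ≤ η * τ) {T : ℕ} (hT : 0 < T)
    (hyt : IsDualSelection p (average x T) yt) (ω : Ω) :
    ∃ a : ℝ, 0 ≤ a ∧ p.F (average x T ω) - p.F xs = a ∧
      a ≤ 1 / T * (η / 2 * ‖x₀ - xs‖ ^ 2 + 8 * K ^ 2 * G ^ 2 / η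
        + 3 * τ * (1 / S) * ∑ i, ‖yt ω i - y₀ i‖ ^ 2
        + p.martingaleTerm S τ xs (p.trajectory S τ W x y ω) T
        + p.quadraticTerm S η τ (p.trajectory S τ W x y ω) T) := by
  have htr := hr.isTrajectory ω
  have hdom (t : ℕ) : x (t + 1) ω ∈ p.dom := (htr.primal_step t).1
  have hxb : average x T ω ∈ p.dom :=
    smul_sum_mem_of_convex hr.assumptions.convexOn_r.1 hT hdom
  refine ⟨p.realF (average x T ω) - p.realF xs,
    sub_nonneg.2 (hr.assumptions.realF_le_of_isMinOn hxs hmin hxb), ?_, ?_⟩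
  · rw [hr.assumptions.F_eq_coe hxb, hr.assumptions.F_eq_coe hxs, EReal.coe_sub]
  · obtain ⟨T, rfl⟩ := Nat.exists_eq_succ_of_ne_zero hT.ne'
    have hgap := hr.assumptions.mul_realF_sub_le xs hT hdom (hyt.2 ω)
      (v := fun t => p.dualIter τ W x y t ω) fun t i => (htr.dual_step t i).1
    have hsum := hr.assumptions.sum_lagrangian_sub_le hr.S_pos hr.S_le hr.η_pos hr.τ_pos hηΛ hητ
      htr hxs (w := yt ω) (fun i => conj_lt_top_of_isMaxOn (hyt.2 ω i).1 (hyt.2 ω i).2) T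
    simp only [Problem.trajectory, hr.run.x_zero, hr.run.y_zero] at hsum
    rw [one_div, ← div_eq_inv_mul, le_div_iff₀' (Nat.cast_pos.2 hT)]
    exact hgap.trans hsum

theorem lintegral_gap_le {xs : Vec d} (hxs : xs ∈ p.X) (hmin : IsMinOn p.F p.X xs)
    (hηΛ : 4 * K * Λ ≤ η) (hητ : 32 * G ^ 2 ≤ η * τ) {T : ℕ} (hT : 0 < T)
    (hyt : IsDualSelection p (average x T) yt) :
    ∫⁻ ω, (p.F (average x T ω) - p.F xs).toENNReal ∂μ
      ≤ ENNReal.ofReal (1 / T * (η / 2 * ‖x₀ - xs‖ ^ 2 + 8 * K ^ 2 * G ^ 2 / η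
        + 6 * τ * (1 / S) * radius μ quad yt y₀)
        + (4 * (K ^ 2 * s₁ ^ 2 + δ ^ 2) / (η * S) + 25 * s₀ ^ 2 / (B * τ))) := by
  have := hr.isProbabilityMeasure
  have hτ := hr.τ_pos
  have hdom : xs ∈ p.dom := hr.assumptions.mem_dom_of_isMinOn hxs hmin
  have hradius := (hr.integralLE_sum_norm_sub_sq hyt.1 fun ω i => (hyt.2 ω i).1).const_mul
    (show 0 ≤ 3 * τ * (1 / (S : ℝ)) by positivity)
  have hbound := ((((IntegralLE.const (μ := μ)
    (η / 2 * ‖x₀ - xs‖ ^ 2 + 8 * K ^ 2 * G ^ 2 / η)).add hradius).add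
      (hr.integralLE_martingaleTerm hdom hmin T)).add (hr.integralLE_quadraticTerm T)).const_mul
        (show (0 : ℝ) ≤ 1 / T by positivity)
  refine (hbound.lintegral_toENNReal_le
    (hr.exists_gap_le hdom hmin hηΛ hητ hT hyt)).trans_eq (congrArg ENNReal.ofReal ?_)
  field_simp
  ring

end RegularRun

end Bound

/-! ### The choice of the step sizes -/

section StepSizes

variable {K G Λ V s₀ D K₀ C S B ε R T : ℝ}

theorem four_mul_mul_le_step (hK₀ : 1 ≤ K₀) (hS : 0 < S) (hε : 0 < ε)
    (h : 4 * |K * Λ| * S * ε ≤ 1) : 4 * K * Λ ≤ K₀ / (S * ε) := by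
  rw [le_div_iff₀ (by positivity)]
  calc 4 * K * Λ * (S * ε) = 4 * (K * Λ) * S * ε := by ring
    _ ≤ 4 * |K * Λ| * S * ε := by
        gcongr
        exact le_abs_self _
    _ ≤ K₀ := h.trans hK₀

theorem thirtyTwo_mul_sq_le_step_mul_step (hK₀ : 1 ≤ K₀) (hS : 1 ≤ S) (hB : 1 ≤ B) (hε : 0 < ε)
    (h : 6 * |G| * S * B * ε ≤ 1) : 32 * G ^ 2 ≤ K₀ / (S * ε) * (K₀ / (B * ε)) := by
  have hSB : 1 ≤ S * B := one_le_mul_of_one_le_of_one_le hS hB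
  have : 0 < S * B := zero_lt_one.trans_le hSB
  rw [div_mul_div_comm, le_div_iff₀ (by positivity)]
  calc 32 * G ^ 2 * (S * ε * (B * ε)) = 32 * G ^ 2 * (S * B * ε ^ 2) * 1 := by ring
    _ ≤ 36 * G ^ 2 * (S * B * ε ^ 2) * (S * B) := by
        gcongr
        norm_num
    _ = (6 * |G| * S * B * ε) ^ 2 := by
        simp only [mul_pow, sq_abs]
        ring
    _ ≤ 1 := pow_le_one₀ (by positivity) h
    _ ≤ K₀ * K₀ := one_le_mul_of_one_le_of_one_le hK₀ hK₀

theorem primal_start_error_le (hS : 0 < S) (hε : 0 < ε) (hC : 5 / 2 * (K₀ * D ^ 2) ≤ C)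
    (hT : C * (1 / S) * (1 / ε ^ 2) ≤ T) : K₀ / (S * ε) / 2 * D ^ 2 ≤ ε / 5 * T :=
  calc K₀ / (S * ε) / 2 * D ^ 2 = ε / 5 * (5 / 2 * (K₀ * D ^ 2) * (1 / S) * (1 / ε ^ 2)) := by
        field_simp
    _ ≤ ε / 5 * (C * (1 / S) * (1 / ε ^ 2)) := by gcongr
    _ ≤ ε / 5 * T := by gcongr

theorem coupling_end_error_le (hK₀ : 1 ≤ K₀) (hS : 0 < S) (hε : 0 < ε)
    (h : 2 * |K * G| * S * ε ≤ 1) (hC : 10 ≤ C) (hT : C * (1 / S) * (1 / ε ^ 2) ≤ T) :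
    8 * K ^ 2 * G ^ 2 / (K₀ / (S * ε)) ≤ ε / 5 * T :=
  calc 8 * K ^ 2 * G ^ 2 / (K₀ / (S * ε)) = (2 * |K * G| * S * ε) ^ 2 * (2 / (S * ε * K₀)) := by
        simp only [mul_pow, sq_abs]
        field_simp
        ring
    _ ≤ 1 * (2 / (S * ε * 1)) := by
        gcongr
        exact pow_le_one₀ (by positivity) h
    _ = ε / 5 * (10 * (1 / S) * (1 / ε ^ 2)) := by
        field_simp
        norm_num
    _ ≤ ε / 5 * (C * (1 / S) * (1 / ε ^ 2)) := by gcongr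
    _ ≤ ε / 5 * T := by gcongr

theorem dual_start_error_le (hS : 0 < S) (hB : 0 < B) (hε : 0 < ε) (hR : 0 ≤ R)
    (hC : 30 * K₀ ≤ C) (hT : C * (R / (B * S)) * (1 / ε ^ 2) ≤ T) :
    6 * (K₀ / (B * ε)) * (1 / S) * R ≤ ε / 5 * T :=
  calc 6 * (K₀ / (B * ε)) * (1 / S) * R = ε / 5 * (30 * K₀ * (R / (B * S)) * (1 / ε ^ 2)) := by
        field_simp
        ring
    _ ≤ ε / 5 * (C * (R / (B * S)) * (1 / ε ^ 2)) := by gcongr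
    _ ≤ ε / 5 * T := by gcongr

theorem mul_div_step_mul_le {a : ℝ} (ha : 0 < a) (hK₀ : 0 < K₀) (hS : 0 < S) (hε : 0 < ε)
    (h : 5 * a * V ≤ K₀) : a * V / (K₀ / (S * ε) * S) ≤ ε / 5 :=
  calc a * V / (K₀ / (S * ε) * S) = ε / 5 * (5 * a * V / K₀) := by field_simp
    _ ≤ ε / 5 := mul_le_of_le_one_right (by positivity) ((div_le_one hK₀).2 h)

theorem error_bound_le (hK₀ : 1 ≤ K₀) (hS : 0 < S) (hB : 0 < B) (hε : 0 < ε) (hR : 0 ≤ R)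
    (hKG : 2 * |K * G| * S * ε ≤ 1) (hV : 20 * V ≤ K₀) (hs₀ : 125 * s₀ ^ 2 ≤ K₀)
    (hC : 30 * K₀ + 5 / 2 * (K₀ * D ^ 2) ≤ C) (hT0 : 0 < T)
    (hTS : C * (1 / S) * (1 / ε ^ 2) ≤ T) (hTR : C * (R / (B * S)) * (1 / ε ^ 2) ≤ T) :
    1 / T * (K₀ / (S * ε) / 2 * D ^ 2 + 8 * K ^ 2 * G ^ 2 / (K₀ / (S * ε))
        + 6 * (K₀ / (B * ε)) * (1 / S) * R)
      + (4 * V / (K₀ / (S * ε) * S) + 25 * s₀ ^ 2 / (B * (K₀ / (B * ε)))) ≤ ε := by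
  have hK₀0 : 0 < K₀ := zero_lt_one.trans_le hK₀
  have hK₀D : 0 ≤ K₀ * D ^ 2 := by positivity
  have hstart := add_le_add (add_le_add
    (primal_start_error_le (K₀ := K₀) (D := D) hS hε (by linarith) hTS)
    (coupling_end_error_le hK₀ hS hε hKG (by linarith) hTS))
    (dual_start_error_le (K₀ := K₀) hS hB hε hR (by linarith) hTR)
  rw [← add_mul, ← add_mul, ← div_le_iff₀ hT0, div_eq_inv_mul, ← one_div] at hstart
  have hgrad := mul_div_step_mul_le (V := V) four_pos hK₀0 hS hε (by linarith)
  have hinner := mul_div_step_mul_le (V := s₀ ^ 2) (a := 25) (by norm_num) hK₀0 hB hε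
    (by linarith)
  rw [mul_comm B (K₀ / (B * ε))]
  linarith

theorem exists_stepSizes (K G Λ s₀ D : ℝ) {V : ℝ} (hV : 0 ≤ V) :
    ∃ C : ℝ, 0 < C ∧ ∀ S B : ℕ, 1 ≤ S → 1 ≤ B → ∃ ε₀ : ℝ, 0 < ε₀ ∧ ∀ ε : ℝ, 0 < ε → ε ≤ ε₀ →
    ∃ η τ : ℝ, 0 < η ∧ η ≤ C / ε ∧ 0 < τ ∧ τ ≤ C / (B * ε) ∧
      4 * K * Λ ≤ η ∧ 32 * G ^ 2 ≤ η * τ ∧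
      ∀ R T : ℝ, 0 ≤ R → C * max (1 / (S : ℝ)) (R / (B * S)) * (1 / ε ^ 2) ≤ T →
        0 < T ∧ 1 / T * (η / 2 * D ^ 2 + 8 * K ^ 2 * G ^ 2 / η + 6 * τ * (1 / S) * R)
          + (4 * V / (η * S) + 25 * s₀ ^ 2 / (B * τ)) ≤ ε := by
  have hs := sq_nonneg s₀
  set K₀ : ℝ := 1 + 20 * V + 125 * s₀ ^ 2 with hK₀
  have hK₀1 : 1 ≤ K₀ := by linarith [hK₀]
  have hK₀D : 0 ≤ K₀ * D ^ 2 := by positivity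
  set C : ℝ := 30 * K₀ + 5 / 2 * (K₀ * D ^ 2) with hC
  have hC0 : 0 < C := by linarith
  -- below this threshold `4|KΛ|Sε`, `6|G|SBε` and `2|KG|Sε` are all at most `1`
  refine ⟨C, hC0, fun S B hS hB =>
    ⟨1 / (1 + 4 * |K * Λ| * S + 6 * |G| * S * B + 2 * |K * G| * S), by positivity,
      fun ε hε hεle => ?_⟩⟩
  have hS1 : (1 : ℝ) ≤ S := Nat.one_le_cast.2 hS
  have hB1 : (1 : ℝ) ≤ B := Nat.one_le_cast.2 hB
  have hS0 : (0 : ℝ) < S := by linarith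
  have hB0 : (0 : ℝ) < B := by linarith
  rw [le_div_iff₀ (by positivity), mul_add, mul_add, mul_add, mul_one] at hεle
  have hΛ : 0 ≤ ε * (4 * |K * Λ| * S) := by positivity
  have hG : 0 ≤ ε * (6 * |G| * S * B) := by positivity
  have hKG : 0 ≤ ε * (2 * |K * G| * S) := by positivity
  have hη : K₀ / (S * ε) ≤ C / ε := by
    gcongr
    · linarith
    · exact le_mul_of_one_le_left hε.le hS1
  refine ⟨K₀ / (S * ε), K₀ / (B * ε), by positivity, hη, by positivity, by gcongr; linarith,
    four_mul_mul_le_step hK₀1 hS0 hε (by linarith),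
    thirtyTwo_mul_sq_le_step_mul_step hK₀1 hS1 hB1 hε (by linarith), fun R T hR hT => ?_⟩
  have hTS : C * (1 / S) * (1 / ε ^ 2) ≤ T := le_trans (by gcongr; exact le_max_left _ _) hT
  have hTR : C * (R / (B * S)) * (1 / ε ^ 2) ≤ T := le_trans (by gcongr; exact le_max_right _ _) hT
  have hT0 : 0 < T := lt_of_lt_of_le (by positivity) hTS
  exact ⟨hT0, error_bound_le hK₀1 hS0 hB0 hε hR (by linarith) (by linarith) (by linarith) le_rfl
    hT0 hTS hTR⟩

end StepSizes

end ALEXR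

end

theorem theorem3_general (K G Λ s₀ s₁ δ D : ℝ) :
    ∃ C : ℝ, 0 < C ∧ ∀ S B : ℕ, 1 ≤ S → 1 ≤ B →
    ∃ ε₀ : ℝ, 0 < ε₀ ∧ ∀ ε : ℝ, 0 < ε → ε ≤ ε₀ →
    ∃ η τ : ℝ, 0 < η ∧ η ≤ C / ε ∧ 0 < τ ∧ τ ≤ C / (B * ε) ∧
    ∀ (n d m : ℕ), S ≤ n → ∀ (Z : Type*) [MeasurableSpace Z] (p : ALEXR.Problem n d m Z),
      p.EuclideanAssumptions K G Λ s₀ s₁ δ →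
    ∀ xs ∈ p.X, IsMinOn p.F p.X xs →
    ∀ x₀ ∈ p.X, ‖x₀ - xs‖ ≤ D →
    ∀ y₀ : Fin n → ALEXR.Vec m, (∀ i, y₀ i ∈ ALEXR.dualSet (p.f i)) →
    ∀ (Ω : Type*) [MeasurableSpace Ω] (μ : Measure Ω)
      (W : ℕ → Ω → ALEXR.Sample n B Z) (x : ℕ → Ω → ALEXR.Vec d)
      (y : ℕ → Ω → Fin n → ALEXR.Vec m),
      ALEXR.IsRun p S B ALEXR.quad 1 η τ x₀ y₀ μ W x y →
    ∀ (T : ℕ) (yt : Ω → Fin n → ALEXR.Vec m),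
      ALEXR.IsDualSelection p (ALEXR.average x T) yt →
      C * max (1 / (S : ℝ)) (ALEXR.radius μ ALEXR.quad yt y₀ / (B * S)) * (1 / ε ^ 2) ≤ T →
      ∫⁻ ω, (p.F (ALEXR.average x T ω) - p.F xs).toENNReal ∂μ ≤ ENNReal.ofReal ε := by
  obtain ⟨C, hC, hsteps⟩ := ALEXR.exists_stepSizes K G Λ s₀ D
    (V := K ^ 2 * s₁ ^ 2 + δ ^ 2) (by positivity)
  refine ⟨C, hC, fun S B hS hB => ?_⟩
  obtain ⟨ε₀, hε₀, hsteps⟩ := hsteps S B hS hB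
  refine ⟨ε₀, hε₀, fun ε hε hεle => ?_⟩
  obtain ⟨η, τ, hη, hηle, hτ, hτle, hηΛ, hητ, hbound⟩ := hsteps ε hε hεle
  refine ⟨η, τ, hη, hηle, hτ, hτle, ?_⟩
  intro n d m hSn Z _ p hp xs hxs hmin x₀ hx₀ hD y₀ hy₀ Ω _ μ W x y hrun T yt hyt hT
  have hr : ALEXR.RegularRun p K G Λ s₀ s₁ δ S B η τ x₀ y₀ μ W x y :=
    ⟨hp, hrun, hS, hSn, hB, hη, hτ, hx₀, hy₀⟩
  obtain ⟨hT0, herr⟩ := hbound _ T (ALEXR.radius_quad_nonneg μ yt y₀) hT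
  refine (hr.lintegral_gap_le hxs hmin hηΛ hητ (Nat.cast_pos.1 hT0) hyt).trans
    (ENNReal.ofReal_le_ofReal (le_trans ?_ herr))
  gcongr

theorem theorem3 (Cf Cg Lg σ₀ σ₁ δ D μψ Lψ : ℝ) (hCf : 0 < Cf) (hCg : 0 < Cg) (hLg : 0 < Lg)
    (hσ₀ : 0 ≤ σ₀) (hσ₁ : 0 ≤ σ₁) (hδ : 0 ≤ δ) (hD : 0 ≤ D) (hμψ : 0 < μψ) (hLψ : 0 < Lψ) :
    -- the hidden constant depends on the constants above only
    ∃ C : ℝ, 0 < C ∧ ∀ S B : ℕ, 1 ≤ S → 1 ≤ B →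
    -- the accuracy is small enough, and the step sizes depend on constants, batch sizes, accuracy
    ∃ ε₀ : ℝ, 0 < ε₀ ∧ ∀ ε : ℝ, 0 < ε → ε ≤ ε₀ →
    ∃ η τ : ℝ, 0 < η ∧ η ≤ C / ε ∧ 0 < τ ∧ τ ≤ C / (B * ε) ∧
    -- every problem, with a norm for which the quadratic is strongly convex and smooth
    ∀ (n d m : ℕ), S ≤ n → ∀ (Z : Type*) [MeasurableSpace Z] (p : ALEXR.Problem n d m Z)
      (q : Seminorm ℝ (ALEXR.Vec m)),
      (∀ v, μψ * q v ^ 2 ≤ ‖v‖ ^ 2 ∧ ‖v‖ ^ 2 ≤ Lψ * q v ^ 2) →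
      p.Assumptions q Cf Cg Lg σ₀ σ₁ δ →
    ∀ xs ∈ p.X, IsMinOn p.F p.X xs →
    ∀ x₀ ∈ p.X, ‖x₀ - xs‖ ≤ D →
    ∀ y₀ : Fin n → ALEXR.Vec m, (∀ i, y₀ i ∈ ALEXR.dualSet (p.f i)) →
    -- every run of the algorithm
    ∀ (Ω : Type*) [MeasurableSpace Ω] (μ : Measure Ω) [IsProbabilityMeasure μ]
      (W : ℕ → Ω → ALEXR.Sample n B Z) (x : ℕ → Ω → ALEXR.Vec d)
      (y : ℕ → Ω → Fin n → ALEXR.Vec m),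
      ALEXR.IsRun p S B ALEXR.quad 1 η τ x₀ y₀ μ W x y →
    -- the number of iterations
    ∀ (T : ℕ) (yt : Ω → Fin n → ALEXR.Vec m),
      ALEXR.IsDualSelection p (ALEXR.average x T) yt →
      C * max (1 / (S : ℝ)) (ALEXR.radius μ ALEXR.quad yt y₀ / (B * S)) * (1 / ε ^ 2) ≤ T →
      ∫⁻ ω, (p.F (ALEXR.average x T ω) - p.F xs).toENNReal ∂μ ≤ ENNReal.ofReal ε := by
  obtain ⟨C, hC, hS⟩ := theorem3_general (Cf * √Lψ) (Cg / √μψ) (Lg / √μψ) (σ₀ / √μψ) (σ₁ / √μψ) δ D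
  refine ⟨C, hC, fun S B hS₁ hB₁ => (hS S B hS₁ hB₁).imp fun _ => And.imp_right ?_⟩
  intro hε ε hε₀ hεle
  obtain ⟨η, τ, hη, hηle, hτ, hτle, hgap⟩ := hε ε hε₀ hεle
  refine ⟨η, τ, hη, hηle, hτ, hτle, fun n d m hSn Z _ p q hq hp xs hxs hmin x₀ hx₀ hD₀ y₀ hy₀ => ?_⟩
  have hp' := hp.euclidean hCf.le hμψ hLψ.le hq
  exact fun Ω _ μ _ => hgap n d m hSn Z p hp' xs hxs hmin x₀ hx₀ hD₀ y₀ hy₀ Ω μ
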